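/- Let $k$ be a finite field of characteristic $p$, and let $W_2(k)$ be its ring of Witt vectors of length $2$. \textbf{The cube construction.} For a $k$-vector space $V$ and $n\ge 0$, an $n$-cube in $V$ is a map $f:\{0,1\}^n\to V$. Let $\overline{Q}_n(V)$ be the $k$-vector space spanned by symbols $[f]$, $f$ an $n$-cube in $V$, modulo the relations $[0]=0$; $[\lambda f]=\lambda[f]$ for $\lambda\in k^*$; and $[f]=0$ whenever $f$ is supported on one of the $2n$ faces $\{x_j=\varepsilon\}$. For $n\geq 1$ the differential $d:\overline{Q}_n(V)\to\overline{Q}_{n-1}(V)$ is $d[f]=\sum_{j=1}^{n}(-1)^j\bigl([f|_{x_j=0}+f|_{x_j=1}]-[f|_{x_j=0}]-[f|_{x_j=1}]\bigr)$. If $A$ is an associative unital $k$-algebra, $\overline{Q}_\bullet(A)$ is a DG algebra over $k$ with product $[f]\cdot[g]=[(x,y)\mapsto f(x)g(y)]$ and unit $[1]$, and there is an augmentation $\overline{Q}_\bullet(A)\to A$, given by $[v]\mapsto v$ in degree $0$. Let $V^\flat_\bullet$ be the two-term quotient complex $V^\flat_1=\overline{Q}_1(V)/\operatorname{Im} d\to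 V^\flat_0=\overline{Q}_0(V)$, and let $\overline{Q}_{\le 1}(V)$ be the quotient of $\overline{Q}_\bullet(V)$ with terms $\overline{Q}_0(V)$, $\overline{Q}_1(V)$, $\overline{Q}_2(V)/\operatorname{Ker} d$ in degrees $0,1,2$ and zero above. For $V=A$ both are quotient DG algebras of $\overline{Q}_\bullet(A)$, and the augmentation factors through $\overline{Q}_{\le 1}(A)\to A$. \textbf{Splittings.} A \emph{splitting} of a two-term complex $d:K_1\to K_0$ of $k$-vector spaces is a $k$-vector space $K_{01}$ with a surjection $a:K_{01}\to K_0$ and an injection $b:K_1\to K_{01}$ such that $ab=d$, $b$ induces an isomorphism $\operatorname{Ker} d\to\operatorname{Ker} a$, and $a$ induces an isomorphism $\operatorname{Coker} b\to\operatorname{Coker} d$; if $K_\bullet$ is a DG algebra, the splitting is \emph{multiplicative} if $K_{01}$ is a $k$-algebra, $a$ is an algebra map, and $b$ is a map of $K_{01}$-bimodules. With isomorphisms compatible with $a$ and $b$ (and, in the second case, with the products), these form groupoids $\operatorname{Spl}(K_\bullet)$ and $\operatorname{Spl}^{\mathrm{mult}}(K_\bullet)$. A \emph{DG splitting} of a DG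 algebra map $B'_\bullet\to B_\bullet$ is a DG algebra map $s:\widetilde{B}_\bullet\to B'_\bullet$ such that the composition $\widetilde{B}_\bullet\to B_\bullet$ is a surjective quasi-isomorphism. \textbf{Liftings.} Let $\operatorname{Lift}(V)$ be the groupoid of flat $W_2(k)$-modules $V'$ equipped with an isomorphism $V'/p\cong V$ of $k$-vector spaces. For a $k$-algebra $A$, let $\operatorname{Lift}^{\mathrm{alg}}(A)$ be the groupoid of flat $W_2(k)$-algebras $A'$ equipped with an isomorphism $A'/p\cong A$ of $k$-algebras. All algebras are associative and unital. \textbf{Statement.} \begin{enumerate} \item There are equivalences of groupoids $e_V:\operatorname{Lift}(V)\cong\operatorname{Spl}(V^\flat_\bullet)$ for all $k$-vector spaces $V$. They are functorial in $V$: a $W_2(k)$-linear map $V'\to W'$ of flat liftings over a $k$-linear map $f:V\to W$ induces a map $e_V(V')\to e_W(W')$ compatible with $a$, $b$ and $f^\flat:V^\flat_\bullet\to W^\flat_\bullet$; this respects compositions, and for isomorphisms over $\operatorname{id}_V$ it is the action of the functor $e_V$ on morphisms. \item For every $k$-algebra $A$, the equivalence $e_A$ identifies flat algebra liftings with multiplicative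 splittings: there is an equivalence $\operatorname{Lift}^{\mathrm{alg}}(A)\cong\operatorname{Spl}^{\mathrm{mult}}(A^\flat_\bullet)$ that is compatible, up to a natural isomorphism, with $e_A$ and with the functors forgetting the products. \item To every pair of a $k$-algebra $A$ and a flat algebra lifting $A'$ of $A$ to $W_2(k)$ one can associate a DG splitting $A_\bullet\to\overline{Q}_{\le 1}(A)$ of the projection $\overline{Q}_{\le 1}(A)\to A$, functorially in the pair $(A,A')$ (with respect to all pairs of compatible algebra maps $A\to B$, $A'\to B'$). \end{enumerate} -/

import Mathlib

open CategoryTheory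

universe u

noncomputable section

namespace CubeConstruction

/-- An `n`-cube in `V`: a family of vectors indexed by the vertices of the cube `{0,1}ⁿ`. -/
abbrev Cube (V : Type u) (n : ℕ) : Type u := (Fin n → Bool) → V

/-- The restriction of a cube to the face on which the `j`-th coordinate is `b`. -/
def Cube.face {V : Type u} {n : ℕ} (j : Fin (n + 1)) (b : Bool) (f : Cube V (n + 1)) : Cube V n :=
  fun x => f (Fin.insertNth (α := fun _ => Bool) j b x)

/-- A slab: a cube supported on a single face of codimension one. -/
def Cube.IsSlab {V : Type u} [Zero V] {n : ℕ} (f : Cube V n) : Prop :=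
  ∃ (i : Fin n) (b : Bool), ∀ x, x i ≠ b → f x = 0

section QBar

variable (k : Type u) [Field k] (V : Type u) [AddCommGroup V] [Module k V] (n : ℕ)

/-- The relations imposed on the `k`-linear span of the `n`-cubes in `V`: the zero cube vanishes
(reduced span), slabs vanish (normalization), and `[λ f] = λ [f]` for `λ ∈ kˣ` (coinvariants of
the action `λ · a [f] = λ⁻¹ a [λ f]` of `kˣ`). -/
def QBar.rel : Submodule k (Cube V n →₀ k) :=
  Submodule.span k
    ({Finsupp.single 0 1} ∪ {r | ∃ f : Cube V n, f.IsSlab ∧ r = Finsupp.single f 1} ∪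
      {r | ∃ (c : kˣ) (f : Cube V n),
        r = Finsupp.single ((c : k) • f) 1 - (c : k) • Finsupp.single f 1})

/-- The degree `n` term of the cube construction `Q̄(V)`. -/
abbrev QBar : Type u := (Cube V n →₀ k) ⧸ QBar.rel k V n

end QBar

namespace QBar

variable {k : Type u} [Field k] {V W A : Type u} [AddCommGroup V] [Module k V]
  [AddCommGroup W] [Module k W] [Ring A] [Algebra k A] {n : ℕ}

variable (k) in
/-- The class of a cube. -/
def mk (f : Cube V n) : QBar k V n := Submodule.Quotient.mk (Finsupp.single f 1)

theorem mk_zero : mk k (0 : Cube V n) = 0 :=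
  (Submodule.Quotient.mk_eq_zero _).2 (Submodule.subset_span (Or.inl (Or.inl rfl)))

theorem mk_slab {f : Cube V n} (hf : f.IsSlab) : mk k f = 0 :=
  (Submodule.Quotient.mk_eq_zero _).2 (Submodule.subset_span (Or.inl (Or.inr ⟨f, hf, rfl⟩)))

theorem mk_units_smul (c : kˣ) (f : Cube V n) : mk k ((c : k) • f) = (c : k) • mk k f := by
  rw [mk, mk, ← Submodule.Quotient.mk_smul]
  exact (Submodule.Quotient.eq _).2 (Submodule.subset_span (Or.inr ⟨c, f, rfl⟩))

theorem mk_smul (c : k) (f : Cube V n) : mk k (c • f) = c • mk k f := by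
  by_cases hc : c = 0
  · subst hc; rw [zero_smul, zero_smul, mk_zero]
  · exact mk_units_smul (Units.mk0 c hc) f

/-- The universal property of `Q̄ₙ(V)`. -/
def lift {M : Type u} [AddCommGroup M] [Module k M] (φ : Cube V n → M) (h0 : φ 0 = 0)
    (hslab : ∀ f : Cube V n, f.IsSlab → φ f = 0)
    (hsmul : ∀ (c : kˣ) (f : Cube V n), φ ((c : k) • f) = (c : k) • φ f) : QBar k V n →ₗ[k] M :=
  (rel k V n).liftQ (Finsupp.linearCombination k φ) <| by
    rw [rel, Submodule.span_le]
    rintro r ((rfl | ⟨f, hf, rfl⟩) | ⟨c, f, rfl⟩)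
    · simp [h0]
    · simp [hslab f hf]
    · simp [hsmul c f]

@[simp]
theorem lift_mk {M : Type u} [AddCommGroup M] [Module k M] (φ : Cube V n → M) (h0 : φ 0 = 0)
    (hslab : ∀ f : Cube V n, f.IsSlab → φ f = 0)
    (hsmul : ∀ (c : kˣ) (f : Cube V n), φ ((c : k) • f) = (c : k) • φ f) (f : Cube V n) :
    lift φ h0 hslab hsmul (mk k f) = φ f := by
  simp [lift, mk]

theorem hom_ext {M : Type u} [AddCommGroup M] [Module k M] {φ ψ : QBar k V n →ₗ[k] M}
    (h : ∀ f, φ (mk k f) = ψ (mk k f)) : φ = ψ := by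
  refine Submodule.linearMap_qext _ (Finsupp.lhom_ext' fun f => LinearMap.ext_ring ?_)
  exact h f

/-- Functoriality of `Q̄ₙ(V)` in `V`. -/
def map (g : V →ₗ[k] W) (n : ℕ) : QBar k V n →ₗ[k] QBar k W n :=
  lift (fun f => mk k (fun x => g (f x)))
    (by
      have h : (fun x => g ((0 : Cube V n) x)) = 0 := by funext x; simp
      rw [h, mk_zero])
    (by
      rintro f ⟨i, b, h⟩
      exact mk_slab ⟨i, b, fun x hx => by simp [h x hx]⟩)
    (by
      intro c f
      rw [← mk_units_smul]
      congr 1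
      funext x
      simp)

@[simp]
theorem map_mk (g : V →ₗ[k] W) (f : Cube V n) : map g n (mk k f) = mk k (fun x => g (f x)) :=
  lift_mk ..

theorem Cube.face_eq_zero {f : Cube V (n + 1)} {i : Fin (n + 1)} {b : Bool}
    (h : ∀ x, x i ≠ b → f x = 0) {c : Bool} (hc : c ≠ b) : f.face i c = 0 := by
  funext x
  exact h _ (by simpa using hc)

/-- The `j`-th partial differential: `[f₀ + f₁] - [f₀] - [f₁]`, where `f₀`, `f₁` are the
restrictions of the cube `f` to the two faces orthogonal to the `j`-th coordinate. -/
def partialD (k : Type u) [Field k] (V : Type u) [AddCommGroup V] [Module k V] {n : ℕ}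
    (j : Fin (n + 1)) : QBar k V (n + 1) →ₗ[k] QBar k V n :=
  lift (fun f => mk k (f.face j false + f.face j true) - mk k (f.face j false)
      - mk k (f.face j true))
    (by
      have h : ∀ b, (0 : Cube V (n + 1)).face j b = 0 := fun b => rfl
      simp [h, mk_zero])
    (by
      rintro f ⟨i, b, h⟩
      by_cases hij : i = j
      · subst hij
        cases b
        · rw [Cube.face_eq_zero h (c := true) (by simp)]; simp [mk_zero]
        · rw [Cube.face_eq_zero h (c := false) (by simp)]; simp [mk_zero]
      · obtain ⟨i', rfl⟩ := Fin.exists_succAbove_eq hij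
        have h' : ∀ c x, x i' ≠ b → f.face j c x = 0 :=
          fun c x hx => h _ (by simpa using hx)
        rw [mk_slab (f := f.face j false) ⟨i', b, h' _⟩,
          mk_slab (f := f.face j true) ⟨i', b, h' _⟩,
          mk_slab ⟨i', b, fun x hx => by simp [h' _ x hx]⟩]
        simp)
    (by
      intro c f
      have h : ∀ b, ((c : k) • f).face j b = (c : k) • f.face j b := fun b => rfl
      rw [h, h, ← smul_add, mk_units_smul, mk_units_smul, mk_units_smul, smul_sub, smul_sub])

theorem partialD_mk (j : Fin (n + 1)) (f : Cube V (n + 1)) :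
    partialD k V j (mk k f) = mk k (f.face j false + f.face j true) - mk k (f.face j false)
      - mk k (f.face j true) :=
  lift_mk ..

/-- The differential of the cube construction. With coordinates numbered from `1`, it is the
alternating sum of the partial differentials with signs `(-1) ^ j`; in particular
`d [v, w] = [v] + [w] - [v + w]` in degree one. -/
def d (k : Type u) [Field k] (V : Type u) [AddCommGroup V] [Module k V] (n : ℕ) :
    QBar k V (n + 1) →ₗ[k] QBar k V n :=
  ∑ j : Fin (n + 1), (-1 : k) ^ ((j : ℕ) + 1) • partialD k V j

theorem insertNth_insertNth {i j : Fin (n + 1)} (hij : i ≤ j) (b c : Bool) (x : Fin n → Bool) :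
    Fin.insertNth (α := fun _ => Bool) j.succ c (Fin.insertNth (α := fun _ => Bool) i b x) =
      Fin.insertNth (α := fun _ => Bool) i.castSucc b
        (Fin.insertNth (α := fun _ => Bool) j c x) := by
  rw [Fin.insertNth_eq_iff]
  constructor
  · have : j.succ = i.castSucc.succAbove j := by
      rw [Fin.succAbove_castSucc_of_le _ _ hij]
    rw [this]; simp
  · funext q
    simp only [Fin.removeNth]
    by_cases hq : q = i
    · subst hq
      have : j.succ.succAbove q = q.castSucc := Fin.succAbove_succ_of_le _ _ hij
      rw [this]; simp
    · obtain ⟨q', rfl⟩ := Fin.exists_succAbove_eq hq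
      have : j.succ.succAbove (i.succAbove q') = i.castSucc.succAbove (j.succAbove q') := by
        ext
        simp only [Fin.succAbove, Fin.lt_def]
        rw [Fin.le_def] at hij
        split_ifs <;> simp at * <;> omega
      rw [this]; simp

theorem partialD_partialD {i j : Fin (n + 1)} (hij : i ≤ j) :
    partialD k V i ∘ₗ partialD k V j.succ = partialD k V j ∘ₗ partialD k V i.castSucc := by
  refine hom_ext fun f => ?_
  have h : ∀ b c, (f.face j.succ c).face i b = (f.face i.castSucc b).face j c := by
    intro b c
    funext x
    simp only [Cube.face, insertNth_insertNth hij]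
  have ha : ∀ (m : ℕ) (q : Fin (m + 1)) (b : Bool) (f g : Cube V (m + 1)),
    (f + g).face q b = f.face q b + g.face q b := fun _ _ _ _ _ => rfl
  simp only [LinearMap.comp_apply, partialD_mk, map_sub, ha, h]
  have e : (f.face i.castSucc false).face j false + (f.face i.castSucc false).face j true +
      ((f.face i.castSucc true).face j false + (f.face i.castSucc true).face j true) =
      (f.face i.castSucc false).face j false + (f.face i.castSucc true).face j false +
      ((f.face i.castSucc false).face j true + (f.face i.castSucc true).face j true) :=
    add_add_add_comm _ _ _ _
  rw [e]
  abel

theorem d_comp_d (n : ℕ) : d k V n ∘ₗ d k V (n + 1) = 0 := by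
  refine LinearMap.ext fun y => ?_
  simp only [d, LinearMap.comp_apply, LinearMap.sum_apply, map_sum, LinearMap.smul_apply,
    map_smul, LinearMap.zero_apply, Finset.smul_sum]
  simp only [← Finset.sum_product']
  let P := Fin (n + 2) × Fin (n + 1)
  let S : Finset P := {ij : P | (ij.1 : ℕ) ≤ (ij.2 : ℕ)}
  rw [Finset.univ_product_univ, ← Finset.sum_add_sum_compl S, ← eq_neg_iff_add_eq_zero,
    ← Finset.sum_neg_distrib]
  let φ : ∀ ij : P, ij ∈ S → P := fun ij hij =>
    (ij.2.succ, Fin.castLT ij.1 (lt_of_le_of_lt (Finset.mem_filter.mp hij).right (Fin.is_lt ij.2)))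
  apply Finset.sum_bij φ
  · intro ij hij
    simp_rw [S, φ, Finset.compl_filter, Finset.mem_filter_univ, Fin.val_succ,
      Fin.val_castLT] at hij ⊢
    omega
  · rintro ⟨i, j⟩ hij ⟨i', j'⟩ hij' h
    rw [Prod.mk_inj] at h ⊢
    refine ⟨?_, Fin.succ_injective _ h.1⟩
    have := congrArg Fin.val h.2
    exact Fin.ext this
  · rintro ⟨i', j'⟩ hij'
    simp_rw [S, Finset.compl_filter, Finset.mem_filter_univ, not_le] at hij'
    have h0 : i' ≠ 0 := by
      rintro rfl
      simp at hij'
    refine ⟨(Fin.castSucc j', i'.pred h0), ?_, ?_⟩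
    · simp only [S, Finset.mem_filter_univ, Fin.val_castSucc, Fin.val_pred]
      omega
    · simp only [φ, Fin.castLT_castSucc, Fin.succ_pred]
  · rintro ⟨i, j⟩ hij
    have hij' : (i : ℕ) ≤ j := (Finset.mem_filter.mp hij).right
    have hi : (i : ℕ) < n + 1 := lt_of_le_of_lt hij' j.2
    have := LinearMap.congr_fun
      (partialD_partialD (k := k) (V := V) (i := i.castLT hi) (j := j) hij') y
    simp only [LinearMap.comp_apply, Fin.castSucc_castLT] at this
    simp only [φ, this, Fin.castSucc_castLT,
      Fin.val_succ, Fin.val_castLT, smul_smul, ← neg_smul]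
    congr 1
    ring

/-- The external product of cubes: `(f × g) (x, y) = f x * g y`. -/
def Cube.mul {i j n : ℕ} (h : i + j = n) (f : Cube A i) (g : Cube A j) : Cube A n :=
  fun x => f (fun q => x (Fin.cast h (Fin.castAdd j q))) *
    g (fun q => x (Fin.cast h (Fin.natAdd i q)))

/-- The product on the cube construction of an algebra. -/
def mul (k : Type u) [Field k] (A : Type u) [Ring A] [Algebra k A] {i j n : ℕ} (h : i + j = n) :
    QBar k A i →ₗ[k] QBar k A j →ₗ[k] QBar k A n :=
  lift (fun f => lift (fun g => mk k (Cube.mul h f g))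
      (by
        have : Cube.mul h f (0 : Cube A j) = 0 := by funext x; simp [Cube.mul]
        rw [this, mk_zero])
      (by
        rintro g ⟨q, b, hg⟩
        exact mk_slab ⟨Fin.cast h (Fin.natAdd i q), b, fun x hx => by
          simp only [Cube.mul]; rw [hg _ hx, mul_zero]⟩)
      (by
        intro c g
        rw [← mk_units_smul]
        congr 1
        funext x
        simp [Cube.mul]))
    (by
      refine hom_ext fun g => ?_
      have : Cube.mul h (0 : Cube A i) g = 0 := by funext x; simp [Cube.mul]
      rw [lift_mk, this, mk_zero, LinearMap.zero_apply])
    (by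
      rintro f ⟨q, b, hf⟩
      refine hom_ext fun g => ?_
      rw [lift_mk, LinearMap.zero_apply]
      exact mk_slab ⟨Fin.cast h (Fin.castAdd j q), b, fun x hx => by
          simp only [Cube.mul]; rw [hf _ hx, zero_mul]⟩)
    (by
      intro c f
      refine hom_ext fun g => ?_
      rw [LinearMap.smul_apply, lift_mk, lift_mk, ← mk_units_smul]
      congr 1
      funext x
      simp [Cube.mul])

@[simp]
theorem mul_mk {i j n : ℕ} (h : i + j = n) (f : Cube A i) (g : Cube A j) :
    mul k A h (mk k f) (mk k g) = mk k (Cube.mul h f g) := by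
  rw [mul, lift_mk, lift_mk]

theorem hom_ext₂ {B : Type u} [AddCommGroup B] [Module k B] {m : ℕ}
    {M : Type u} [AddCommGroup M] [Module k M]
    {φ ψ : QBar k V n →ₗ[k] QBar k B m →ₗ[k] M}
    (h : ∀ f g, φ (mk k f) (mk k g) = ψ (mk k f) (mk k g)) : φ = ψ :=
  hom_ext fun f => hom_ext fun g => h f g

@[elab_as_elim]
theorem induction_on {P : QBar k V n → Prop} (x : QBar k V n) (hmk : ∀ f, P (mk k f))
    (hadd : ∀ x y, P x → P y → P (x + y)) (hsmul : ∀ (c : k) x, P x → P (c • x)) : P x := by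
  obtain ⟨x, rfl⟩ := Submodule.Quotient.mk_surjective _ x
  induction x using Finsupp.induction_linear with
  | zero => simpa using hsmul 0 _ (hmk 0)
  | add f g hf hg => exact hadd _ _ hf hg
  | single f c =>
    have := hsmul c _ (hmk f)
    rwa [mk, ← Submodule.Quotient.mk_smul, Finsupp.smul_single_one] at this

theorem mul_assoc' {i j l ij jl n : ℕ} (h₁ : i + j = ij) (h₂ : j + l = jl) (h₃ : ij + l = n)
    (h₄ : i + jl = n) (x : QBar k A i) (y : QBar k A j) (z : QBar k A l) :
    mul k A h₃ (mul k A h₁ x y) z = mul k A h₄ x (mul k A h₂ y z) := by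
  induction x using induction_on with
  | hadd a b ha hb => simp only [map_add, LinearMap.add_apply, ha, hb]
  | hsmul c a ha => simp only [map_smul, LinearMap.smul_apply, ha]
  | hmk f =>
  induction y using induction_on with
  | hadd a b ha hb => simp only [map_add, LinearMap.add_apply, ha, hb]
  | hsmul c a ha => simp only [map_smul, LinearMap.smul_apply, ha]
  | hmk g =>
  induction z using induction_on with
  | hadd a b ha hb => simp only [map_add, LinearMap.add_apply, ha, hb]
  | hsmul c a ha => simp only [map_smul, LinearMap.smul_apply, ha]
  | hmk e =>
  rw [mul_mk, mul_mk, mul_mk, mul_mk]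
  congr 1
  funext x
  subst h₁ h₂ h₃
  simp only [Cube.mul, mul_assoc]
  congr 2
  congr 1
  all_goals
    congr 1
    funext q
    congr 1
    ext
    simp [add_assoc]

theorem one_mul' {n : ℕ} (h : 0 + n = n) (x : QBar k A n) :
    mul k A h (mk k (fun _ => 1)) x = x := by
  induction x using induction_on with
  | hadd a b ha hb => simp only [map_add, LinearMap.add_apply, ha, hb]
  | hsmul c a ha => simp only [map_smul, LinearMap.smul_apply, ha]
  | hmk f =>
  rw [mul_mk]
  congr 1
  funext x
  simp only [Cube.mul, one_mul]
  congr 1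
  funext q
  congr 1
  ext
  simp

theorem mul_one' {n : ℕ} (h : n + 0 = n) (x : QBar k A n) :
    mul k A h x (mk k (fun _ => 1)) = x := by
  induction x using induction_on with
  | hadd a b ha hb => simp only [map_add, LinearMap.add_apply, ha, hb]
  | hsmul c a ha => simp only [map_smul, LinearMap.smul_apply, ha]
  | hmk f =>
  rw [mul_mk]
  congr 1
  funext x
  simp only [Cube.mul, mul_one]
  congr 1

theorem partialD_mul_left {i j n : ℕ} (h : i + 1 + j = n + 1) (h' : i + j = n) (p : Fin (i + 1))
    (x : QBar k A (i + 1)) (y : QBar k A j) :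
    partialD k A (Fin.cast h (Fin.castAdd j p)) (mul k A h x y) =
      mul k A h' (partialD k A p x) y := by
  induction x using induction_on with
  | hadd a b ha hb => simp only [map_add, LinearMap.add_apply, ha, hb]
  | hsmul c a ha => simp only [map_smul, LinearMap.smul_apply, ha]
  | hmk f =>
  induction y using induction_on with
  | hadd a b ha hb => simp only [map_add, LinearMap.add_apply, ha, hb]
  | hsmul c a ha => simp only [map_smul, LinearMap.smul_apply, ha]
  | hmk g =>
  have hf : ∀ b, (Cube.mul h f g).face (Fin.cast h (Fin.castAdd j p)) b =
      Cube.mul h' (f.face p b) g := by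
    intro b
    funext x
    simp only [Cube.mul, Cube.face]
    congr 1
    · congr 1
      funext q
      by_cases hq : q = p
      · subst hq; simp
      · obtain ⟨q', rfl⟩ := Fin.exists_succAbove_eq hq
        have : Fin.cast h (Fin.castAdd j (p.succAbove q')) =
            (Fin.cast h (Fin.castAdd j p)).succAbove (Fin.cast h' (Fin.castAdd j q')) := by
          ext
          simp only [Fin.succAbove, Fin.lt_def]
          split_ifs <;> simp at * <;> omega
        rw [this, Fin.insertNth_apply_succAbove, Fin.insertNth_apply_succAbove]
    · congr 1
      funext q
      have : Fin.cast h (Fin.natAdd (i + 1) q) =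
            (Fin.cast h (Fin.castAdd j p)).succAbove (Fin.cast h' (Fin.natAdd i q)) := by
          ext
          simp only [Fin.succAbove, Fin.lt_def]
          split_ifs <;> simp at * <;> omega
      rw [this, Fin.insertNth_apply_succAbove]
  have ha : ∀ f f' : Cube A i, Cube.mul h' (f + f') g = Cube.mul h' f g + Cube.mul h' f' g := by
    intro f f'
    funext x
    simp [Cube.mul, add_mul]
  rw [mul_mk, partialD_mk, partialD_mk, hf, hf, ← ha]
  simp

theorem partialD_mul_right {i j n : ℕ} (h : i + (j + 1) = n + 1) (h' : i + j = n)
    (p : Fin (j + 1)) (x : QBar k A i) (y : QBar k A (j + 1)) :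
    partialD k A (Fin.cast h (Fin.natAdd i p)) (mul k A h x y) =
      mul k A h' x (partialD k A p y) := by
  induction x using induction_on with
  | hadd a b ha hb => simp only [map_add, LinearMap.add_apply, ha, hb]
  | hsmul c a ha => simp only [map_smul, LinearMap.smul_apply, ha]
  | hmk f =>
  induction y using induction_on with
  | hadd a b ha hb => simp only [map_add, LinearMap.add_apply, ha, hb]
  | hsmul c a ha => simp only [map_smul, LinearMap.smul_apply, ha]
  | hmk g =>
  have hf : ∀ b, (Cube.mul h f g).face (Fin.cast h (Fin.natAdd i p)) b =
      Cube.mul h' f (g.face p b) := by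
    intro b
    funext x
    simp only [Cube.mul, Cube.face]
    congr 1
    · congr 1
      funext q
      have : Fin.cast h (Fin.castAdd (j + 1) q) =
            (Fin.cast h (Fin.natAdd i p)).succAbove (Fin.cast h' (Fin.castAdd j q)) := by
          ext
          simp only [Fin.succAbove, Fin.lt_def]
          split_ifs <;> simp at * <;> omega
      rw [this, Fin.insertNth_apply_succAbove]
    · congr 1
      funext q
      by_cases hq : q = p
      · subst hq; simp
      · obtain ⟨q', rfl⟩ := Fin.exists_succAbove_eq hq
        have : Fin.cast h (Fin.natAdd i (p.succAbove q')) =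
            (Fin.cast h (Fin.natAdd i p)).succAbove (Fin.cast h' (Fin.natAdd i q')) := by
          ext
          simp only [Fin.succAbove, Fin.lt_def]
          split_ifs <;> simp at * <;> omega
        rw [this, Fin.insertNth_apply_succAbove, Fin.insertNth_apply_succAbove]
  have ha : ∀ g g' : Cube A j, Cube.mul h' f (g + g') = Cube.mul h' f g + Cube.mul h' f g' := by
    intro f f'
    funext x
    simp [Cube.mul, mul_add]
  rw [mul_mk, partialD_mk, partialD_mk, hf, hf, ← ha]
  simp

theorem sum_fin_cast {M : Type u} [AddCommMonoid M] {a b : ℕ} (h : a = b) (F : Fin b → M) :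
    ∑ q : Fin b, F q = ∑ q : Fin a, F (Fin.cast h q) := by
  subst h; rfl

theorem d_mul_zero {i n : ℕ} (h : i + 1 + 0 = n + 1) (h' : i + 0 = n)
    (x : QBar k A (i + 1)) (y : QBar k A 0) :
    d k A n (mul k A h x y) = mul k A h' (d k A i x) y := by
  simp only [d, LinearMap.sum_apply, LinearMap.smul_apply, map_sum, map_smul]
  rw [sum_fin_cast h]
  refine Finset.sum_congr rfl fun q _ => ?_
  rw [← partialD_mul_left h h' q x y]
  rfl

theorem d_zero_mul {j n : ℕ} (h : 0 + (j + 1) = n + 1) (h' : 0 + j = n)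
    (x : QBar k A 0) (y : QBar k A (j + 1)) :
    d k A n (mul k A h x y) = mul k A h' x (d k A j y) := by
  simp only [d, LinearMap.sum_apply, LinearMap.smul_apply, map_sum, map_smul]
  rw [sum_fin_cast h, Fin.sum_univ_add]
  simp only [Finset.univ_eq_empty, Finset.sum_empty, zero_add]
  refine Finset.sum_congr rfl fun q _ => ?_
  rw [← partialD_mul_right h h' q x y]
  simp

theorem d_mul {i j n : ℕ} (h : i + 1 + (j + 1) = n + 1) (h₁ : i + (j + 1) = n)
    (h₂ : i + 1 + j = n) (x : QBar k A (i + 1)) (y : QBar k A (j + 1)) :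
    d k A n (mul k A h x y) =
      mul k A h₁ (d k A i x) y + (-1 : k) ^ (i + 1) • mul k A h₂ x (d k A j y) := by
  simp only [d, LinearMap.sum_apply, LinearMap.smul_apply, map_sum, map_smul, Finset.smul_sum]
  rw [sum_fin_cast h, Fin.sum_univ_add]
  congr 1
  · refine Finset.sum_congr rfl fun q _ => ?_
    rw [← partialD_mul_left h h₁ q x y]
    rfl
  · refine Finset.sum_congr rfl fun q _ => ?_
    rw [← partialD_mul_right h h₂ q x y, smul_smul]
    congr 1
    simp only [Fin.val_cast, Fin.val_natAdd]
    ring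

end QBar

/-! ### Differential graded algebras -/

/-- A DG algebra over `k` (homological grading, concentrated in non-negative degrees): a chain
complex with an associative unital product that satisfies the graded Leibniz rule. -/
structure DGAlg (k : Type u) [Field k] where
  /-- the underlying complex -/
  cx : ChainComplex (ModuleCat.{u} k) ℕ
  /-- the unit -/
  one : cx.X 0
  /-- the product of homogeneous elements -/
  mul : ∀ {i j n : ℕ}, i + j = n → (cx.X i →ₗ[k] cx.X j →ₗ[k] cx.X n)
  one_mul : ∀ {n : ℕ} (h : 0 + n = n) (x : cx.X n), mul h one x = x
  mul_one : ∀ {n : ℕ} (h : n + 0 = n) (x : cx.X n), mul h x one = x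
  mul_assoc : ∀ {i j l ij jl n : ℕ} (h₁ : i + j = ij) (h₂ : j + l = jl) (h₃ : ij + l = n)
    (h₄ : i + jl = n) (x : cx.X i) (y : cx.X j) (z : cx.X l),
    mul h₃ (mul h₁ x y) z = mul h₄ x (mul h₂ y z)
  d_mul : ∀ {i j n : ℕ} (h : i + 1 + (j + 1) = n + 1) (h₁ : i + (j + 1) = n) (h₂ : i + 1 + j = n)
    (x : cx.X (i + 1)) (y : cx.X (j + 1)),
    (cx.d (n + 1) n).hom (mul h x y) = mul h₁ ((cx.d (i + 1) i).hom x) y +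
      (-1 : k) ^ (i + 1) • mul h₂ x ((cx.d (j + 1) j).hom y)
  d_mul_zero : ∀ {i n : ℕ} (h : i + 1 + 0 = n + 1) (h' : i + 0 = n) (x : cx.X (i + 1))
    (y : cx.X 0), (cx.d (n + 1) n).hom (mul h x y) = mul h' ((cx.d (i + 1) i).hom x) y
  d_zero_mul : ∀ {j n : ℕ} (h : 0 + (j + 1) = n + 1) (h' : 0 + j = n) (x : cx.X 0)
    (y : cx.X (j + 1)), (cx.d (n + 1) n).hom (mul h x y) = mul h' x ((cx.d (j + 1) j).hom y)

namespace DGAlg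

variable {k : Type u} [Field k]

/-- Morphisms of DG algebras. -/
@[ext]
structure Hom (B C : DGAlg k) where
  /-- the underlying map of complexes -/
  f : B.cx ⟶ C.cx
  map_one : (f.f 0).hom B.one = C.one
  map_mul : ∀ {i j n : ℕ} (h : i + j = n) (x : B.cx.X i) (y : B.cx.X j),
    (f.f n).hom (B.mul h x y) = C.mul h ((f.f i).hom x) ((f.f j).hom y)

instance : Category (DGAlg k) where
  Hom := Hom
  id B := ⟨𝟙 _, by simp, by simp⟩
  comp φ ψ := ⟨φ.f ≫ ψ.f, by simp [φ.map_one, ψ.map_one], by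
    intro i j n h x y
    simp [φ.map_mul, ψ.map_mul]⟩

@[ext]
theorem hom_ext {B C : DGAlg k} {φ ψ : B ⟶ C} (h : φ.f = ψ.f) : φ = ψ := Hom.ext h

@[simp]
theorem id_f (B : DGAlg k) : Hom.f (𝟙 B) = 𝟙 B.cx := rfl

@[simp]
theorem comp_f {B C D : DGAlg k} (φ : B ⟶ C) (ψ : C ⟶ D) : (φ ≫ ψ).f = φ.f ≫ ψ.f := rfl

/-- A map `s : B̃ ⟶ B'` is a DG splitting of `q : B' ⟶ B` if the composition `B̃ ⟶ B` is a
surjective quasi-isomorphism. -/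
def IsDGSplitting {B₁ B' B : DGAlg k} (s : B₁ ⟶ B') (q : B' ⟶ B) : Prop :=
  (∀ n, Function.Surjective ((s ≫ q).f.f n).hom) ∧ QuasiIso (s ≫ q).f

variable (k) in
/-- The terms of the complex `A` concentrated in degree `0`. -/
def singleX (A : Type u) [Ring A] [Algebra k A] : ℕ → ModuleCat.{u} k
  | 0 => ModuleCat.of k A
  | _ + 1 => ModuleCat.of k PUnit

instance (A : Type u) [Ring A] [Algebra k A] (n : ℕ) : Subsingleton (singleX k A (n + 1)) :=
  inferInstanceAs (Subsingleton PUnit)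

variable (k) in
/-- The product on `A`, placed in degree `0`. -/
def singleMul (A : Type u) [Ring A] [Algebra k A] : ∀ (i j n : ℕ), i + j = n →
    (singleX k A i →ₗ[k] singleX k A j →ₗ[k] singleX k A n)
  | 0, 0, 0, _ => LinearMap.mul k A
  | _, _, _, _ => 0

variable (k) in
/-- An algebra considered as a DG algebra concentrated in degree `0`. -/
def single (A : Type u) [Ring A] [Algebra k A] : DGAlg k where
  cx := { X := singleX k A, d := fun _ _ => 0 }
  one := (1 : A)
  mul {i j n} h := singleMul k A i j n h
  one_mul {n} h x := by
    cases n with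
    | zero => exact _root_.one_mul (M := A) x
    | succ n => exact Subsingleton.elim _ _
  mul_one {n} h x := by
    cases n with
    | zero => exact _root_.mul_one (M := A) x
    | succ n => exact Subsingleton.elim _ _
  mul_assoc {i j l ij jl n} h₁ h₂ h₃ h₄ x y z := by
    cases n with
    | zero =>
      obtain ⟨rfl, rfl⟩ : ij = 0 ∧ l = 0 := by omega
      obtain ⟨rfl, rfl⟩ : i = 0 ∧ j = 0 := by omega
      obtain rfl : jl = 0 := by omega
      exact _root_.mul_assoc (G := A) x y z
    | succ n => exact Subsingleton.elim _ _
  d_mul {i j n} h h₁ h₂ x y := by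
    obtain ⟨m, rfl⟩ : ∃ m, n = m + 1 := ⟨i + j, by omega⟩
    exact Subsingleton.elim _ _
  d_mul_zero {i n} h h' x y := by
    change 0 = singleMul k A i 0 n h' 0 y
    simp
  d_zero_mul {i n} h h' x y := by
    change 0 = singleMul k A 0 i n h' x 0
    simp

end DGAlg

/-! ### Quotients, truncations -/

/-- The quotient of a complex by a subcomplex. -/
def quotCx {k : Type u} [Field k] (C : ChainComplex (ModuleCat.{u} k) ℕ)
    (I : ∀ n, Submodule k (C.X n)) (hI : ∀ i j, I i ≤ (I j).comap (C.d i j).hom) :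
    ChainComplex (ModuleCat.{u} k) ℕ where
  X n := ModuleCat.of k (C.X n ⧸ I n)
  d i j := ModuleCat.ofHom (Submodule.mapQ (I i) (I j) (C.d i j).hom (hI i j))
  shape i j h := by
    ext x
    simp [C.shape i j h]
  d_comp_d' i j l _ _ := by
    ext x
    simp [← ModuleCat.comp_apply]

/-- The map of quotients induced by a map of complexes. -/
def quotCxMap {k : Type u} [Field k] {C D : ChainComplex (ModuleCat.{u} k) ℕ} (f : C ⟶ D)
    {I : ∀ n, Submodule k (C.X n)} (hI : ∀ i j, I i ≤ (I j).comap (C.d i j).hom)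
    {J : ∀ n, Submodule k (D.X n)} (hJ : ∀ i j, J i ≤ (J j).comap (D.d i j).hom)
    (hf : ∀ n, I n ≤ (J n).comap (f.f n).hom) : quotCx C I hI ⟶ quotCx D J hJ where
  f n := ModuleCat.ofHom (Submodule.mapQ (I n) (J n) (f.f n).hom (hf n))
  comm' i j _ := by
    refine ModuleCat.hom_ext (Submodule.linearMap_qext _ (LinearMap.ext fun x => ?_))
    exact congrArg (fun g => (Submodule.Quotient.mk (g.hom x) : D.X j ⧸ J j)) (f.comm i j)

namespace DGAlg

variable {k : Type u} [Field k]

/-- A two-sided DG ideal. -/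
structure DGIdeal (B : DGAlg k) where
  /-- the homogeneous components -/
  I : ∀ n, Submodule k (B.cx.X n)
  d_mem : ∀ i j, I i ≤ (I j).comap (B.cx.d i j).hom
  mul_left : ∀ {i j n : ℕ} (h : i + j = n) (x : B.cx.X i) (y : B.cx.X j), y ∈ I j →
    B.mul h x y ∈ I n
  mul_right : ∀ {i j n : ℕ} (h : i + j = n) (x : B.cx.X i) (y : B.cx.X j), x ∈ I i →
    B.mul h x y ∈ I n

/-- The product on the quotient by a DG ideal. -/
def quotMul {B : DGAlg k} (J : DGIdeal B) {i j n : ℕ} (h : i + j = n) :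
    (B.cx.X i ⧸ J.I i) →ₗ[k] (B.cx.X j ⧸ J.I j) →ₗ[k] (B.cx.X n ⧸ J.I n) :=
  (J.I i).liftQ
    { toFun := fun x => (J.I j).mapQ (J.I n) (B.mul h x) (fun y hy => J.mul_left h x y hy)
      map_add' := fun x y => by
        refine Submodule.linearMap_qext _ (LinearMap.ext fun z => ?_)
        simp
      map_smul' := fun c x => by
        refine Submodule.linearMap_qext _ (LinearMap.ext fun z => ?_)
        simp }
    (by
      intro x hx
      refine Submodule.linearMap_qext _ (LinearMap.ext fun z => ?_)
      simpa using J.mul_right h x z hx)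

/-- The quotient of a DG algebra by a DG ideal. -/
def quot (B : DGAlg k) (J : DGIdeal B) : DGAlg k where
  cx := quotCx B.cx J.I J.d_mem
  one := Submodule.Quotient.mk B.one
  mul h := quotMul J h
  one_mul {n} h x := by
    obtain ⟨x, rfl⟩ := Submodule.Quotient.mk_surjective _ x
    exact congrArg Submodule.Quotient.mk (B.one_mul h x)
  mul_one {n} h x := by
    obtain ⟨x, rfl⟩ := Submodule.Quotient.mk_surjective _ x
    exact congrArg Submodule.Quotient.mk (B.mul_one h x)
  mul_assoc h₁ h₂ h₃ h₄ x y z := by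
    obtain ⟨x, rfl⟩ := Submodule.Quotient.mk_surjective _ x
    obtain ⟨y, rfl⟩ := Submodule.Quotient.mk_surjective _ y
    obtain ⟨z, rfl⟩ := Submodule.Quotient.mk_surjective _ z
    exact congrArg Submodule.Quotient.mk (B.mul_assoc h₁ h₂ h₃ h₄ x y z)
  d_mul h h₁ h₂ x y := by
    obtain ⟨x, rfl⟩ := Submodule.Quotient.mk_surjective _ x
    obtain ⟨y, rfl⟩ := Submodule.Quotient.mk_surjective _ y
    exact congrArg Submodule.Quotient.mk (B.d_mul h h₁ h₂ x y)
  d_mul_zero h h' x y := by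
    obtain ⟨x, rfl⟩ := Submodule.Quotient.mk_surjective _ x
    obtain ⟨y, rfl⟩ := Submodule.Quotient.mk_surjective _ y
    exact congrArg Submodule.Quotient.mk (B.d_mul_zero h h' x y)
  d_zero_mul h h' x y := by
    obtain ⟨x, rfl⟩ := Submodule.Quotient.mk_surjective _ x
    obtain ⟨y, rfl⟩ := Submodule.Quotient.mk_surjective _ y
    exact congrArg Submodule.Quotient.mk (B.d_zero_mul h h' x y)

/-- The map of quotients induced by a DG algebra map. -/
def quotMap {B C : DGAlg k} (φ : B ⟶ C) (I : DGIdeal B) (J : DGIdeal C)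
    (h : ∀ n, I.I n ≤ (J.I n).comap (φ.f.f n).hom) : B.quot I ⟶ C.quot J :=
  Hom.mk (quotCxMap φ.f I.d_mem J.d_mem h)
    (congrArg Submodule.Quotient.mk φ.map_one)
    (by
      intro i j n hij x y
      obtain ⟨x, rfl⟩ := Submodule.Quotient.mk_surjective _ x
      obtain ⟨y, rfl⟩ := Submodule.Quotient.mk_surjective _ y
      exact congrArg Submodule.Quotient.mk (φ.map_mul hij x y))

/-- The map from a quotient induced by a DG algebra map that kills the ideal. -/
def quotLift {B C : DGAlg k} (φ : B ⟶ C) (I : DGIdeal B)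
    (h : ∀ n, I.I n ≤ LinearMap.ker (φ.f.f n).hom) : B.quot I ⟶ C :=
  Hom.mk
    { f := fun n => ModuleCat.ofHom ((I.I n).liftQ (φ.f.f n).hom (h n))
      comm' := fun i j _ => by
        refine ModuleCat.hom_ext (Submodule.linearMap_qext _ (LinearMap.ext fun x => ?_))
        exact congrArg (fun g => g.hom x) (φ.f.comm i j) }
    (by exact φ.map_one)
    (by
      intro i j n hij x y
      obtain ⟨x, rfl⟩ := Submodule.Quotient.mk_surjective _ x
      obtain ⟨y, rfl⟩ := Submodule.Quotient.mk_surjective _ y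
      exact φ.map_mul hij x y)

end DGAlg

/-- The subcomplex by which one divides to get the `l`-th canonical truncation: it is `0` in
degrees `≤ l`, the kernel of the differential in degree `l + 1`, everything above. -/
def truncSub {k : Type u} [Field k] (C : ChainComplex (ModuleCat.{u} k) ℕ) (l n : ℕ) :
    Submodule k (C.X n) :=
  if n ≤ l then ⊥ else if n = l + 1 then LinearMap.ker (C.d n l).hom else ⊤

/-- The subcomplex by which one divides `C` to get the two-term complex
`C₁ / Im d → C₀`. -/
def flatSub {k : Type u} [Field k] (C : ChainComplex (ModuleCat.{u} k) ℕ) (n : ℕ) :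
    Submodule k (C.X n) :=
  if n = 0 then ⊥ else if n = 1 then LinearMap.range (C.d 2 n).hom else ⊤

section

variable {k : Type u} [Field k]

theorem d_d_apply (C : ChainComplex (ModuleCat.{u} k) ℕ) (i j l : ℕ) (x : C.X i) :
    (C.d j l).hom ((C.d i j).hom x) = 0 :=
  congrArg (fun g => g.hom x) (C.d_comp_d i j l)

theorem d_eq_zero (C : ChainComplex (ModuleCat.{u} k) ℕ) {i j : ℕ} (h : j + 1 ≠ i) (x : C.X i) :
    (C.d i j).hom x = 0 := by
  rw [C.shape i j h]; rfl

theorem truncSub_d (C : ChainComplex (ModuleCat.{u} k) ℕ) (l i j : ℕ) :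
    truncSub C l i ≤ (truncSub C l j).comap (C.d i j).hom := by
  intro x hx
  rw [Submodule.mem_comap]
  by_cases hij : j + 1 = i
  · subst hij
    unfold truncSub at hx ⊢
    split_ifs at hx ⊢ with h₁ h₂ h₃ h₄ h₅ h₆ h₇
    all_goals first | omega | skip
    · rw [(Submodule.mem_bot k).1 hx, map_zero]; exact Submodule.zero_mem _
    · obtain rfl : j = l := by omega
      exact hx
    · subst h₄
      exact d_d_apply C _ _ _ x
    · trivial
  · rw [d_eq_zero C hij]; exact Submodule.zero_mem _

theorem flatSub_d (C : ChainComplex (ModuleCat.{u} k) ℕ) (i j : ℕ) :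
    flatSub C i ≤ (flatSub C j).comap (C.d i j).hom := by
  intro x hx
  rw [Submodule.mem_comap]
  by_cases hij : j + 1 = i
  · subst hij
    rcases j with _ | _ | j
    · obtain ⟨y, rfl⟩ : x ∈ LinearMap.range (C.d 2 1).hom := hx
      rw [d_d_apply]; exact Submodule.zero_mem _
    · exact ⟨x, rfl⟩
    · trivial
  · rw [d_eq_zero C hij]; exact Submodule.zero_mem _

theorem truncSub_map {C D : ChainComplex (ModuleCat.{u} k) ℕ} (f : C ⟶ D) (l n : ℕ) :
    truncSub C l n ≤ (truncSub D l n).comap (f.f n).hom := by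
  intro x hx
  rw [Submodule.mem_comap]
  unfold truncSub at hx ⊢
  split_ifs at hx ⊢ with h₁ h₂
  · rw [(Submodule.mem_bot k).1 hx, map_zero]; exact Submodule.zero_mem _
  · have := congrArg (fun g => g.hom x) (f.comm n l)
    have hx' : (C.d n l).hom x = 0 := hx
    simp only [ModuleCat.hom_comp, LinearMap.comp_apply, hx', map_zero] at this
    exact this
  · trivial

theorem flatSub_map {C D : ChainComplex (ModuleCat.{u} k) ℕ} (f : C ⟶ D) (n : ℕ) :
    flatSub C n ≤ (flatSub D n).comap (f.f n).hom := by
  intro x hx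
  rw [Submodule.mem_comap]
  unfold flatSub at hx ⊢
  split_ifs at hx ⊢ with h₁ h₂
  · rw [(Submodule.mem_bot k).1 hx, map_zero]; exact Submodule.zero_mem _
  · obtain ⟨y, rfl⟩ := hx
    exact ⟨(f.f 2).hom y, congrArg (fun g => g.hom y) (f.comm 2 n)⟩
  · trivial

/-- The two-term quotient `C₁ / Im d → C₀` of a complex. -/
def flatCx (C : ChainComplex (ModuleCat.{u} k) ℕ) : ChainComplex (ModuleCat.{u} k) ℕ :=
  quotCx C (flatSub C) (flatSub_d C)

/-- Functoriality of the two-term quotient. -/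
def flatCxMap {C D : ChainComplex (ModuleCat.{u} k) ℕ} (f : C ⟶ D) : flatCx C ⟶ flatCx D :=
  quotCxMap f _ _ (flatSub_map f)

/-- The DG ideal that defines the `l`-th canonical truncation of a DG algebra. -/
def DGAlg.truncIdeal (B : DGAlg k) (l : ℕ) : DGAlg.DGIdeal B where
  I := truncSub B.cx l
  d_mem := truncSub_d B.cx l
  mul_left {i j n} h x y hy := by
    unfold truncSub at hy ⊢
    split_ifs at hy ⊢ with h₁ h₂ h₃ h₄ h₅ h₆ h₇
    all_goals first | omega | trivial | skip
    · rw [(Submodule.mem_bot k).1 hy, map_zero]; exact Submodule.zero_mem _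
    · rw [(Submodule.mem_bot k).1 hy, map_zero]; exact Submodule.zero_mem _
    · obtain rfl : i = 0 := by omega
      subst h₆
      obtain rfl : n = l + 1 := by omega
      have hy' : (B.cx.d (l + 1) l).hom y = 0 := hy
      rw [LinearMap.mem_ker, B.d_zero_mul h (by omega), hy', map_zero]
  mul_right {i j n} h x y hx := by
    unfold truncSub at hx ⊢
    split_ifs at hx ⊢ with h₁ h₂ h₃ h₄ h₅ h₆ h₇
    all_goals first | omega | trivial | skip
    · rw [(Submodule.mem_bot k).1 hx, map_zero]; exact Submodule.zero_mem _
    · rw [(Submodule.mem_bot k).1 hx, map_zero]; exact Submodule.zero_mem _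
    · obtain rfl : j = 0 := by omega
      subst h₆
      obtain rfl : n = l + 1 := by omega
      have hx' : (B.cx.d (l + 1) l).hom x = 0 := hx
      rw [LinearMap.mem_ker, B.d_mul_zero h (by omega), hx', map_zero]; rfl

/-- The DG ideal that defines the two-term quotient of a DG algebra. -/
def DGAlg.flatIdeal (B : DGAlg k) : DGAlg.DGIdeal B where
  I := flatSub B.cx
  d_mem := flatSub_d B.cx
  mul_left {i j n} h x y hy := by
    rcases n with _ | _ | n
    · obtain ⟨rfl, rfl⟩ : i = 0 ∧ j = 0 := by omega
      rw [(Submodule.mem_bot k).1 hy, map_zero]; exact Submodule.zero_mem _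
    · rcases j with _ | _ | j
      · rw [(Submodule.mem_bot k).1 hy, map_zero]; exact Submodule.zero_mem _
      · obtain rfl : i = 0 := by omega
        obtain ⟨z, rfl⟩ : y ∈ LinearMap.range (B.cx.d 2 1).hom := hy
        exact ⟨B.mul (by omega) x z, B.d_zero_mul (by omega) h x z⟩
      · omega
    · trivial
  mul_right {i j n} h x y hx := by
    rcases n with _ | _ | n
    · obtain ⟨rfl, rfl⟩ : i = 0 ∧ j = 0 := by omega
      rw [(Submodule.mem_bot k).1 hx, map_zero]; exact Submodule.zero_mem _
    · rcases i with _ | _ | i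
      · rw [(Submodule.mem_bot k).1 hx, map_zero]; exact Submodule.zero_mem _
      · obtain rfl : j = 0 := by omega
        obtain ⟨z, rfl⟩ : x ∈ LinearMap.range (B.cx.d 2 1).hom := hx
        exact ⟨B.mul (by omega) z y, B.d_mul_zero (by omega) h z y⟩
      · omega
    · trivial

/-- The `l`-th canonical truncation of a DG algebra. -/
def DGAlg.trunc (B : DGAlg k) (l : ℕ) : DGAlg k := B.quot (B.truncIdeal l)

/-- The two-term quotient of a DG algebra. -/
def DGAlg.flat (B : DGAlg k) : DGAlg k := B.quot B.flatIdeal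

end

/-! ### The cube construction as a complex and as a DG algebra -/

section

variable (k : Type u) [Field k]

/-- The complex `Q̄(V)`. -/
def QBarCx (V : Type u) [AddCommGroup V] [Module k V] : ChainComplex (ModuleCat.{u} k) ℕ :=
  ChainComplex.of (fun n => ModuleCat.of k (QBar k V n)) (fun n => ModuleCat.ofHom (QBar.d k V n))
    (fun n => by rw [← ModuleCat.ofHom_comp, QBar.d_comp_d]; rfl)

theorem QBarCx_d (V : Type u) [AddCommGroup V] [Module k V] (n : ℕ) :
    (QBarCx k V).d (n + 1) n = ModuleCat.ofHom (QBar.d k V n) :=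
  ChainComplex.of_d (fun n => ModuleCat.of k (QBar k V n))
    (fun n => ModuleCat.ofHom (QBar.d k V n)) n

theorem QBarCx_d_apply (V : Type u) [AddCommGroup V] [Module k V] (n : ℕ) (x : QBar k V (n + 1)) :
    ((QBarCx k V).d (n + 1) n).hom x = QBar.d k V n x := by
  rw [QBarCx_d]; rfl

variable {k} in
theorem QBar.map_d {V W : Type u} [AddCommGroup V] [Module k V] [AddCommGroup W] [Module k W]
    (g : V →ₗ[k] W) (n : ℕ) : QBar.d k W n ∘ₗ QBar.map g (n + 1) = QBar.map g n ∘ₗ QBar.d k V n := by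
  refine QBar.hom_ext fun f => ?_
  simp only [LinearMap.comp_apply, QBar.d, LinearMap.sum_apply, LinearMap.smul_apply, map_sum,
    map_smul, QBar.map_mk, QBar.partialD_mk, map_sub]
  refine Finset.sum_congr rfl fun j _ => ?_
  congr 3
  congr 1
  funext x
  exact (map_add g _ _).symm

variable {k} in
/-- Functoriality of the complex `Q̄(V)`. -/
def QBarCxMap {V W : Type u} [AddCommGroup V] [Module k V] [AddCommGroup W] [Module k W]
    (g : V →ₗ[k] W) : QBarCx k V ⟶ QBarCx k W where
  f n := ModuleCat.ofHom (QBar.map g n)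
  comm' i j h := by
    obtain rfl : j + 1 = i := h
    rw [QBarCx_d, QBarCx_d]
    ext x
    exact LinearMap.congr_fun (QBar.map_d g j) x

/-- The two-term complex `V♭`: `V♭₀ = Q̄₀(V)`, `V♭₁ = Q̄₁(V) / Im d`. -/
abbrev flatV (V : Type u) [AddCommGroup V] [Module k V] : ChainComplex (ModuleCat.{u} k) ℕ :=
  flatCx (QBarCx k V)

variable {k} in
/-- Functoriality of `V♭`. -/
abbrev flatVMap {V W : Type u} [AddCommGroup V] [Module k V] [AddCommGroup W] [Module k W]
    (g : V →ₗ[k] W) : flatV k V ⟶ flatV k W :=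
  flatCxMap (QBarCxMap g)

/-- The DG algebra `Q̄(A)`; its unit is the class of `1 ∈ A`. -/
def QBarAlg (A : Type u) [Ring A] [Algebra k A] : DGAlg k where
  cx := QBarCx k A
  one := QBar.mk k (fun _ => 1)
  mul h := QBar.mul k A h
  one_mul h x := QBar.one_mul' h x
  mul_one h x := QBar.mul_one' h x
  mul_assoc h₁ h₂ h₃ h₄ x y z := QBar.mul_assoc' h₁ h₂ h₃ h₄ x y z
  d_mul h h₁ h₂ x y := by
    rw [QBarCx_d, QBarCx_d, QBarCx_d]
    exact QBar.d_mul h h₁ h₂ x y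
  d_mul_zero h h' x y := by
    rw [QBarCx_d, QBarCx_d]
    exact QBar.d_mul_zero h h' x y
  d_zero_mul h h' x y := by
    rw [QBarCx_d, QBarCx_d]
    exact QBar.d_zero_mul h h' x y

variable {k} in
theorem QBar.map_mul {A B : Type u} [Ring A] [Algebra k A] [Ring B] [Algebra k B] (g : A →ₐ[k] B)
    {i j n : ℕ} (h : i + j = n) (x : QBar k A i) (y : QBar k A j) :
    QBar.map g.toLinearMap n (QBar.mul k A h x y) =
      QBar.mul k B h (QBar.map g.toLinearMap i x) (QBar.map g.toLinearMap j y) := by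
  induction x using QBar.induction_on with
  | hadd a b ha hb => simp only [map_add, LinearMap.add_apply, ha, hb]
  | hsmul c a ha => simp only [map_smul, LinearMap.smul_apply, ha]
  | hmk f =>
  induction y using QBar.induction_on with
  | hadd a b ha hb => simp only [map_add, ha, hb]
  | hsmul c a ha => simp only [map_smul, ha]
  | hmk e =>
  rw [QBar.mul_mk, QBar.map_mk, QBar.map_mk, QBar.map_mk, QBar.mul_mk]
  congr 1
  funext x
  exact _root_.map_mul g _ _

variable {k} in
/-- Functoriality of the DG algebra `Q̄(A)`. -/
def QBarAlgMap {A B : Type u} [Ring A] [Algebra k A] [Ring B] [Algebra k B] (g : A →ₐ[k] B) :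
    QBarAlg k A ⟶ QBarAlg k B :=
  DGAlg.Hom.mk (QBarCxMap g.toLinearMap)
    (by
      refine (QBar.map_mk _ _).trans ?_
      change QBar.mk k _ = QBar.mk k _
      congr 1
      funext x
      exact map_one g)
    (fun h x y => QBar.map_mul g h x y)

/-- The degree `0` part of the augmentation, `[v] ↦ v`. -/
def QBar.aug₀ (V : Type u) [AddCommGroup V] [Module k V] : QBar k V 0 →ₗ[k] V :=
  QBar.lift (fun f => f Fin.elim0) rfl (fun _ ⟨i, _⟩ => i.elim0) (fun _ _ => rfl)

/-- The terms of the augmentation `Q̄(A) → A`. -/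
def augTerm (A : Type u) [Ring A] [Algebra k A] : ∀ n : ℕ, QBar k A n →ₗ[k] DGAlg.singleX k A n
  | 0 => QBar.aug₀ k A
  | _ + 1 => 0

theorem QBar.aug₀_d (V : Type u) [AddCommGroup V] [Module k V] :
    QBar.aug₀ k V ∘ₗ QBar.d k V 0 = 0 := by
  refine QBar.hom_ext fun f => ?_
  simp [QBar.aug₀, QBar.d, QBar.partialD_mk]

theorem QBar.aug₀_one (A : Type u) [Ring A] [Algebra k A] :
    QBar.aug₀ k A (QBar.mk k (fun _ => 1)) = 1 :=
  QBar.lift_mk ..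

theorem QBar.aug₀_mul (A : Type u) [Ring A] [Algebra k A] (h : 0 + 0 = 0) (x y : QBar k A 0) :
    QBar.aug₀ k A (QBar.mul k A h x y) = QBar.aug₀ k A x * QBar.aug₀ k A y := by
  induction x using QBar.induction_on with
  | hadd a b ha hb => simp only [map_add, LinearMap.add_apply, ha, hb, add_mul]
  | hsmul c a ha => simp only [map_smul, LinearMap.smul_apply, ha, smul_mul_assoc]
  | hmk f =>
  induction y using QBar.induction_on with
  | hadd a b ha hb => simp only [map_add, ha, hb, mul_add]
  | hsmul c a ha => simp only [map_smul, ha, mul_smul_comm]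
  | hmk g =>
  rw [QBar.mul_mk, QBar.aug₀, QBar.lift_mk, QBar.lift_mk, QBar.lift_mk, QBar.Cube.mul]
  congr 1

/-- The augmentation `Q̄(A) → A`. -/
def aug (A : Type u) [Ring A] [Algebra k A] : QBarAlg k A ⟶ DGAlg.single k A :=
  DGAlg.Hom.mk
    { f := fun n => ModuleCat.ofHom (augTerm k A n)
      comm' := fun i j h => by
        obtain rfl : j + 1 = i := h
        refine ModuleCat.hom_ext (LinearMap.ext fun x => ?_)
        cases j with
        | zero =>
          refine ((congrArg (QBar.aug₀ k A) (QBarCx_d_apply k A 0 x)).trans ?_).symm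
          exact LinearMap.congr_fun (QBar.aug₀_d k A) x
        | succ j => rfl }
    (QBar.aug₀_one k A)
    (by
      intro i j n h x y
      cases n with
      | succ n => exact Subsingleton.elim (α := DGAlg.singleX k A (n + 1)) _ _
      | zero =>
        obtain ⟨rfl, rfl⟩ : i = 0 ∧ j = 0 := by omega
        exact QBar.aug₀_mul k A h x y)

theorem QBar.map_id (V : Type u) [AddCommGroup V] [Module k V] (n : ℕ) :
    QBar.map (LinearMap.id : V →ₗ[k] V) n = LinearMap.id :=
  QBar.hom_ext fun f => by simp

variable {k} in
theorem QBar.map_comp {U V W : Type u} [AddCommGroup U] [Module k U] [AddCommGroup V] [Module k V]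
    [AddCommGroup W] [Module k W] (f : U →ₗ[k] V) (g : V →ₗ[k] W) (n : ℕ) :
    QBar.map (g ∘ₗ f) n = QBar.map g n ∘ₗ QBar.map f n :=
  QBar.hom_ext fun f => by simp

/-- The truncation `Q̄_{≤ l}(A)`, as a functor of the algebra `A`. -/
def QBarLE (l : ℕ) : AlgCat.{u} k ⥤ DGAlg k where
  obj A := (QBarAlg k A).trunc l
  map g := DGAlg.quotMap (QBarAlgMap g.hom) _ _ (fun n => truncSub_map _ l n)
  map_id A := by
    refine DGAlg.hom_ext (HomologicalComplex.hom_ext _ _ fun n => ?_)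
    refine ModuleCat.hom_ext (Submodule.linearMap_qext _ (LinearMap.ext fun x => ?_))
    exact congrArg Submodule.Quotient.mk (LinearMap.congr_fun (QBar.map_id k A n) x)
  map_comp f g := by
    refine DGAlg.hom_ext (HomologicalComplex.hom_ext _ _ fun n => ?_)
    refine ModuleCat.hom_ext (Submodule.linearMap_qext _ (LinearMap.ext fun x => ?_))
    exact congrArg Submodule.Quotient.mk
      (LinearMap.congr_fun (QBar.map_comp f.hom.toLinearMap g.hom.toLinearMap n) x)

/-- The augmentation `Q̄_{≤ l}(A) → A`. -/
def augLE (l : ℕ) (A : Type u) [Ring A] [Algebra k A] : (QBarAlg k A).trunc l ⟶ DGAlg.single k A :=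
  DGAlg.quotLift (aug k A) _ (fun n x hx => by
    cases n with
    | zero =>
      have hx' : x ∈ truncSub (QBarCx k A) l 0 := hx
      rw [truncSub, if_pos (Nat.zero_le l)] at hx'
      have hx0 : x = 0 := hx'
      subst hx0
      exact Submodule.zero_mem _
    | succ n => exact Subsingleton.elim (α := DGAlg.singleX k A (n + 1)) _ _)

/-- The two-term DG algebra `A♭`. -/
abbrev flatA (A : Type u) [Ring A] [Algebra k A] : DGAlg k := (QBarAlg k A).flat

end

/-! ### Splittings of two-term complexes -/

/-- The maps `a : K₀₁ → K₀` and `b : K₁ → K₀₁` make `K₀₁` a splitting of the two-term complex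
`d : K₁ → K₀`. -/
structure IsSplitting {k : Type u} [Field k] {K₁ K₀ K₀₁ : Type u} [AddCommGroup K₁] [Module k K₁]
    [AddCommGroup K₀] [Module k K₀] [AddCommGroup K₀₁] [Module k K₀₁] (d : K₁ →ₗ[k] K₀)
    (a : K₀₁ →ₗ[k] K₀) (b : K₁ →ₗ[k] K₀₁) : Prop where
  surjective : Function.Surjective a
  injective : Function.Injective b
  comp : a ∘ₗ b = d
  /-- `b` induces an isomorphism `Ker d → Ker a` -/
  ker : Set.BijOn b (LinearMap.ker d) (LinearMap.ker a)
  /-- `a` induces an isomorphism `Coker b → Coker d` -/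
  coker : Function.Bijective ((LinearMap.range b).mapQ (LinearMap.range d) a (by
    rintro _ ⟨x, rfl⟩
    exact ⟨x, by rw [← comp]; rfl⟩))

/-- A splitting of a complex `C` of `k`-vector spaces concentrated in degrees `0` and `1`. -/
structure Spl {k : Type u} [Field k] (C : ChainComplex (ModuleCat.{u} k) ℕ) where
  /-- the object `K₀₁` -/
  carrier : Type u
  [addCommGroup : AddCommGroup carrier]
  [module : Module k carrier]
  /-- the map `K₀₁ → K₀` -/
  a : carrier →ₗ[k] C.X 0
  /-- the map `K₁ → K₀₁` -/
  b : C.X 1 →ₗ[k] carrier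
  isSplitting : IsSplitting (C.d 1 0).hom a b

attribute [instance] Spl.addCommGroup Spl.module

namespace Spl

variable {k : Type u} [Field k]

/-- Isomorphisms of splittings. -/
@[ext]
structure Hom {C : ChainComplex (ModuleCat.{u} k) ℕ} (S T : Spl C) where
  /-- the underlying isomorphism -/
  e : S.carrier ≃ₗ[k] T.carrier
  comm_a : ∀ x, T.a (e x) = S.a x
  comm_b : ∀ y, e (S.b y) = T.b y

/-- The groupoid of splittings of `C`. -/
instance (C : ChainComplex (ModuleCat.{u} k) ℕ) : Groupoid (Spl C) where
  Hom := Hom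
  id S := ⟨LinearEquiv.refl k _, fun _ => rfl, fun _ => rfl⟩
  comp φ ψ := ⟨φ.e.trans ψ.e, by simp [φ.comm_a, ψ.comm_a], by simp [φ.comm_b, ψ.comm_b]⟩
  inv φ := ⟨φ.e.symm, fun x => by rw [← φ.comm_a]; simp, fun y => by rw [← φ.comm_b]; simp⟩
  inv_comp φ := Hom.ext (LinearEquiv.ext fun x => by simp)
  comp_inv φ := Hom.ext (LinearEquiv.ext fun x => by simp)

/-- Maps from a splitting of `C` to a splitting of `D` over a map of complexes `f : C ⟶ D`. -/
@[ext]
structure HomOver {C D : ChainComplex (ModuleCat.{u} k) ℕ} (f : C ⟶ D) (S : Spl C) (T : Spl D) where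
  /-- the underlying linear map -/
  φ : S.carrier →ₗ[k] T.carrier
  comm_a : ∀ x, T.a (φ x) = (f.f 0).hom (S.a x)
  comm_b : ∀ y, φ (S.b y) = T.b ((f.f 1).hom y)

end Spl

/-- A multiplicative splitting of a DG algebra `B` concentrated in degrees `0` and `1`: the
splitting `K₀₁` is an algebra, `a` is an algebra map, and `b` is a map of `K₀₁`-bimodules. -/
structure MulSpl {k : Type u} [Field k] (B : DGAlg k) where
  /-- the algebra `K₀₁` -/
  carrier : Type u
  [ring : Ring carrier]
  [algebra : Algebra k carrier]
  /-- the map `K₀₁ → K₀` -/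
  a : carrier →ₗ[k] B.cx.X 0
  /-- the map `K₁ → K₀₁` -/
  b : B.cx.X 1 →ₗ[k] carrier
  isSplitting : IsSplitting (B.cx.d 1 0).hom a b
  map_one : a 1 = B.one
  map_mul : ∀ x y, a (x * y) = B.mul (zero_add 0) (a x) (a y)
  left : ∀ x m, b (B.mul (zero_add 1) (a x) m) = x * b m
  right : ∀ x m, b (B.mul (add_zero 1) m (a x)) = b m * x

attribute [instance] MulSpl.ring MulSpl.algebra

namespace MulSpl

variable {k : Type u} [Field k] {B : DGAlg k}

/-- Isomorphisms of multiplicative splittings. -/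
@[ext]
structure Hom (S T : MulSpl B) where
  /-- the underlying isomorphism -/
  e : S.carrier ≃ₐ[k] T.carrier
  comm_a : ∀ x, T.a (e x) = S.a x
  comm_b : ∀ y, e (S.b y) = T.b y

/-- The groupoid of multiplicative splittings of `B`. -/
instance : Groupoid (MulSpl B) where
  Hom := Hom
  id S := ⟨AlgEquiv.refl, fun _ => rfl, fun _ => rfl⟩
  comp φ ψ := ⟨φ.e.trans ψ.e, by simp [φ.comm_a, ψ.comm_a], by simp [φ.comm_b, ψ.comm_b]⟩
  inv φ := ⟨φ.e.symm, fun x => by rw [← φ.comm_a]; simp, fun y => by rw [← φ.comm_b]; simp⟩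
  inv_comp φ := Hom.ext (AlgEquiv.ext fun x => by simp)
  comp_inv φ := Hom.ext (AlgEquiv.ext fun x => by simp)

/-- Forget the product. -/
def forget (B : DGAlg k) : MulSpl B ⥤ Spl B.cx where
  obj S := { carrier := S.carrier, a := S.a, b := S.b, isSplitting := S.isSplitting }
  map φ := Spl.Hom.mk φ.e.toLinearEquiv φ.comm_a φ.comm_b

end MulSpl

/-- Multiplicative splittings of `A♭` are splittings of the underlying complex `A♭`. -/
def forgetFlat (k : Type u) [Field k] (A : Type u) [Ring A] [Algebra k A] :
    MulSpl (flatA k A) ⥤ Spl (flatV k A) :=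
  MulSpl.forget (flatA k A)

/-! ### Liftings to the second Witt vectors -/

/-- The ring `W₂(k)` of Witt vectors of length two. -/
abbrev W₂ (p : ℕ) (k : Type u) : Type u := TruncatedWittVector p 2 k

/-- The reduction map `W₂(k) → k`, `(x₀, x₁) ↦ x₀`. -/
def residue (p : ℕ) [Fact p.Prime] (k : Type u) [CommRing k] : W₂ p k →+* k where
  toFun x := x.coeff 0
  map_one' := by
    have h := WittVector.coeff_truncate (p := p) (n := 2) (1 : WittVector p k) 0
    rw [_root_.map_one] at h
    simpa using h
  map_zero' := by simp
  map_mul' x y := by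
    obtain ⟨x, rfl⟩ := WittVector.truncate_surjective p 2 k x
    obtain ⟨y, rfl⟩ := WittVector.truncate_surjective p 2 k y
    rw [← _root_.map_mul]
    simp only [WittVector.coeff_truncate]
    exact WittVector.mul_coeff_zero x y
  map_add' x y := by
    obtain ⟨x, rfl⟩ := WittVector.truncate_surjective p 2 k x
    obtain ⟨y, rfl⟩ := WittVector.truncate_surjective p 2 k y
    rw [← map_add]
    simp only [WittVector.coeff_truncate]
    exact WittVector.add_coeff_zero x y

/-- A flat lifting of the `k`-vector space `V` to `W₂(k)`: a flat `W₂(k)`-module `V'` with an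
identification `V' / p ≅ V`, given as a surjective map `V' → V`, linear over `W₂(k) → k`, with
kernel `p V'`. -/
structure Lift (p : ℕ) [Fact p.Prime] (k : Type u) [Field k] (V : Type u) [AddCommGroup V]
    [Module k V] where
  /-- the lifting `V'` -/
  carrier : Type u
  [addCommGroup : AddCommGroup carrier]
  [module : Module (W₂ p k) carrier]
  flat : Module.Flat (W₂ p k) carrier
  /-- the reduction `V' → V` -/
  proj : carrier →ₛₗ[residue p k] V
  surjective : Function.Surjective proj
  ker : ∀ x, proj x = 0 ↔ ∃ y : carrier, x = (p : W₂ p k) • y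

attribute [instance] Lift.addCommGroup Lift.module

namespace Lift

variable {p : ℕ} [Fact p.Prime] {k : Type u} [Field k] {V W : Type u} [AddCommGroup V]
  [Module k V] [AddCommGroup W] [Module k W]

/-- Isomorphisms of liftings. -/
@[ext]
structure Hom (L M : Lift p k V) where
  /-- the underlying isomorphism -/
  e : L.carrier ≃ₗ[W₂ p k] M.carrier
  comm : ∀ x, M.proj (e x) = L.proj x

/-- The groupoid of flat liftings of `V`. -/
instance : Groupoid (Lift p k V) where
  Hom := Hom
  id L := ⟨LinearEquiv.refl _ _, fun _ => rfl⟩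
  comp φ ψ := ⟨φ.e.trans ψ.e, by simp [φ.comm, ψ.comm]⟩
  inv φ := ⟨φ.e.symm, fun x => by rw [← φ.comm]; simp⟩
  inv_comp φ := Hom.ext (LinearEquiv.ext fun x => by simp)
  comp_inv φ := Hom.ext (LinearEquiv.ext fun x => by simp)

/-- Maps from a lifting of `V` to a lifting of `W` over a linear map `f : V → W`. -/
@[ext]
structure HomOver (f : V →ₗ[k] W) (L : Lift p k V) (M : Lift p k W) where
  /-- the underlying linear map -/
  φ : L.carrier →ₗ[W₂ p k] M.carrier
  comm : ∀ x, M.proj (φ x) = f (L.proj x)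

/-- An isomorphism of liftings of `V`, as a map over the identity of `V`. -/
def Hom.toHomOver {L M : Lift p k V} (g : L ⟶ M) : HomOver LinearMap.id L M :=
  ⟨g.e.toLinearMap, g.comm⟩

/-- Composition of maps of liftings. -/
def HomOver.comp {U : Type u} [AddCommGroup U] [Module k U] {f : U →ₗ[k] V} {g : V →ₗ[k] W}
    {L : Lift p k U} {M : Lift p k V} {N : Lift p k W} (ψ : HomOver g M N) (φ : HomOver f L M) :
    HomOver (g ∘ₗ f) L N :=
  ⟨ψ.φ ∘ₗ φ.φ, fun x => by simp [ψ.comm, φ.comm]⟩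

end Lift

/-- A flat lifting of the `k`-algebra `A` to `W₂(k)`: a flat `W₂(k)`-algebra `A'` with an
identification of algebras `A' / p ≅ A`. -/
structure AlgLift (p : ℕ) [Fact p.Prime] (k : Type u) [Field k] (A : Type u) [Ring A]
    [Algebra k A] where
  /-- the lifting `A'` -/
  carrier : Type u
  [ring : Ring carrier]
  [algebra : Algebra (W₂ p k) carrier]
  flat : Module.Flat (W₂ p k) carrier
  /-- the reduction `A' → A` -/
  proj : carrier →+* A
  proj_algebraMap : ∀ w, proj (algebraMap (W₂ p k) carrier w) = algebraMap k A (residue p k w)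
  surjective : Function.Surjective proj
  ker : ∀ x, proj x = 0 ↔ ∃ y : carrier, x = (p : W₂ p k) • y

attribute [instance] AlgLift.ring AlgLift.algebra

namespace AlgLift

variable {p : ℕ} [Fact p.Prime] {k : Type u} [Field k] {A : Type u} [Ring A] [Algebra k A]

/-- Isomorphisms of algebra liftings. -/
@[ext]
structure Hom (L M : AlgLift p k A) where
  /-- the underlying isomorphism -/
  e : L.carrier ≃ₐ[W₂ p k] M.carrier
  comm : ∀ x, M.proj (e x) = L.proj x

/-- The groupoid of flat algebra liftings of `A`. -/
instance : Groupoid (AlgLift p k A) where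
  Hom := Hom
  id L := ⟨AlgEquiv.refl, fun _ => rfl⟩
  comp φ ψ := ⟨φ.e.trans ψ.e, by simp [φ.comm, ψ.comm]⟩
  inv φ := ⟨φ.e.symm, fun x => by rw [← φ.comm]; simp⟩
  inv_comp φ := Hom.ext (AlgEquiv.ext fun x => by simp)
  comp_inv φ := Hom.ext (AlgEquiv.ext fun x => by simp)

/-- Forget the product. -/
def forget (p : ℕ) [Fact p.Prime] (k : Type u) [Field k] (A : Type u) [Ring A] [Algebra k A] :
    AlgLift p k A ⥤ Lift p k A where
  obj L :=
    { carrier := L.carrier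
      flat := L.flat
      proj :=
        { toFun := L.proj
          map_add' := map_add L.proj
          map_smul' := fun w x => by
            rw [Algebra.smul_def, _root_.map_mul, L.proj_algebraMap, ← Algebra.smul_def] }
      surjective := L.surjective
      ker := L.ker }
  map φ := Lift.Hom.mk φ.e.toLinearEquiv φ.comm

end AlgLift

/-- The category of pairs `(A, A')` of a `k`-algebra `A` and a flat lifting `A'` of `A` to `W₂(k)`
(with arbitrary algebra maps as morphisms). -/
structure AlgWithLift (p : ℕ) [Fact p.Prime] (k : Type u) [Field k] where
  /-- the algebra `A` -/
  base : AlgCat.{u} k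
  /-- the lifting `A'` -/
  lift : AlgLift p k base

namespace AlgWithLift

variable {p : ℕ} [Fact p.Prime] {k : Type u} [Field k]

/-- A map of algebras together with a map of their liftings over it. -/
@[ext]
structure Hom (X Y : AlgWithLift p k) where
  /-- the map `A → B` -/
  base : X.base ⟶ Y.base
  /-- the map `A' → B'` -/
  lift : X.lift.carrier →ₐ[W₂ p k] Y.lift.carrier
  comm : ∀ x, Y.lift.proj (lift x) = base.hom (X.lift.proj x)

instance : Category (AlgWithLift p k) where
  Hom := Hom
  id X := ⟨𝟙 _, AlgHom.id _ _, fun _ => rfl⟩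
  comp φ ψ := ⟨φ.base ≫ ψ.base, ψ.lift.comp φ.lift, by simp [φ.comm, ψ.comm]⟩

variable (p k) in
/-- The projection `(A, A') ↦ A`. -/
def toAlg : AlgWithLift p k ⥤ AlgCat.{u} k where
  obj X := X.base
  map φ := φ.base

end AlgWithLift

end CubeConstruction

end

/-! To a flat lifting `V'` of `V` attach the space `Symb` spanned by symbols [x], x ∈ V', subject to
[τ(c) x] = c [x] for c ∈ kˣ, with τ the Teichmüller map, and [x + p y] = [x] + [p y]. The map a
sends [x] to [x mod p]. Since the defect [x] + [y] − [x + y] does not change when x and y are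
altered by multiples of p, it is a cocycle on V, and it defines b on V♭₁, the target of the
universal homogeneous symmetric cocycle (v, w) ↦ [v, w].

That a and b form a splitting rests on two computations. The kernel of a consists of the symbols [p
y], and [p y] ↦ y mod p is well defined (`exists_symb_retraction`). The kernel of d on V♭₁ consists
of the elements θ(v) = ∑_{i<p} [i v, v] (`FlatV.exists_eq_theta`): a cocycle with θ = 0 defines an
extension annihilated by p, which splits over 𝔽_p, and averaging over kˣ makes the splitting
homogeneous (`exists_coboundary`). As b(θ(x mod p)) = p [x] − [p x] = −[p x] by telescoping
(`symbB_theta`), b matches the two kernels.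

Conversely, V' is recovered from its splitting: x ↦ [x] is injective, its image is the preimage
under a of the set of generators [v], the sum is read off from b, and the scalars from the
Teichmüller action. This gives full faithfulness (`exists_linearEquiv`). Essential surjectivity is
abstract: a lifting exists (`nonempty_lift`), and any two splittings of a complex of vector spaces
are isomorphic (`Spl.nonempty_hom`).

For algebras the product is [x][y] = [x y]. In a multiplicative splitting the preimage of the
generators is closed under products, and the bimodule property of b is exactly distributivity
(`exists_algLift`).

For the DG splitting, the degree 0 term of Q̄_{≤1}(A) is replaced by the algebra of symbols, with b
∘ (Q̄₁ → A♭₁) as the differential. Injectivity of b removes the homology in degree 1, the homology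
in degree 0 is Coker b = Coker d = A, and the truncation makes the differential out of degree 2
injective. -/

noncomputable section

namespace CubeConstruction

/-! ### Teichmüller representatives and arithmetic in W₂(k) -/

section Teichmuller

variable {p : ℕ} [Fact p.Prime] {k : Type u} [Field k]

variable (p) in
/-- The Teichmüller representative in `W₂(k)`. -/
def teich : k →* W₂ p k :=
  (WittVector.truncate 2 : WittVector p k →+* W₂ p k).toMonoidHom.comp (WittVector.teichmuller p)

theorem teich_apply (c : k) : teich p c = WittVector.truncate 2 (WittVector.teichmuller p c) := rfl

theorem residue_truncate (w : WittVector p k) :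
    residue p k (WittVector.truncate 2 w) = w.coeff 0 :=
  WittVector.coeff_truncate w 0

@[simp]
theorem residue_teich (c : k) : residue p k (teich p c) = c := by
  rw [teich_apply, residue_truncate, WittVector.teichmuller_coeff_zero]

@[simp]
theorem teich_zero : teich p (0 : k) = 0 := by
  rw [teich_apply, WittVector.teichmuller_zero, map_zero]

theorem residue_natCast_self [CharP k p] : residue p k (p : W₂ p k) = 0 := by
  rw [map_natCast, CharP.cast_eq_zero]

theorem truncate_two_eq_zero_iff (w : WittVector p k) :
    (WittVector.truncate 2 w : W₂ p k) = 0 ↔ w.coeff 0 = 0 ∧ w.coeff 1 = 0 := by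
  rw [← RingHom.mem_ker, WittVector.mem_ker_truncate]
  constructor
  · intro h
    exact ⟨h 0 (by norm_num), h 1 (by norm_num)⟩
  · rintro ⟨h₀, h₁⟩ i hi
    interval_cases i <;> assumption

/-- In characteristic p one has p · (x₀, x₁) = (0, x₀ᵖ). -/
theorem natCast_mul_eq_zero_iff [CharP k p] (w : W₂ p k) :
    (p : W₂ p k) * w = 0 ↔ residue p k w = 0 := by
  obtain ⟨w, rfl⟩ := WittVector.truncate_surjective p 2 k w
  rw [residue_truncate, mul_comm, ← map_natCast (WittVector.truncate 2 : WittVector p k →+* W₂ p k),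
    ← map_mul, truncate_two_eq_zero_iff, WittVector.mul_charP_coeff_zero,
    WittVector.mul_charP_coeff_succ]
  simp [(Fact.out : p.Prime).ne_zero]

theorem natCast_mul_natCast [CharP k p] : (p : W₂ p k) * (p : W₂ p k) = 0 :=
  (natCast_mul_eq_zero_iff _).2 residue_natCast_self

/-- Since p τ(y) = (0, yᵖ), the required y is a p-th root of the second Witt component; it exists
because a finite field is perfect. -/
theorem exists_eq_natCast_mul_teich [CharP k p] [Finite k] {w : W₂ p k} (hw : residue p k w = 0) :
    ∃ y : k, w = (p : W₂ p k) * teich p y := by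
  obtain ⟨w, rfl⟩ := WittVector.truncate_surjective p 2 k w
  rw [residue_truncate] at hw
  have : ExpChar k p := ExpChar.prime Fact.out
  obtain ⟨y, hy⟩ := (PerfectField.toPerfectRing (K := k) p).bijective_frobenius.2 (w.coeff 1)
  refine ⟨y, ?_⟩
  rw [mul_comm, teich_apply,
    ← map_natCast (WittVector.truncate 2 : WittVector p k →+* W₂ p k), ← map_mul]
  ext i
  rw [WittVector.coeff_truncate, WittVector.coeff_truncate]
  fin_cases i
  · simp [hw, WittVector.mul_charP_coeff_zero]
  · rw [show ((⟨1, by omega⟩ : Fin 2) : ℕ) = 0 + 1 from rfl, WittVector.mul_charP_coeff_succ,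
      WittVector.teichmuller_coeff_zero]
    exact hy.symm

theorem exists_eq_teich_add [CharP k p] [Finite k] (w : W₂ p k) :
    ∃ x y : k, w = teich p x + (p : W₂ p k) * teich p y := by
  obtain ⟨y, hy⟩ := exists_eq_natCast_mul_teich (w := w - teich p (residue p k w)) (by simp)
  exact ⟨residue p k w, y, by rw [← hy]; simp⟩

theorem residue_surjective : Function.Surjective (residue p k) := fun c => ⟨teich p c, by simp⟩

/-- An additive map that commutes with the Teichmüller representatives of units is linear
over `W₂(k)`. -/
theorem map_smul_of_teich [CharP k p] [Finite k] {M N : Type*} [AddCommGroup M] [Module (W₂ p k) M]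
    [AddCommGroup N] [Module (W₂ p k) N] (φ : M →+ N)
    (h : ∀ (c : kˣ) x, φ (teich p (c : k) • x) = teich p (c : k) • φ x) (w : W₂ p k) (x : M) :
    φ (w • x) = w • φ x := by
  have h' : ∀ (c : k) x, φ (teich p c • x) = teich p c • φ x := by
    intro c x
    by_cases hc : c = 0
    · simp [hc]
    · exact h (Units.mk0 c hc) x
  obtain ⟨a, b, rfl⟩ := exists_eq_teich_add w
  simp only [add_smul, mul_smul, map_add, h', Nat.cast_smul_eq_nsmul, map_nsmul]

/-- The group kˣ has q − 1 elements, and q = 0 in k. Averaging over kˣ is therefore possible, and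
normalizing an average only costs a sign. -/
theorem sum_units_one [Finite k] [Fintype kˣ] : (∑ _c : kˣ, (1 : k)) = -1 := by
  have := Fintype.ofFinite k
  rw [Finset.sum_const, Finset.card_univ, nsmul_one, Fintype.card_eq_nat_card, Nat.card_units,
    Nat.card_eq_fintype_card, Nat.cast_sub Fintype.card_pos, FiniteField.cast_card_eq_zero]
  simp

end Teichmuller

/-! ### Flat liftings: flatness over W₂(k) and existence -/

namespace Lift

variable {p : ℕ} [Fact p.Prime] {k : Type u} [Field k] {V : Type u}
  [AddCommGroup V] [Module k V] (L : Lift p k V)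

@[simp]
theorem proj_teich_smul (c : k) (x : L.carrier) : L.proj (teich p c • x) = c • L.proj x := by
  rw [LinearMap.map_smulₛₗ, residue_teich]

@[simp]
theorem proj_natCast_smul (x : L.carrier) : L.proj ((p : W₂ p k) • x) = 0 :=
  (L.ker _).2 ⟨x, rfl⟩

/-- By the equational criterion of flatness, a relation p x = 0 comes from an expression x = ∑ aⱼ yⱼ
with p aⱼ = 0, and then every aⱼ reduces to 0. The converse is p² = 0. This makes division by p a
well-defined map p V' → V. -/
theorem natCast_smul_eq_zero_iff [CharP k p] (x : L.carrier) :
    (p : W₂ p k) • x = 0 ↔ L.proj x = 0 := by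
  constructor
  · intro h
    have := L.flat
    have h1 : ∑ i : Fin 1, (fun _ => (p : W₂ p k)) i • (fun _ => x) i = 0 := by simpa using h
    obtain ⟨κ, a, y, hx, ha⟩ := Module.Flat.isTrivialRelation_of_sum_smul_eq_zero h1
    have hx' : x = _ := hx 0
    rw [hx', map_sum]
    refine Finset.sum_eq_zero fun j _ => ?_
    have : (p : W₂ p k) * a 0 j = 0 := by simpa using ha j
    rw [LinearMap.map_smulₛₗ, (natCast_mul_eq_zero_iff _).1 this, zero_smul]
  · intro h
    obtain ⟨y, rfl⟩ := (L.ker x).1 h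
    rw [← mul_smul, natCast_mul_natCast, zero_smul]

theorem exists_eq_add {x y : L.carrier} (h : L.proj x = L.proj y) :
    ∃ z, x = y + (p : W₂ p k) • z := by
  obtain ⟨z, hz⟩ := (L.ker (x - y)).1 (by rw [map_sub, h, sub_self])
  exact ⟨z, by rw [← hz]; abel⟩

/-- Every vector space has a flat lifting. -/
theorem nonempty_lift [CharP k p] [Finite k] (V : Type u) [AddCommGroup V] [Module k V] :
    Nonempty (Lift p k V) := by
  let B := Module.Basis.ofVectorSpace k V
  let ι := Module.Basis.ofVectorSpaceIndex k V
  let r : (ι →₀ W₂ p k) →ₛₗ[residue p k] (ι →₀ k) :=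
    { toFun := Finsupp.mapRange (residue p k) (map_zero _)
      map_add' := fun x y => Finsupp.mapRange_add (map_add _) x y
      map_smul' := fun c x => by ext i; simp }
  refine ⟨{ carrier := ι →₀ W₂ p k
            flat := inferInstance
            proj := B.repr.symm.toLinearMap.comp r
            surjective := B.repr.symm.surjective.comp
              (Finsupp.mapRange_surjective _ (map_zero _) residue_surjective)
            ker := fun x => ?_ }⟩
  have h0 : B.repr.symm.toLinearMap.comp r x = 0 ↔ r x = 0 :=
    map_eq_zero_iff B.repr.symm B.repr.symm.injective
  rw [h0]
  constructor
  · intro h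
    have hi : ∀ i, ∃ y : k, x i = (p : W₂ p k) * teich p y := fun i =>
      exists_eq_natCast_mul_teich (DFunLike.congr_fun h i)
    choose y hy using hi
    classical
    -- The default value 0 off the support of `x` makes finiteness of the support evident.
    refine ⟨Finsupp.onFinset x.support (fun i => if x i = 0 then 0 else teich p (y i))
      (fun i hi => ?_), ?_⟩
    · rw [Finsupp.mem_support_iff]
      intro h0
      simp [h0] at hi
    · ext1 i
      simp only [Finsupp.smul_apply, Finsupp.onFinset_apply, smul_eq_mul]
      split_ifs with hxi
      · simp [hxi]
      · exact hy i
  · rintro ⟨y, rfl⟩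
    ext i
    simp [r]

end Lift

/-! ### Homogeneous symmetric cocycles -/

/-- A normalized symmetric `2`-cocycle that is homogeneous with respect to the units of `k`. -/
structure IsCocycle (k : Type u) [Field k] {V N : Type*} [AddCommGroup V] [Module k V]
    [AddCommGroup N] [Module k N] (c : V → V → N) : Prop where
  zero_left : ∀ v, c 0 v = 0
  symm : ∀ v w, c v w = c w v
  assoc : ∀ v w x, c v (w + x) + c w x = c (v + w) x + c v w
  smul : ∀ (t : kˣ) v w, c ((t : k) • v) ((t : k) • w) = (t : k) • c v w

namespace IsCocycle

variable {k : Type u} [Field k] {V N P : Type*} [AddCommGroup V] [Module k V]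
  [AddCommGroup N] [Module k N] [AddCommGroup P] [Module k P] {c : V → V → N}

theorem zero_right (h : IsCocycle k c) (v : V) : c v 0 = 0 := by rw [h.symm, h.zero_left]

/-- In the commutative extension defined by the cocycle, (v + x) + (w + y) and (v + w) + (x + y)
have the same correction term. This is the identity that kills the boundaries of squares. -/
theorem interchange (h : IsCocycle k c) (v w x y : V) :
    c (v + x) (w + y) - c v w - c x y = c (v + w) (x + y) - c v x - c w y := by
  have h₁ := h.assoc (v + x) w y
  have h₂ := h.assoc v x w
  have h₃ := h.assoc (v + w) x y
  have h₄ := h.assoc v w x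
  rw [h.symm x w, add_comm x w] at h₂
  rw [add_right_comm v x w] at h₁
  rw [← eq_sub_iff_add_eq] at h₁ h₂ h₃ h₄
  have h₅ : c (v + x) w = c v (w + x) + c w x - c v x := by rw [h₂]; abel
  have h₆ : c (v + w) x = c v (w + x) + c w x - c v w := by rw [h₄]; abel
  rw [h₁, h₃, h₅, h₆]
  abel

theorem comp (h : IsCocycle k c) (φ : N →ₗ[k] P) : IsCocycle k (fun v w => φ (c v w)) where
  zero_left v := by rw [h.zero_left, map_zero]
  symm v w := by rw [h.symm]
  assoc v w x := by rw [← map_add, h.assoc, map_add]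
  smul t v w := by rw [h.smul, map_smul]

end IsCocycle

/-! ### Generators and universal properties of V♭ -/

namespace FlatV

section

variable {V : Type u}

/-- The `1`-cube with given values. -/
def pair (v w : V) : Cube V 1 := fun x => bif x 0 then w else v

theorem pair_eta (f : Cube V 1) : pair (f fun _ => false) (f fun _ => true) = f := by
  funext x
  have hx : x = fun _ => x 0 := funext fun i => by rw [Subsingleton.elim i 0]
  rw [hx, pair]
  cases x 0 <;> rfl

theorem const_eta (f : Cube V 0) : (fun _ => f Fin.elim0) = f :=
  funext fun _ => congrArg f (Subsingleton.elim _ _)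

theorem face_zero_apply (f : Cube V 2) (b c : Bool) :
    f.face 0 b (fun _ => c) = f ![b, c] := by
  refine congrArg f ?_
  revert b c
  decide

theorem face_one_apply (f : Cube V 2) (b c : Bool) :
    f.face 1 b (fun _ => c) = f ![c, b] := by
  refine congrArg f ?_
  revert b c
  decide

theorem pair_add [AddCommGroup V] (v w v' w' : V) :
    pair v w + pair v' w' = pair (v + v') (w + w') := by
  rw [← pair_eta (pair v w + pair v' w')]
  rfl

end

section

variable {k : Type u} [Field k] {V W N : Type u} [AddCommGroup V] [Module k V]
  [AddCommGroup W] [Module k W] [AddCommGroup N] [Module k N]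

variable (k) in
/-- The generator `[v]` of `V♭₀`. -/
def gen₀ (v : V) : (flatV k V).X 0 :=
  (Submodule.Quotient.mk (QBar.mk k (fun _ => v)) : QBar k V 0 ⧸ flatSub (QBarCx k V) 0)

variable (k) in
/-- The generator `[v, w]` of `V♭₁`. -/
def gen₁ (v w : V) : (flatV k V).X 1 :=
  (Submodule.Quotient.mk (QBar.mk k (pair v w)) : QBar k V 1 ⧸ flatSub (QBarCx k V) 1)

theorem gen₀_zero : gen₀ k (0 : V) = 0 :=
  congrArg (Submodule.Quotient.mk (p := flatSub (QBarCx k V) 0)) (QBar.mk_zero (k := k) (V := V))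

theorem gen₀_smul (c : k) (v : V) : gen₀ k (c • v) = c • gen₀ k v :=
  congrArg (Submodule.Quotient.mk (p := flatSub (QBarCx k V) 0))
    (QBar.mk_smul c (fun _ => v : Cube V 0))

theorem hom_ext₀ {φ ψ : (flatV k V).X 0 →ₗ[k] N} (h : ∀ v, φ (gen₀ k v) = ψ (gen₀ k v)) :
    φ = ψ := by
  refine Submodule.linearMap_qext (flatSub (QBarCx k V) 0) (QBar.hom_ext (V := V) fun f => ?_)
  rw [← const_eta f]
  exact h _

theorem hom_ext₁ {φ ψ : (flatV k V).X 1 →ₗ[k] N} (h : ∀ v w, φ (gen₁ k v w) = ψ (gen₁ k v w)) :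
    φ = ψ := by
  refine Submodule.linearMap_qext (flatSub (QBarCx k V) 1) (QBar.hom_ext (V := V) fun f => ?_)
  rw [← pair_eta f]
  exact h _ _

/-- The universal property of `V♭₀`. -/
def lift₀ (g : V → N) (h0 : g 0 = 0) (hs : ∀ (c : kˣ) v, g ((c : k) • v) = (c : k) • g v) :
    (flatV k V).X 0 →ₗ[k] N :=
  (flatSub (QBarCx k V) 0).liftQ
    (QBar.lift (fun f => g (f Fin.elim0)) h0 (fun _ ⟨i, _⟩ => i.elim0) (fun c _ => hs c _))
    (by
      intro x hx
      rw [(Submodule.mem_bot k).1 hx]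
      exact Submodule.zero_mem _)

@[simp]
theorem lift₀_gen (g : V → N) (h0 : g 0 = 0)
    (hs : ∀ (c : kˣ) v, g ((c : k) • v) = (c : k) • g v) (v : V) :
    lift₀ g h0 hs (gen₀ k v) = g v :=
  QBar.lift_mk (V := V) (n := 0) (fun f => g (f Fin.elim0)) h0 (fun _ ⟨i, _⟩ => i.elim0)
    (fun c _ => hs c _) _

/-- The two coordinates enter with opposite signs, so the boundary of a square compares adding in
one direction with adding in the other. Dividing by such boundaries imposes precisely the
interchange law. -/
theorem d_two (f : Cube V 2) : QBar.d k V 1 (QBar.mk k f) =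
    (QBar.mk k (pair (f ![false, false] + f ![false, true]) (f ![true, false] + f ![true, true]))
      - QBar.mk k (pair (f ![false, false]) (f ![true, false]))
      - QBar.mk k (pair (f ![false, true]) (f ![true, true]))) -
    (QBar.mk k (pair (f ![false, false] + f ![true, false]) (f ![false, true] + f ![true, true]))
      - QBar.mk k (pair (f ![false, false]) (f ![false, true]))
      - QBar.mk k (pair (f ![true, false]) (f ![true, true]))) := by
  have h₀ : ∀ b, f.face 0 b = pair (f ![b, false]) (f ![b, true]) := fun b => by
    rw [← pair_eta (f.face 0 b), face_zero_apply, face_zero_apply]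
  have h₁ : ∀ b, f.face 1 b = pair (f ![false, b]) (f ![true, b]) := fun b => by
    rw [← pair_eta (f.face 1 b), face_one_apply, face_one_apply]
  simp only [QBar.d, LinearMap.sum_apply, LinearMap.smul_apply, QBar.partialD_mk]
  rw [Fin.sum_univ_two, h₀, h₀, h₁, h₁, pair_add, pair_add]
  simp
  abel

/-- The map from `Q̄₁(V)` that corresponds to a cocycle. -/
def liftQ₁ (c : V → V → N) (h : IsCocycle k c) : QBar k V 1 →ₗ[k] N :=
  QBar.lift (fun f => c (f fun _ => false) (f fun _ => true)) (h.zero_left 0)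
    (fun f hf => by
      obtain ⟨i, b, hf⟩ := hf
      cases b
      · rw [hf (fun _ => true) (by simp), h.zero_right]
      · rw [hf (fun _ => false) (by simp), h.zero_left])
    (fun t f => h.smul t _ _)

theorem liftQ₁_mk (c : V → V → N) (h : IsCocycle k c) (v w : V) :
    liftQ₁ c h (QBar.mk k (pair v w)) = c v w :=
  QBar.lift_mk (fun f : Cube V 1 => c (f fun _ => false) (f fun _ => true)) _ _ _ _

theorem liftQ₁_comp_d (c : V → V → N) (h : IsCocycle k c) :
    liftQ₁ c h ∘ₗ QBar.d k V 1 = 0 := by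
  refine QBar.hom_ext fun f => ?_
  rw [LinearMap.comp_apply, d_two]
  simp only [map_sub, liftQ₁_mk]
  exact sub_eq_zero.2 (h.interchange _ _ _ _)

/-- The universal property of `V♭₁`. -/
def lift₁ (c : V → V → N) (h : IsCocycle k c) : (flatV k V).X 1 →ₗ[k] N :=
  (flatSub (QBarCx k V) 1).liftQ (liftQ₁ c h) (by
    intro x hx
    obtain ⟨y, rfl⟩ : x ∈ LinearMap.range ((QBarCx k V).d 2 1).hom := hx
    refine (congrArg (liftQ₁ c h) (QBarCx_d_apply k V 1 y)).trans ?_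
    exact LinearMap.congr_fun (liftQ₁_comp_d c h) y)

@[simp]
theorem lift₁_gen (c : V → V → N) (h : IsCocycle k c) (v w : V) :
    lift₁ c h (gen₁ k v w) = c v w :=
  liftQ₁_mk c h v w

theorem gen₁_smul (c : k) (v w : V) : gen₁ k (c • v) (c • w) = c • gen₁ k v w := by
  refine congrArg (Submodule.Quotient.mk (p := flatSub (QBarCx k V) 1))
    (Eq.trans ?_ (QBar.mk_smul c (pair v w)))
  rw [← pair_eta (c • pair v w)]
  rfl

theorem gen₁_zero_left (w : V) : gen₁ k 0 w = 0 :=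
  congrArg (Submodule.Quotient.mk (p := flatSub (QBarCx k V) 1))
    (QBar.mk_slab (k := k) (f := pair 0 w) ⟨0, true, fun x hx => by
      rw [pair, Bool.eq_false_of_not_eq_true hx]; rfl⟩)

theorem gen₁_zero_right (v : V) : gen₁ k v 0 = 0 :=
  congrArg (Submodule.Quotient.mk (p := flatSub (QBarCx k V) 1))
    (QBar.mk_slab (k := k) (f := pair v 0) ⟨0, false, fun x hx => by
      rw [pair, Bool.eq_true_of_not_eq_false hx]; rfl⟩)

theorem gen₁_interchange (v w x y : V) :
    gen₁ k (v + x) (w + y) - gen₁ k v w - gen₁ k x y =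
      gen₁ k (v + w) (x + y) - gen₁ k v x - gen₁ k w y := by
  -- The square with v, x in the row q₀ = 0 and w, y in the row q₀ = 1; its boundary is the desired
  -- relation.
  let f : Cube V 2 := fun q => bif q 0 then (bif q 1 then y else w) else (bif q 1 then x else v)
  have h : QBar.d k V 1 (QBar.mk k f) ∈ flatSub (QBarCx k V) 1 :=
    ⟨QBar.mk k f, QBarCx_d_apply k V 1 _⟩
  rw [d_two] at h
  exact (Submodule.Quotient.eq _).2 h

-- An Eckmann–Hilton argument: the interchange law for (0, v, w, 0) is symmetry, and for (v, w, 0,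
-- x) it is the cocycle identity, because symbols with a zero entry are slabs. With `lift₁` this
-- makes [v, w] the universal homogeneous symmetric cocycle.
variable (k V) in
theorem isCocycle_gen₁ : IsCocycle k (gen₁ k (V := V)) where
  zero_left := gen₁_zero_left
  symm v w := by
    have := gen₁_interchange (k := k) 0 v w 0
    simp only [zero_add, add_zero, gen₁_zero_left, gen₁_zero_right, sub_zero] at this
    exact this.symm
  assoc v w x := by
    have := gen₁_interchange (k := k) v w 0 x
    simp only [zero_add, add_zero, gen₁_zero_left, gen₁_zero_right, sub_zero] at this
    rw [← sub_eq_sub_iff_add_eq_add, this]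
  smul t v w := gen₁_smul _ v w

theorem d_gen₁ (v w : V) :
    ((flatV k V).d 1 0).hom (gen₁ k v w) = gen₀ k v + gen₀ k w - gen₀ k (v + w) := by
  refine (congrArg (Submodule.Quotient.mk (p := flatSub (QBarCx k V) 0))
    (QBarCx_d_apply k V 0 (QBar.mk k (pair v w)))).trans ?_
  have : QBar.d k V 0 (QBar.mk k (pair v w)) =
      QBar.mk k (fun _ => v) + QBar.mk k (fun _ => w) - QBar.mk k (fun _ => v + w) := by
    simp only [QBar.d, LinearMap.sum_apply, LinearMap.smul_apply, QBar.partialD_mk]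
    rw [Fin.sum_univ_one, ← const_eta ((pair v w).face 0 false + (pair v w).face 0 true),
      ← const_eta ((pair v w).face 0 false), ← const_eta ((pair v w).face 0 true)]
    simp [Cube.face, pair]
    abel
  exact congrArg (Submodule.Quotient.mk (p := flatSub (QBarCx k V) 0)) this

theorem map_gen₀ (g : V →ₗ[k] W) (v : V) :
    ((flatVMap g).f 0).hom (gen₀ k v) = gen₀ k (g v) :=
  congrArg (Submodule.Quotient.mk (p := flatSub (QBarCx k W) 0)) (QBar.map_mk g _)

theorem map_gen₁ (g : V →ₗ[k] W) (v w : V) :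
    ((flatVMap g).f 1).hom (gen₁ k v w) = gen₁ k (g v) (g w) := by
  refine congrArg (Submodule.Quotient.mk (p := flatSub (QBarCx k W) 1))
    ((QBar.map_mk g (pair v w)).trans ?_)
  rw [← pair_eta (fun x => g (pair v w x))]
  rfl

variable (k V) in
/-- The augmentation `V♭₀ → V`. -/
def aug : (flatV k V).X 0 →ₗ[k] V := lift₀ id rfl fun _ _ => rfl

@[simp]
theorem aug_gen₀ (v : V) : aug k V (gen₀ k v) = v := lift₀_gen ..

theorem gen₀_injective : Function.Injective (gen₀ k (V := V)) := fun v w h => by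
  rw [← aug_gen₀ (k := k) v, h, aug_gen₀]

end

end FlatV

/-! ### Products of generators in A♭ -/

namespace FlatA

open FlatV (pair pair_eta)

variable {k : Type u} [Field k] {A N : Type u} [Ring A] [Algebra k A] [AddCommGroup N] [Module k N]

variable (k) in
/-- The generator `[x]` of the degree `0` part of the DG algebra `A♭`. -/
def gen₀ (x : A) : (flatA k A).cx.X 0 := FlatV.gen₀ k x

variable (k) in
/-- The generator `[v, w]` of the degree `1` part of the DG algebra `A♭`. -/
def gen₁ (v w : A) : (flatA k A).cx.X 1 := FlatV.gen₁ k v w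

theorem gen₀_injective : Function.Injective (gen₀ k (A := A)) := FlatV.gen₀_injective

theorem hom_ext₁ {φ ψ : (flatA k A).cx.X 1 →ₗ[k] N}
    (h : ∀ v w, φ (gen₁ k v w) = ψ (gen₁ k v w)) : φ = ψ :=
  FlatV.hom_ext₁ h

theorem mul_gen₀_gen₀ (x y : A) :
    (flatA k A).mul (zero_add 0) (gen₀ k x) (gen₀ k y) = gen₀ k (x * y) :=
  congrArg (Submodule.Quotient.mk (p := flatSub (QBarCx k A) 0))
    (QBar.mul_mk (k := k) (zero_add 0) (fun _ => x) (fun _ => y))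

theorem mul_gen₀_gen₁ (x v w : A) :
    (flatA k A).mul (zero_add 1) (gen₀ k x) (gen₁ k v w) = gen₁ k (x * v) (x * w) := by
  refine congrArg (Submodule.Quotient.mk (p := flatSub (QBarCx k A) 1))
    ((QBar.mul_mk (k := k) (zero_add 1) (fun _ => x) (pair v w)).trans ?_)
  rw [← pair_eta (QBar.Cube.mul _ _ _)]
  rfl

theorem mul_gen₁_gen₀ (x v w : A) :
    (flatA k A).mul (add_zero 1) (gen₁ k v w) (gen₀ k x) = gen₁ k (v * x) (w * x) := by
  refine congrArg (Submodule.Quotient.mk (p := flatSub (QBarCx k A) 1))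
    ((QBar.mul_mk (k := k) (add_zero 1) (pair v w) (fun _ => x)).trans ?_)
  rw [← pair_eta (QBar.Cube.mul _ _ _)]
  rfl

theorem one_eq : (flatA k A).one = gen₀ k (1 : A) := rfl

end FlatA

/-! ### Cocycle extensions and their splitting by averaging -/

/-- The extension of `V` by `N` defined by a symmetric `2`-cocycle. -/
@[ext]
structure CocycleExt {k : Type u} [Field k] {V N : Type u} [AddCommGroup V] [Module k V]
    [AddCommGroup N] [Module k N] {c : V → V → N} (h : IsCocycle k c) where
  /-- the component in `N` -/
  fst : N
  /-- the component in `V` -/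
  snd : V

namespace CocycleExt

variable {k : Type u} [Field k] {V N : Type u} [AddCommGroup V] [Module k V]
  [AddCommGroup N] [Module k N] {c : V → V → N} (h : IsCocycle k c)

instance : Add (CocycleExt h) := ⟨fun x y => ⟨x.fst + y.fst + c x.snd y.snd, x.snd + y.snd⟩⟩

instance : Zero (CocycleExt h) := ⟨⟨0, 0⟩⟩

instance : Neg (CocycleExt h) := ⟨fun x => ⟨-x.fst - c (-x.snd) x.snd, -x.snd⟩⟩

@[simp] theorem add_fst (x y : CocycleExt h) : (x + y).fst = x.fst + y.fst + c x.snd y.snd := rfl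

@[simp] theorem add_snd (x y : CocycleExt h) : (x + y).snd = x.snd + y.snd := rfl

@[simp] theorem zero_fst : (0 : CocycleExt h).fst = 0 := rfl

@[simp] theorem zero_snd : (0 : CocycleExt h).snd = 0 := rfl

instance : AddCommGroup (CocycleExt h) where
  __ := AddGroup.ofLeftAxioms (G := CocycleExt h)
    (fun x y z => by
      ext
      · have := h.assoc x.snd y.snd z.snd
        simp only [add_fst, add_snd]
        rw [← eq_sub_iff_add_eq] at this
        rw [this]
        abel
      · simp [add_assoc])
    (fun x => by ext <;> simp [h.zero_left])
    (fun x => by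
      ext
      · change -x.fst - c (-x.snd) x.snd + x.fst + c (-x.snd) x.snd = 0
        abel
      · exact neg_add_cancel x.snd)
  add_comm x y := by
    ext
    · simp only [add_fst]
      rw [h.symm, add_comm x.fst]
    · exact add_comm x.snd y.snd

/-- The sum collects the cocycle contributions of adding v to i v one step at a time. For n = p the
multiple lies in N and measures the failure of the extension to be annihilated by p. -/
theorem nsmul_mk (n : ℕ) (m : N) (v : V) :
    n • (⟨m, v⟩ : CocycleExt h) = ⟨n • m + ∑ i ∈ Finset.range n, c (i • v) v, n • v⟩ := by
  induction n with
  | zero => ext <;> simp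
  | succ n ih =>
    rw [succ_nsmul, ih]
    ext
    · simp only [add_fst, Finset.sum_range_succ, succ_nsmul]
      abel
    · simp [succ_nsmul]

/-- The projection to `V`. -/
def sndHom : CocycleExt h →+ V where
  toFun := snd
  map_zero' := rfl
  map_add' _ _ := rfl

end CocycleExt

/-- A surjection of abelian groups annihilated by `p` splits. -/
theorem exists_additive_section {p : ℕ} [Fact p.Prime] {E V : Type*} [AddCommGroup E]
    [AddCommGroup V] (f : E →+ V) (hf : Function.Surjective f) (hE : ∀ x : E, p • x = 0)
    (hV : ∀ v : V, p • v = 0) : ∃ s : V →+ E, ∀ v, f (s v) = v := by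
  have : Module (ZMod p) E := AddCommGroup.zmodModule hE
  have : Module (ZMod p) V := AddCommGroup.zmodModule hV
  let F : E →ₗ[ZMod p] V := f.toZModLinearMap p
  obtain ⟨s, hs⟩ := Module.projective_lifting_property F LinearMap.id hf
  exact ⟨s.toAddMonoidHom, fun v => LinearMap.congr_fun hs v⟩

namespace IsCocycle

variable {p : ℕ} {k : Type u} [Field k] [CharP k p] {V N : Type u} [AddCommGroup V]
  [Module k V] [AddCommGroup N] [Module k N] {c : V → V → N}

theorem char_nsmul (p : ℕ) (k : Type u) [Field k] [CharP k p] {V : Type u} [AddCommGroup V]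
    [Module k V] (v : V) : p • v = 0 := by
  rw [← Nat.cast_smul_eq_nsmul k, CharP.cast_eq_zero, zero_smul]

variable (p) in
/-- The multiplication by `p` on the extension defined by a cocycle, as a map `V → N`. -/
def theta (h : IsCocycle k c) : V →ₗ[k] N where
  toFun v := ∑ i ∈ Finset.range p, c (i • v) v
  map_add' v w := by
    -- Additivity comes from multiplication by p being additive in the commutative extension; the
    -- extra term p · c(v, w) vanishes in characteristic p.
    have e := nsmul_add (⟨0, v⟩ : CocycleExt h) ⟨0, w⟩ p
    have e' : (⟨0, v⟩ + ⟨0, w⟩ : CocycleExt h) = ⟨c v w, v + w⟩ := by ext <;> simp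
    rw [e', CocycleExt.nsmul_mk, CocycleExt.nsmul_mk, CocycleExt.nsmul_mk] at e
    have := congrArg CocycleExt.fst e
    simpa [char_nsmul p k, h.zero_left] using this
  map_smul' t v := by
    by_cases ht : t = 0
    · subst ht
      simp [h.zero_left]
    · rw [RingHom.id_apply, Finset.smul_sum]
      refine Finset.sum_congr rfl fun i _ => ?_
      rw [smul_comm i t]
      exact h.smul (Units.mk0 t ht) _ _

theorem theta_apply (h : IsCocycle k c) (v : V) :
    h.theta p v = ∑ i ∈ Finset.range p, c (i • v) v := rfl

/-- A cocycle whose extension is annihilated by `p` is the coboundary of a homogeneous function. -/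
theorem exists_coboundary [Fact p.Prime] [Finite k] (h : IsCocycle k c) (h0 : h.theta p = 0) :
    ∃ g : V → N, g 0 = 0 ∧ (∀ (t : kˣ) v, g ((t : k) • v) = (t : k) • g v) ∧
      ∀ v w, c v w = g v + g w - g (v + w) := by
  -- Vanishing of θ says that p annihilates the extension, so it is a surjection of 𝔽_p-vector
  -- spaces and has an additive section.
  obtain ⟨s, hs'⟩ := exists_additive_section (p := p) (CocycleExt.sndHom h)
    (fun v => ⟨⟨0, v⟩, rfl⟩) (by
      rintro ⟨m, v⟩
      rw [CocycleExt.nsmul_mk, ← theta_apply h, h0]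
      simp only [char_nsmul p k, LinearMap.zero_apply, add_zero]
      rfl) (char_nsmul p k)
  replace hs' : ∀ v, (s v).snd = v := hs'
  have hadd : ∀ v w, (s (v + w)).fst = (s v).fst + (s w).fst + c v w := by
    intro v w
    rw [map_add, CocycleExt.add_fst, hs', hs']
  have := Fintype.ofFinite kˣ
  -- Summing t⁻¹ s(t v) over kˣ makes the section homogeneous. The cochain s has coboundary −c, and
  -- by homogeneity of c the sum multiplies it by |kˣ| = −1, which yields exactly c.
  refine ⟨fun v => ∑ t : kˣ, ((t⁻¹ : kˣ) : k) • (s ((t : k) • v)).fst, ?_, ?_, ?_⟩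
  · simp
  · intro r v
    rw [Finset.smul_sum]
    refine Fintype.sum_equiv (Equiv.mulRight r) _ _ fun t => ?_
    simp only [Equiv.coe_mulRight, smul_smul, mul_inv_rev, Units.val_mul]
    rw [← mul_assoc, Units.mul_inv, one_mul]
  · intro v w
    rw [← Finset.sum_add_distrib, ← Finset.sum_sub_distrib]
    have : ∀ t : kˣ, ((t⁻¹ : kˣ) : k) • (s ((t : k) • v)).fst +
        ((t⁻¹ : kˣ) : k) • (s ((t : k) • w)).fst - ((t⁻¹ : kˣ) : k) • (s ((t : k) • (v + w))).fst =
        -((1 : k) • c v w) := by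
      intro t
      rw [smul_add, hadd, h.smul, smul_add, smul_add, smul_smul, Units.inv_mul]
      abel
    rw [Finset.sum_congr rfl fun t _ => this t, Finset.sum_neg_distrib, ← Finset.sum_smul,
      sum_units_one, neg_smul, one_smul, neg_neg]

end IsCocycle

/-! ### The first homology of V♭ -/

namespace FlatV

variable {p : ℕ} [Fact p.Prime] {k : Type u} [Field k] [CharP k p] [Finite k] {V : Type u}
  [AddCommGroup V] [Module k V]

/-- The first homology of `V♭` consists of the elements `∑ [i v, v]`. -/
theorem exists_eq_theta {x : (flatV k V).X 1} (hx : ((flatV k V).d 1 0).hom x = 0) :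
    ∃ v, x = (isCocycle_gen₁ k V).theta p v := by
  let R := LinearMap.range ((isCocycle_gen₁ k V).theta p)
  have hc := (isCocycle_gen₁ k V).comp R.mkQ
  -- Modulo the elements θ(v) the universal cocycle has θ = 0, hence is the coboundary of a
  -- homogeneous function g. Extended to V♭₀, g factors the quotient map V♭₁ → V♭₁ / R through d, so
  -- every cycle lies in R.
  obtain ⟨g, g0, gs, hg⟩ := hc.exists_coboundary (p := p) (by
    ext v
    rw [IsCocycle.theta_apply, ← map_sum, ← IsCocycle.theta_apply (p := p) (isCocycle_gen₁ k V)]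
    exact (Submodule.Quotient.mk_eq_zero _).2 ⟨v, rfl⟩)
  have e : lift₀ g g0 gs ∘ₗ ((flatV k V).d 1 0).hom = R.mkQ := by
    refine hom_ext₁ fun v w => ?_
    rw [LinearMap.comp_apply, d_gen₁, map_sub, map_add, lift₀_gen, lift₀_gen, lift₀_gen, ← hg]
  have hx' : R.mkQ x = 0 := by rw [← e, LinearMap.comp_apply, hx, map_zero]
  obtain ⟨v, hv⟩ := (Submodule.Quotient.mk_eq_zero R).1 hx'
  exact ⟨v, hv.symm⟩

end FlatV

/-- Given a b = d, the inclusion Ker a ⊆ Im b is all that is missing: it gives surjectivity of Ker d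
→ Ker a, and injectivity of Coker b → Coker d, since z and b x with a z = d x differ by an element
of Ker a. -/
theorem IsSplitting.of_ker_le_range {k : Type u} [Field k] {K₁ K₀ K₀₁ : Type u} [AddCommGroup K₁]
    [Module k K₁] [AddCommGroup K₀] [Module k K₀] [AddCommGroup K₀₁] [Module k K₀₁]
    {d : K₁ →ₗ[k] K₀} {a : K₀₁ →ₗ[k] K₀} {b : K₁ →ₗ[k] K₀₁} (ha : Function.Surjective a)
    (hb : Function.Injective b) (hab : a ∘ₗ b = d) (hker : LinearMap.ker a ≤ LinearMap.range b) :
    IsSplitting d a b where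
  surjective := ha
  injective := hb
  comp := hab
  ker := by
    refine ⟨fun x hx => ?_, hb.injOn, fun z hz => ?_⟩
    · rw [← hab] at hx
      exact hx
    · obtain ⟨x, rfl⟩ := hker hz
      refine ⟨x, ?_, rfl⟩
      rw [← hab]
      exact hz
  coker := by
    constructor
    · rw [injective_iff_map_eq_zero]
      intro z hz
      obtain ⟨z, rfl⟩ := Submodule.Quotient.mk_surjective _ z
      rw [Submodule.mapQ_apply, Submodule.Quotient.mk_eq_zero] at hz
      obtain ⟨x, hx⟩ := hz
      rw [Submodule.Quotient.mk_eq_zero]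
      have h : z - b x ∈ LinearMap.ker a := by
        rw [LinearMap.mem_ker, map_sub, ← hx, ← hab, LinearMap.comp_apply, sub_self]
      simpa using add_mem (hker h) (LinearMap.mem_range_self b x)
    · intro y
      obtain ⟨y, rfl⟩ := Submodule.Quotient.mk_surjective _ y
      obtain ⟨z, rfl⟩ := ha y
      exact ⟨Submodule.Quotient.mk z, rfl⟩

/-! ### The space of symbols of a lifting as a splitting of V♭ -/

namespace Lift

open FlatV

variable {p : ℕ} [Fact p.Prime] {k : Type u} [Field k] {V N : Type u}
  [AddCommGroup V] [Module k V] [AddCommGroup N] [Module k N] (L : Lift p k V)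

/-- The relations between the symbols of the elements of a lifting. -/
def symbRel : Submodule k (L.carrier →₀ k) :=
  Submodule.span k
    ({r | ∃ (c : kˣ) (x : L.carrier), r = Finsupp.single (teich p (c : k) • x) 1 -
        (c : k) • Finsupp.single x 1} ∪
      {r | ∃ x y : L.carrier, r = Finsupp.single (x + (p : W₂ p k) • y) 1 -
        Finsupp.single x 1 - Finsupp.single ((p : W₂ p k) • y) 1})

/-- The `k`-vector space spanned by symbols `[x]`, `x ∈ V'`, modulo the relations
`[τ(c) x] = c [x]` for `c ∈ kˣ` and `[x + p y] = [x] + [p y]`. -/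
def Symb : Type u := (L.carrier →₀ k) ⧸ L.symbRel

instance : AddCommGroup L.Symb := inferInstanceAs (AddCommGroup ((L.carrier →₀ k) ⧸ L.symbRel))

instance : Module k L.Symb := inferInstanceAs (Module k ((L.carrier →₀ k) ⧸ L.symbRel))

/-- The symbol of an element of `V'`. -/
def symb (x : L.carrier) : L.Symb := L.symbRel.mkQ (Finsupp.single x 1)

variable {L} in
theorem Symb.hom_ext {φ ψ : L.Symb →ₗ[k] N} (h : ∀ x, φ (L.symb x) = ψ (L.symb x)) : φ = ψ :=
  Submodule.linearMap_qext L.symbRel (Finsupp.lhom_ext' fun x => LinearMap.ext_ring (h x))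

/-- The universal property of the space of symbols. -/
def symbLift (φ : L.carrier → N) (hs : ∀ (c : kˣ) x, φ (teich p (c : k) • x) = (c : k) • φ x)
    (hp : ∀ x y, φ (x + (p : W₂ p k) • y) = φ x + φ ((p : W₂ p k) • y)) : L.Symb →ₗ[k] N :=
  L.symbRel.liftQ (Finsupp.linearCombination k φ) <| by
    rw [symbRel, Submodule.span_le]
    rintro r (⟨c, x, rfl⟩ | ⟨x, y, rfl⟩)
    · simp [hs]
    · simp [hp]

@[simp]
theorem symbLift_symb (φ : L.carrier → N)
    (hs : ∀ (c : kˣ) x, φ (teich p (c : k) • x) = (c : k) • φ x)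
    (hp : ∀ x y, φ (x + (p : W₂ p k) • y) = φ x + φ ((p : W₂ p k) • y)) (x : L.carrier) :
    L.symbLift φ hs hp (L.symb x) = φ x := by
  change Finsupp.linearCombination k φ (Finsupp.single x 1) = φ x
  simp

theorem symb_add (x y : L.carrier) :
    L.symb (x + (p : W₂ p k) • y) = L.symb x + L.symb ((p : W₂ p k) • y) := by
  rw [← sub_eq_iff_eq_add', ← sub_eq_zero]
  exact (Submodule.Quotient.mk_eq_zero L.symbRel).2
    (Submodule.subset_span (Or.inr ⟨x, y, rfl⟩))

@[simp]
theorem symb_zero : L.symb 0 = 0 := by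
  simpa using L.symb_add 0 0

theorem symb_smul (c : k) (x : L.carrier) : L.symb (teich p c • x) = c • L.symb x := by
  by_cases hc : c = 0
  · subst hc; simp
  · rw [← sub_eq_zero]
    exact (Submodule.Quotient.mk_eq_zero L.symbRel).2
      (Submodule.subset_span (Or.inl ⟨Units.mk0 c hc, x, rfl⟩))

@[elab_as_elim]
theorem symb_induction {P : L.Symb → Prop} (z : L.Symb) (hsymb : ∀ x, P (L.symb x))
    (hadd : ∀ y z, P y → P z → P (y + z)) (hsmul : ∀ (c : k) z, P z → P (c • z)) : P z := by
  obtain ⟨z, rfl⟩ := L.symbRel.mkQ_surjective z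
  induction z using Finsupp.induction_linear with
  | zero =>
    have h := hsymb 0
    rw [symb_zero] at h
    exact h
  | add f g hf hg => rw [map_add]; exact hadd _ _ hf hg
  | single x c =>
    rw [← Finsupp.smul_single_one, map_smul]
    exact hsmul c _ (hsymb x)

/-- The map `[x] ↦ [x mod p]`. -/
def symbA : L.Symb →ₗ[k] (flatV k V).X 0 :=
  L.symbLift (fun x => gen₀ k (L.proj x)) (fun c x => by rw [proj_teich_smul, gen₀_smul])
    (fun x y => by rw [map_add, proj_natCast_smul, add_zero, gen₀_zero, add_zero])

@[simp]
theorem symbA_symb (x : L.carrier) : L.symbA (L.symb x) = gen₀ k (L.proj x) :=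
  L.symbLift_symb ..

theorem symbA_surjective : Function.Surjective L.symbA := by
  rw [← LinearMap.range_eq_top, ← top_le_iff]
  have : (LinearMap.range L.symbA).mkQ = 0 := hom_ext₀ fun v => by
    obtain ⟨x, rfl⟩ := L.surjective v
    rw [← symbA_symb]
    exact (Submodule.Quotient.mk_eq_zero _).2 (LinearMap.mem_range_self _ _)
  rw [← Submodule.ker_mkQ (LinearMap.range L.symbA), this, LinearMap.ker_zero]

/-- A set-theoretic section of the reduction. -/
def sec (v : V) : L.carrier := Function.surjInv L.surjective v

@[simp]
theorem proj_sec (v : V) : L.proj (L.sec v) = v := Function.surjInv_eq L.surjective v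

/-- The cocycle that measures the failure of `x ↦ [x]` to be additive. -/
def symbCocycle (v w : V) : L.Symb :=
  L.symb (L.sec v) + L.symb (L.sec w) - L.symb (L.sec v + L.sec w)

/-- Replacing x by x + p z adds [p z] both to [x] and to [x + y], and these contributions cancel;
the same holds for y. Hence the chosen section `sec` plays no role. -/
theorem symbCocycle_proj (x y : L.carrier) :
    L.symbCocycle (L.proj x) (L.proj y) = L.symb x + L.symb y - L.symb (x + y) := by
  obtain ⟨z, hz⟩ := L.exists_eq_add (L.proj_sec (L.proj x))
  obtain ⟨t, ht⟩ := L.exists_eq_add (L.proj_sec (L.proj y))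
  have e : x + (p : W₂ p k) • z + (y + (p : W₂ p k) • t) =
      x + y + (p : W₂ p k) • z + (p : W₂ p k) • t := by abel
  rw [symbCocycle, hz, ht, e, symb_add, symb_add, symb_add, symb_add]
  abel

/-- Pulled back to V' this is the coboundary of x ↦ [x], so the cocycle identities hold there
formally and descend along the surjection V' → V. -/
theorem isCocycle_symbCocycle : IsCocycle k L.symbCocycle where
  zero_left v := by
    obtain ⟨x, rfl⟩ := L.surjective v
    rw [← map_zero L.proj, symbCocycle_proj]
    simp
  symm v w := by
    obtain ⟨x, rfl⟩ := L.surjective v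
    obtain ⟨y, rfl⟩ := L.surjective w
    rw [symbCocycle_proj, symbCocycle_proj, add_comm y x, add_comm (L.symb x)]
  assoc v w t := by
    obtain ⟨x, rfl⟩ := L.surjective v
    obtain ⟨y, rfl⟩ := L.surjective w
    obtain ⟨z, rfl⟩ := L.surjective t
    rw [← map_add, ← map_add, symbCocycle_proj, symbCocycle_proj, symbCocycle_proj,
      symbCocycle_proj, add_assoc x y z]
    abel
  smul c v w := by
    obtain ⟨x, rfl⟩ := L.surjective v
    obtain ⟨y, rfl⟩ := L.surjective w
    rw [← proj_teich_smul, ← proj_teich_smul, symbCocycle_proj, symbCocycle_proj, ← smul_add,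
      symb_smul, symb_smul, symb_smul, smul_sub, smul_add]

/-- The map `[v, w] ↦ [x] + [y] - [x + y]`, where `x` and `y` are liftings of `v` and `w`. -/
def symbB : (flatV k V).X 1 →ₗ[k] L.Symb := lift₁ L.symbCocycle L.isCocycle_symbCocycle

theorem symbB_gen (x y : L.carrier) :
    L.symbB (gen₁ k (L.proj x) (L.proj y)) = L.symb x + L.symb y - L.symb (x + y) := by
  rw [symbB, lift₁_gen, symbCocycle_proj]

theorem symbA_comp_symbB : L.symbA ∘ₗ L.symbB = ((flatV k V).d 1 0).hom := by
  refine hom_ext₁ fun v w => ?_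
  obtain ⟨x, rfl⟩ := L.surjective v
  obtain ⟨y, rfl⟩ := L.surjective w
  rw [LinearMap.comp_apply, symbB_gen, d_gen₁]
  simp

/-- The subspace of the symbols `[p y]`. -/
def symbP : Submodule k L.Symb where
  carrier := {z | ∃ y, z = L.symb ((p : W₂ p k) • y)}
  zero_mem' := ⟨0, by simp⟩
  add_mem' := by
    rintro _ _ ⟨x, rfl⟩ ⟨y, rfl⟩
    exact ⟨x + y, by rw [smul_add, symb_add]⟩
  smul_mem' := by
    rintro c _ ⟨x, rfl⟩
    exact ⟨teich p c • x, by rw [← symb_smul, smul_comm]⟩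

theorem symb_sub_mem {x y : L.carrier} (h : L.proj x = L.proj y) :
    L.symb x - L.symb y ∈ L.symbP := by
  obtain ⟨z, rfl⟩ := L.exists_eq_add h
  exact ⟨z, by rw [symb_add]; abel⟩

/-- Modulo the symbols [p y], the symbol of a lift of v depends only on v and is homogeneous in it.
This defines a map from V♭₀ whose composition with a is the quotient map. -/
theorem mem_symbP_of_symbA {z : L.Symb} (hz : L.symbA z = 0) : z ∈ L.symbP := by
  let g : (flatV k V).X 0 →ₗ[k] L.Symb ⧸ L.symbP :=
    lift₀ (fun v => L.symbP.mkQ (L.symb (L.sec v)))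
      (by
        refine (Submodule.Quotient.mk_eq_zero _).2 ?_
        simpa using L.symb_sub_mem (x := L.sec 0) (y := 0) (by simp))
      (fun c v => by
        rw [← map_smul, ← symb_smul]
        exact (Submodule.Quotient.eq _).2 (L.symb_sub_mem (by simp)))
  have hg : g ∘ₗ L.symbA = L.symbP.mkQ := by
    refine Symb.hom_ext fun x => ?_
    rw [LinearMap.comp_apply, symbA_symb]
    refine (lift₀_gen _ _ _ _).trans ?_
    exact (Submodule.Quotient.eq _).2 (L.symb_sub_mem (by simp))
  rw [← Submodule.Quotient.mk_eq_zero, ← Submodule.mkQ_apply, ← hg, LinearMap.comp_apply, hz,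
    map_zero]

/-- Correcting [x] by an element [p y] of the kernel gives the symbol [x + p y]. Thus the symbols
are exactly the elements over the generators of V♭₀, and the set V' can be found inside the
splitting. -/
theorem exists_symb_eq {z : L.Symb} {v : V} (hz : L.symbA z = gen₀ k v) :
    ∃ x, L.symb x = z := by
  obtain ⟨x, rfl⟩ := L.surjective v
  obtain ⟨y, hy⟩ := L.mem_symbP_of_symbA (z := z - L.symb x) (by simp [hz])
  exact ⟨x + (p : W₂ p k) • y, by rw [symb_add, ← hy]; abel⟩

section

variable [CharP k p]

/-- The quotient (x − σ(x mod p)) / p, with σ the chosen section, is well defined modulo p by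
flatness. -/
theorem exists_divided_difference (x : L.carrier) :
    ∃ v, ∀ y, x = L.sec (L.proj x) + (p : W₂ p k) • y → v = L.proj y := by
  obtain ⟨y, hy⟩ := L.exists_eq_add (L.proj_sec (L.proj x)).symm
  refine ⟨L.proj y, fun z hz => ?_⟩
  rw [← sub_eq_zero, ← map_sub, ← natCast_smul_eq_zero_iff, smul_sub, sub_eq_zero]
  exact add_left_cancel (hy.symm.trans hz)

/-- The divided difference r satisfies r(x + p z) = r(x) + (z mod p), but it need not commute with
kˣ because the section is arbitrary. Averaging over kˣ repairs this. The result shows that passing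
to the quotient by the relations on symbols does not collapse the classes [p y]. -/
theorem exists_symb_retraction [Finite k] :
    ∃ ρ : L.Symb →ₗ[k] V, ∀ y, ρ (L.symb ((p : W₂ p k) • y)) = L.proj y := by
  choose r hr using L.exists_divided_difference
  have hr' : ∀ x z, r (x + (p : W₂ p k) • z) = r x + L.proj z := by
    intro x z
    obtain ⟨y, hy⟩ := L.exists_eq_add (L.proj_sec (L.proj x)).symm
    rw [hr x y hy, ← map_add]
    apply hr
    rw [map_add, proj_natCast_smul, add_zero, smul_add, ← add_assoc, ← hy]
  have := Fintype.ofFinite kˣ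
  -- The sign compensates |kˣ| = −1. Subtracting r(0) gives φ(0) = 0, and with it φ(p z) = z mod p,
  -- which the relation [x + p y] = [x] + [p y] requires.
  let φ : L.carrier → V := fun x =>
    -∑ t : kˣ, ((t⁻¹ : kˣ) : k) • (r (teich p (t : k) • x) - r 0)
  have h0 : φ 0 = 0 := by simp [φ]
  have hadd : ∀ x z, φ (x + (p : W₂ p k) • z) = φ x + L.proj z := by
    intro x z
    have : ∀ t : kˣ, ((t⁻¹ : kˣ) : k) • (r (teich p (t : k) • (x + (p : W₂ p k) • z)) - r 0) =
        ((t⁻¹ : kˣ) : k) • (r (teich p (t : k) • x) - r 0) + (1 : k) • L.proj z := by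
      intro t
      rw [smul_add, smul_comm _ (p : W₂ p k), hr', proj_teich_smul, add_sub_right_comm, smul_add,
        smul_smul, Units.inv_mul]
    simp only [φ]
    rw [Finset.sum_congr rfl fun t _ => this t, Finset.sum_add_distrib, ← Finset.sum_smul,
      sum_units_one, neg_smul, one_smul, neg_add, neg_neg]
  have hp : ∀ z, φ ((p : W₂ p k) • z) = L.proj z := fun z => by
    rw [← zero_add ((p : W₂ p k) • z), hadd, h0, zero_add]
  refine ⟨L.symbLift φ ?_ ?_, fun y => ?_⟩
  · intro c x
    simp only [φ]
    rw [smul_neg, Finset.smul_sum]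
    refine congrArg Neg.neg (Fintype.sum_equiv (Equiv.mulRight c) _ _ fun t => ?_)
    simp only [Equiv.coe_mulRight, smul_smul, mul_inv_rev, Units.val_mul, map_mul]
    rw [← mul_assoc, Units.mul_inv, one_mul]
  · intro x y
    rw [hadd, hp]
  · rw [symbLift_symb, hp]

/-- The terms [i x] + [x] − [(i + 1) x] telescope to p [x] − [p x], and p [x] = 0 in characteristic
p. -/
theorem symbB_theta (x : L.carrier) :
    L.symbB ((isCocycle_gen₁ k V).theta p (L.proj x)) = -L.symb ((p : W₂ p k) • x) := by
  have h : ∀ n : ℕ, L.symbB (∑ i ∈ Finset.range n, gen₁ k (i • L.proj x) (L.proj x)) =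
      n • L.symb x - L.symb (n • x) := by
    intro n
    induction n with
    | zero => simp
    | succ n ih =>
      rw [Finset.sum_range_succ, map_add, ih, ← map_nsmul, symbB_gen, succ_nsmul, succ_nsmul]
      abel
  rw [IsCocycle.theta_apply, h, IsCocycle.char_nsmul p k, zero_sub, Nat.cast_smul_eq_nsmul]

variable [Finite k]

theorem symb_natCast_smul_eq_zero_iff (y : L.carrier) :
    L.symb ((p : W₂ p k) • y) = 0 ↔ L.proj y = 0 := by
  constructor
  · intro h
    obtain ⟨ρ, hρ⟩ := L.exists_symb_retraction
    rw [← hρ, h, map_zero]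
  · intro h
    rw [(L.natCast_smul_eq_zero_iff y).2 h, symb_zero]

/-- The symbol determines x mod p through a. Two lifts of the same vector differ by some p z, which
is detected by [p z]. -/
theorem symb_injective : Function.Injective L.symb := by
  intro x y h
  have h' : L.proj x = L.proj y := gen₀_injective (k := k) (by
    rw [← symbA_symb, h, symbA_symb])
  obtain ⟨z, rfl⟩ := L.exists_eq_add h'
  rw [symb_add, add_eq_left, symb_natCast_smul_eq_zero_iff] at h
  rw [(L.natCast_smul_eq_zero_iff z).2 h, add_zero]

/-- Since a b = d, an element killed by b is a cycle, hence of the form θ(v). Its image −[p x], for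
x over v, vanishes only if v = 0. -/
theorem symbB_injective : Function.Injective L.symbB := by
  rw [injective_iff_map_eq_zero]
  intro m hm
  obtain ⟨v, rfl⟩ := exists_eq_theta (p := p) (x := m) (by
    rw [← L.symbA_comp_symbB, LinearMap.comp_apply, hm, map_zero])
  obtain ⟨x, rfl⟩ := L.surjective v
  rw [symbB_theta, neg_eq_zero, symb_natCast_smul_eq_zero_iff] at hm
  rw [hm, map_zero]

/-- Every element of Ker a is some [p x], which equals b(−θ(x mod p)). -/
theorem isSplitting : IsSplitting ((flatV k V).d 1 0).hom L.symbA L.symbB :=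
  IsSplitting.of_ker_le_range L.symbA_surjective L.symbB_injective L.symbA_comp_symbB
    (fun z hz => by
      obtain ⟨x, rfl⟩ := L.mem_symbP_of_symbA hz
      exact ⟨-(isCocycle_gen₁ k V).theta p (L.proj x), by rw [map_neg, symbB_theta, neg_neg]⟩)

/-- The splitting of `V♭` defined by a lifting of `V`. -/
def toSpl : Spl (flatV k V) where
  carrier := L.Symb
  a := L.symbA
  b := L.symbB
  isSplitting := L.isSplitting

end

end Lift

/-! ### Uniqueness of splittings up to isomorphism -/

namespace Spl

variable {k : Type u} [Field k] {C : ChainComplex (ModuleCat.{u} k) ℕ}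

/-- The decomposition of a splitting defined by a section of `C₀ → Coker d`. -/
theorem exists_equiv (S : Spl C) (s : (C.X 0 ⧸ LinearMap.range (C.d 1 0).hom) →ₗ[k] C.X 0)
    (hs : ∀ c, (LinearMap.range (C.d 1 0).hom).mkQ (s c) = c) :
    ∃ e : (C.X 1 × (C.X 0 ⧸ LinearMap.range (C.d 1 0).hom)) ≃ₗ[k] S.carrier,
      (∀ m, e (m, 0) = S.b m) ∧ ∀ m c, S.a (e (m, c)) = (C.d 1 0).hom m + s c := by
  have hab : ∀ m, S.a (S.b m) = (C.d 1 0).hom m := LinearMap.congr_fun S.isSplitting.comp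
  obtain ⟨r, hr⟩ := S.a.exists_rightInverse_of_surjective
    (LinearMap.range_eq_top.2 S.isSplitting.surjective)
  have hr' : ∀ x, S.a (r x) = x := LinearMap.congr_fun hr
  -- Here r is a linear section of a; the copy of Coker d in the splitting is embedded by r ∘ s.
  let f := S.b.coprod (r ∘ₗ s)
  have hf : ∀ m c, f (m, c) = S.b m + r (s c) := fun m c => by simp [f]
  have hbij : Function.Bijective f := by
    constructor
    · rw [injective_iff_map_eq_zero]
      rintro ⟨m, c⟩ h
      rw [hf] at h
      have h' : (C.d 1 0).hom m + s c = 0 := by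
        rw [← hab, ← hr' (s c), ← map_add, h, map_zero]
      have hc : c = 0 := by
        rw [← hs c, Submodule.mkQ_apply, Submodule.Quotient.mk_eq_zero,
          eq_neg_of_add_eq_zero_right h']
        exact neg_mem (LinearMap.mem_range_self _ m)
      subst hc
      rw [map_zero, map_zero, add_zero] at h
      rw [Prod.mk_eq_zero]
      exact ⟨S.isSplitting.injective (h.trans (map_zero _).symm), rfl⟩
    · intro z
      let c := (LinearMap.range (C.d 1 0).hom).mkQ (S.a z)
      -- This element becomes zero in Coker d, and Coker b → Coker d is injective.
      have h : z - r (s c) ∈ LinearMap.range S.b := by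
        rw [← Submodule.Quotient.mk_eq_zero]
        refine S.isSplitting.coker.1 ?_
        rw [Submodule.mapQ_apply, map_zero, map_sub, hr', Submodule.Quotient.mk_sub]
        exact sub_eq_zero.2 (hs c).symm
      obtain ⟨m, hm⟩ := h
      exact ⟨(m, c), by rw [hf, hm]; abel⟩
  refine ⟨LinearEquiv.ofBijective f hbij, fun m => ?_, fun m c => ?_⟩
  · rw [LinearEquiv.ofBijective_apply, hf, map_zero, map_zero, add_zero]
  · rw [LinearEquiv.ofBijective_apply, hf, map_add, hab, hr']

/-- Any two splittings of a two-term complex of vector spaces are isomorphic. -/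
theorem nonempty_hom (S T : Spl C) : Nonempty (S ⟶ T) := by
  obtain ⟨s, hs⟩ := (LinearMap.range (C.d 1 0).hom).mkQ.exists_rightInverse_of_surjective
    (Submodule.range_mkQ _)
  have hs' := LinearMap.congr_fun hs
  obtain ⟨e, he, he'⟩ := S.exists_equiv s hs'
  obtain ⟨f, hf, hf'⟩ := T.exists_equiv s hs'
  -- In the coordinates C₁ × Coker d the formulas for a and b involve only d and the common section
  -- s, so they agree for both splittings.
  refine ⟨Spl.Hom.mk (e.symm.trans f) (fun x => ?_) (fun y => ?_)⟩
  · obtain ⟨⟨m, c⟩, rfl⟩ := e.surjective x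
    rw [LinearEquiv.trans_apply, LinearEquiv.symm_apply_apply, he', hf']
  · rw [LinearEquiv.trans_apply, ← he, LinearEquiv.symm_apply_apply, hf]

end Spl

/-! ### Functoriality in V and the equivalence of liftings with splittings -/

namespace Lift

open FlatV

variable {p : ℕ} [Fact p.Prime] {k : Type u} [Field k] {U V W : Type u}
  [AddCommGroup U] [Module k U] [AddCommGroup V] [Module k V] [AddCommGroup W] [Module k W]

section

variable {L : Lift p k V} {M : Lift p k W}

/-- Functoriality of the space of symbols. -/
def symbMap {f : V →ₗ[k] W} (φ : HomOver f L M) : L.Symb →ₗ[k] M.Symb :=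
  L.symbLift (fun x => M.symb (φ.φ x)) (fun c x => by rw [map_smul, symb_smul])
    (fun x y => by rw [map_add, map_smul, symb_add])

@[simp]
theorem symbMap_symb {f : V →ₗ[k] W} (φ : HomOver f L M) (x : L.carrier) :
    symbMap φ (L.symb x) = M.symb (φ.φ x) :=
  L.symbLift_symb ..

theorem symbA_symbMap {f : V →ₗ[k] W} (φ : HomOver f L M) (z : L.Symb) :
    M.symbA (symbMap φ z) = ((flatVMap f).f 0).hom (L.symbA z) := by
  have : M.symbA ∘ₗ symbMap φ = ((flatVMap f).f 0).hom ∘ₗ L.symbA :=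
    Symb.hom_ext fun x => by
      simp only [LinearMap.comp_apply, symbMap_symb, symbA_symb, φ.comm]
      exact (map_gen₀ f _).symm
  exact LinearMap.congr_fun this z

theorem symbMap_symbB {f : V →ₗ[k] W} (φ : HomOver f L M) (m : (flatV k V).X 1) :
    symbMap φ (L.symbB m) = M.symbB (((flatVMap f).f 1).hom m) := by
  have : symbMap φ ∘ₗ L.symbB = M.symbB ∘ₗ ((flatVMap f).f 1).hom := by
    refine hom_ext₁ fun v w => ?_
    obtain ⟨x, rfl⟩ := L.surjective v
    obtain ⟨y, rfl⟩ := L.surjective w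
    rw [LinearMap.comp_apply, LinearMap.comp_apply, symbB_gen, map_gen₁, ← φ.comm, ← φ.comm,
      symbB_gen]
    simp
  exact LinearMap.congr_fun this m

theorem symbMap_comp {K : Lift p k U} {f : U →ₗ[k] V} {g : V →ₗ[k] W} (ψ : HomOver g L M)
    (φ : HomOver f K L) : symbMap (ψ.comp φ) = symbMap ψ ∘ₗ symbMap φ :=
  Symb.hom_ext fun x => by simp [HomOver.comp]

end

variable {L M : Lift p k V}

/-- The isomorphism of the spaces of symbols defined by an isomorphism of liftings. -/
def symbEquiv (g : L ⟶ M) : L.Symb ≃ₗ[k] M.Symb :=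
  LinearEquiv.ofLinearMap (symbMap (Hom.toHomOver g)) (symbMap (Hom.toHomOver (Groupoid.inv g)))
    (Symb.hom_ext fun x => by
      simp only [LinearMap.comp_apply, symbMap_symb, LinearMap.id_apply]
      exact congrArg M.symb (g.e.apply_symm_apply x))
    (Symb.hom_ext fun x => by
      simp only [LinearMap.comp_apply, symbMap_symb, LinearMap.id_apply]
      exact congrArg L.symb (g.e.symm_apply_apply x))

@[simp]
theorem symbEquiv_symb (g : L ⟶ M) (x : L.carrier) : symbEquiv g (L.symb x) = M.symb (g.e x) :=
  symbMap_symb ..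

theorem flatVMap_id_apply (n : ℕ) (x : (flatV k V).X n) :
    ((flatVMap (LinearMap.id : V →ₗ[k] V)).f n).hom x = x := by
  obtain ⟨x, rfl⟩ := Submodule.Quotient.mk_surjective (flatSub (QBarCx k V) n) x
  exact congrArg (Submodule.Quotient.mk (p := flatSub (QBarCx k V) n))
    (LinearMap.congr_fun (QBar.map_id k V n) x)

theorem symbA_symbEquiv (g : L ⟶ M) (z : L.Symb) : M.symbA (symbEquiv g z) = L.symbA z :=
  (symbA_symbMap (Hom.toHomOver g) z).trans (flatVMap_id_apply 0 _)

theorem symbEquiv_symbB (g : L ⟶ M) (m : (flatV k V).X 1) :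
    symbEquiv g (L.symbB m) = M.symbB m :=
  (symbMap_symbB (Hom.toHomOver g) m).trans (congrArg M.symbB (flatVMap_id_apply 1 m))

variable [CharP k p] [Finite k]

/-- An isomorphism of the spaces of symbols that is compatible with `a` and `b` comes from an
isomorphism of liftings. -/
theorem exists_linearEquiv (e : L.Symb ≃ₗ[k] M.Symb) (ha : ∀ z, M.symbA (e z) = L.symbA z)
    (hb : ∀ m, e (L.symbB m) = M.symbB m) :
    ∃ g : L.carrier ≃ₗ[W₂ p k] M.carrier,
      (∀ x, M.proj (g x) = L.proj x) ∧ ∀ x, M.symb (g x) = e (L.symb x) := by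
  have h : ∀ x, ∃ y, M.symb y = e (L.symb x) := fun x =>
    M.exists_symb_eq (v := L.proj x) (by rw [ha, symbA_symb])
  -- Compatibility with a makes e preserve the elements over the generators [v], that is, the set of
  -- symbols; g is the induced map on these sets.
  choose g hg using h
  have hproj : ∀ x, M.proj (g x) = L.proj x := fun x => gen₀_injective (k := k) (by
    rw [← symbA_symb, hg, ha, symbA_symb])
  have hadd : ∀ x y, g (x + y) = g x + g y := by
    intro x y
    apply M.symb_injective
    -- Addition is encoded in b: [x + y] = [x] + [y] − b([v, w]), and e carries one b to the other.
    have h₁ := L.symbB_gen x y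
    have h₂ := M.symbB_gen (g x) (g y)
    rw [hproj, hproj, ← hb, h₁, map_sub, map_add, hg, hg, ← hg (x + y)] at h₂
    exact sub_right_injective h₂
  have hsmul : ∀ (c : kˣ) x, g (teich p (c : k) • x) = teich p (c : k) • g x := by
    intro c x
    apply M.symb_injective
    rw [hg, symb_smul, symb_smul, hg, map_smul]
  let g' : L.carrier →ₗ[W₂ p k] M.carrier :=
    { toFun := g
      map_add' := hadd
      map_smul' := map_smul_of_teich (AddMonoidHom.mk' g hadd) hsmul }
  refine ⟨LinearEquiv.ofBijective g' ⟨fun x y hxy => ?_, fun y => ?_⟩, hproj, hg⟩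
  · apply L.symb_injective
    apply e.injective
    rw [← hg, ← hg]
    exact congrArg M.symb hxy
  · obtain ⟨x, hx⟩ := L.exists_symb_eq (z := e.symm (M.symb y)) (v := M.proj y) (by
      rw [← ha, e.apply_symm_apply, symbA_symb])
    refine ⟨x, M.symb_injective ((hg x).trans ?_)⟩
    rw [hx, e.apply_symm_apply]

/-- The map of splittings defined by a map of liftings. -/
def HomOver.toSpl {f : V →ₗ[k] W} {L : Lift p k V} {M : Lift p k W} (φ : HomOver f L M) :
    Spl.HomOver (flatVMap f) L.toSpl M.toSpl :=
  Spl.HomOver.mk (symbMap φ) (symbA_symbMap φ) (symbMap_symbB φ)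

variable (p k V) in
/-- The functor from liftings to splittings. -/
def splFunctor : Lift p k V ⥤ Spl (flatV k V) where
  obj L := L.toSpl
  map g := Spl.Hom.mk (symbEquiv g) (symbA_symbEquiv g) (symbEquiv_symbB g)
  map_id L := Spl.Hom.ext (LinearEquiv.toLinearMap_injective (Symb.hom_ext fun x =>
    symbEquiv_symb (𝟙 L) x))
  map_comp g h := Spl.Hom.ext (LinearEquiv.toLinearMap_injective
    (Symb.hom_ext fun x => (symbEquiv_symb (g ≫ h) x).trans
      ((congrArg (symbEquiv h) (symbEquiv_symb g x)).trans (symbEquiv_symb h _)).symm))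

instance : (splFunctor p k V).Faithful where
  map_injective {L M g h} e := by
    refine Hom.ext (LinearEquiv.ext fun x => M.symb_injective ?_)
    rw [← symbEquiv_symb, ← symbEquiv_symb]
    exact LinearEquiv.congr_fun (congrArg Spl.Hom.e e) (L.symb x)

instance : (splFunctor p k V).Full where
  map_surjective {L M} e := by
    obtain ⟨g, hg, hg'⟩ := exists_linearEquiv (L := L) (M := M) e.e e.comm_a e.comm_b
    exact ⟨Hom.mk g hg, Spl.Hom.ext (LinearEquiv.toLinearMap_injective (Symb.hom_ext fun x =>
      (symbEquiv_symb (Hom.mk g hg) x).trans (hg' x)))⟩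

/-- No lifting is reconstructed from the given splitting: one lifting of V exists, and its splitting
is isomorphic to any other. -/
instance : (splFunctor p k V).EssSurj where
  mem_essImage S := by
    obtain ⟨L⟩ := nonempty_lift (p := p) (k := k) V
    obtain ⟨e⟩ := Spl.nonempty_hom L.toSpl S
    exact ⟨L, ⟨(Groupoid.isoEquivHom _ _).symm e⟩⟩

instance : (splFunctor p k V).IsEquivalence where

end Lift

/-! ### The algebra of symbols of an algebra lifting -/

namespace AlgLift

open FlatA Lift

variable {p : ℕ} [Fact p.Prime] {k : Type u} [Field k] {A : Type u} [Ring A] [Algebra k A]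

/-- The underlying lifting of vector spaces. -/
def toLift (L : AlgLift p k A) : Lift p k A := (AlgLift.forget p k A).obj L

variable (L : AlgLift p k A)

/-- The symbol of an element of `A'`. -/
def symb (x : L.carrier) : L.toLift.Symb := L.toLift.symb x

theorem symb_teich_smul (c : k) (x : L.carrier) : L.symb (teich p c • x) = c • L.symb x :=
  L.toLift.symb_smul c x

theorem symb_add_smul (x y : L.carrier) :
    L.symb (x + (p : W₂ p k) • y) = L.symb x + L.symb ((p : W₂ p k) • y) :=
  L.toLift.symb_add x y

/-- The map `[x] ↦ [x mod p]`, with values in the degree `0` part of the DG algebra `A♭`. -/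
def symbA : L.toLift.Symb →ₗ[k] (flatA k A).cx.X 0 := L.toLift.symbA

/-- The map `[v, w] ↦ [x] + [y] - [x + y]` on the degree `1` part of the DG algebra `A♭`. -/
def symbB : (flatA k A).cx.X 1 →ₗ[k] L.toLift.Symb := L.toLift.symbB

theorem symbA_symb (x : L.carrier) : L.symbA (L.symb x) = gen₀ k (L.proj x) :=
  L.toLift.symbA_symb x

theorem symbB_gen (x y : L.carrier) : L.symbB (gen₁ k (L.proj x) (L.proj y)) =
    L.symb x + L.symb y - L.symb (x + y) :=
  L.toLift.symbB_gen x y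

theorem symb_hom_ext {L : AlgLift p k A} {N : Type u} [AddCommGroup N] [Module k N]
    {φ ψ : L.toLift.Symb →ₗ[k] N} (h : ∀ x, φ (L.symb x) = ψ (L.symb x)) : φ = ψ :=
  Symb.hom_ext h

/-- The universal property of the space of symbols. -/
def symbLift {N : Type u} [AddCommGroup N] [Module k N] (φ : L.carrier → N)
    (hs : ∀ (c : kˣ) x, φ (teich p (c : k) • x) = (c : k) • φ x)
    (hp : ∀ x y, φ (x + (p : W₂ p k) • y) = φ x + φ ((p : W₂ p k) • y)) :
    L.toLift.Symb →ₗ[k] N :=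
  L.toLift.symbLift φ hs hp

theorem symbLift_symb {N : Type u} [AddCommGroup N] [Module k N] (φ : L.carrier → N)
    (hs : ∀ (c : kˣ) x, φ (teich p (c : k) • x) = (c : k) • φ x)
    (hp : ∀ x y, φ (x + (p : W₂ p k) • y) = φ x + φ ((p : W₂ p k) • y)) (x : L.carrier) :
    L.symbLift φ hs hp (L.symb x) = φ x :=
  L.toLift.symbLift_symb φ hs hp x

/-- The product of symbols, `[x] [y] = [x y]`. -/
def symbMul : L.toLift.Symb →ₗ[k] L.toLift.Symb →ₗ[k] L.toLift.Symb :=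
  L.symbLift
    (fun x => L.symbLift (fun y => L.symb (x * y))
      (fun c y => by rw [mul_smul_comm, symb_teich_smul])
      (fun y z => by rw [mul_add, mul_smul_comm, symb_add_smul]))
    (fun c x => symb_hom_ext fun y => by
      rw [LinearMap.smul_apply, symbLift_symb, symbLift_symb, smul_mul_assoc, symb_teich_smul])
    (fun x z => symb_hom_ext fun y => by
      rw [LinearMap.add_apply, symbLift_symb, symbLift_symb, symbLift_symb, add_mul,
        smul_mul_assoc, symb_add_smul])

theorem symbMul_symb (x y : L.carrier) :
    L.symbMul (L.symb x) (L.symb y) = L.symb (x * y) := by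
  rw [symbMul, symbLift_symb, symbLift_symb]

@[elab_as_elim]
theorem symb_induction {P : L.toLift.Symb → Prop} (z : L.toLift.Symb) (hsymb : ∀ x, P (L.symb x))
    (hadd : ∀ y z, P y → P z → P (y + z)) (hsmul : ∀ (c : k) z, P z → P (c • z)) : P z :=
  L.toLift.symb_induction z hsymb hadd hsmul

instance : Ring L.toLift.Symb where
  __ := (inferInstance : AddCommGroup L.toLift.Symb)
  mul x y := L.symbMul x y
  one := L.symb 1
  left_distrib x y z := map_add (L.symbMul x) y z
  right_distrib x y z := LinearMap.map_add₂ L.symbMul x y z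
  zero_mul x := LinearMap.map_zero₂ L.symbMul x
  mul_zero x := map_zero (L.symbMul x)
  mul_assoc x y z := by
    change L.symbMul (L.symbMul x y) z = L.symbMul x (L.symbMul y z)
    induction x using symb_induction with
    | hadd a b ha hb => simp only [map_add, LinearMap.add_apply, ha, hb]
    | hsmul c a ha => simp only [map_smul, LinearMap.smul_apply, ha]
    | hsymb x =>
    induction y using symb_induction with
    | hadd a b ha hb => simp only [map_add, LinearMap.add_apply, ha, hb]
    | hsmul c a ha => simp only [map_smul, LinearMap.smul_apply, ha]
    | hsymb y =>
    induction z using symb_induction with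
    | hadd a b ha hb => simp only [map_add, ha, hb]
    | hsmul c a ha => simp only [map_smul, ha]
    | hsymb z => rw [symbMul_symb, symbMul_symb, symbMul_symb, symbMul_symb, mul_assoc]
  one_mul x := by
    change L.symbMul (L.symb 1) x = x
    induction x using symb_induction with
    | hadd a b ha hb => rw [map_add, ha, hb]
    | hsmul c a ha => rw [map_smul, ha]
    | hsymb x => rw [symbMul_symb, one_mul]
  mul_one x := by
    change L.symbMul x (L.symb 1) = x
    induction x using symb_induction with
    | hadd a b ha hb => rw [map_add, LinearMap.add_apply, ha, hb]
    | hsmul c a ha => rw [map_smul, LinearMap.smul_apply, ha]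
    | hsymb x => rw [symbMul_symb, mul_one]

instance : Algebra k L.toLift.Symb :=
  Algebra.ofModule (fun c x y => LinearMap.map_smul₂ L.symbMul c x y)
    (fun c x y => map_smul (L.symbMul x) c y)

theorem symb_mul (x y : L.carrier) : L.symb (x * y) = L.symb x * L.symb y :=
  (L.symbMul_symb x y).symm

theorem symb_one : L.symb 1 = 1 := rfl

theorem symbA_one : L.symbA 1 = (flatA k A).one := by
  rw [← symb_one, symbA_symb, map_one]
  rfl

theorem symbA_mul (x y : L.toLift.Symb) : L.symbA (x * y) =
    (flatA k A).mul (zero_add 0) (L.symbA x) (L.symbA y) := by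
  induction x using symb_induction with
  | hadd a b ha hb => rw [add_mul, map_add, ha, hb, map_add, map_add, LinearMap.add_apply]
  | hsmul c a ha => rw [smul_mul_assoc, map_smul, ha, map_smul, map_smul, LinearMap.smul_apply]
  | hsymb x =>
  induction y using symb_induction with
  | hadd a b ha hb => rw [mul_add, map_add, ha, hb, map_add, map_add]
  | hsmul c a ha => rw [mul_smul_comm, map_smul, ha, map_smul, map_smul]
  | hsymb y =>
  rw [← symb_mul, symbA_symb, symbA_symb, symbA_symb, map_mul, mul_gen₀_gen₀]

/-- For a symbol [x] and lifts y, z of v, w, both sides are [x y] + [x z] − [x (y + z)], by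
distributivity in A'; bilinearity does the rest. -/
theorem symbB_left (x : L.toLift.Symb) (m : (flatA k A).cx.X 1) :
    L.symbB ((flatA k A).mul (zero_add 1) (L.symbA x) m) =
      x * L.symbB m := by
  induction x using symb_induction with
  | hadd a b ha hb => rw [add_mul, ← ha, ← hb, map_add, map_add, LinearMap.add_apply, map_add]
  | hsmul c a ha => rw [smul_mul_assoc, ← ha, map_smul, map_smul, LinearMap.smul_apply, map_smul]
  | hsymb x =>
  have : L.symbB ∘ₗ (flatA k A).mul (zero_add 1) (L.symbA (L.symb x)) =
      L.symbMul (L.symb x) ∘ₗ L.symbB := by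
    refine hom_ext₁ fun v w => ?_
    obtain ⟨y, rfl⟩ := L.surjective v
    obtain ⟨z, rfl⟩ := L.surjective w
    rw [LinearMap.comp_apply, LinearMap.comp_apply, symbA_symb, mul_gen₀_gen₁, ← map_mul,
      ← map_mul, symbB_gen, symbB_gen, map_sub, map_add, symbMul_symb, symbMul_symb,
      symbMul_symb, mul_add]
  exact LinearMap.congr_fun this m

theorem symbB_right (x : L.toLift.Symb) (m : (flatA k A).cx.X 1) :
    L.symbB ((flatA k A).mul (add_zero 1) m (L.symbA x)) =
      L.symbB m * x := by
  induction x using symb_induction with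
  | hadd a b ha hb => rw [mul_add, ← ha, ← hb, map_add, map_add, map_add]
  | hsmul c a ha => rw [mul_smul_comm, ← ha, map_smul, map_smul, map_smul]
  | hsymb x =>
  have : L.symbB ∘ₗ ((flatA k A).mul (add_zero 1)).flip (L.symbA (L.symb x)) =
      L.symbMul.flip (L.symb x) ∘ₗ L.symbB := by
    refine hom_ext₁ fun v w => ?_
    obtain ⟨y, rfl⟩ := L.surjective v
    obtain ⟨z, rfl⟩ := L.surjective w
    rw [LinearMap.comp_apply, LinearMap.comp_apply, symbA_symb, LinearMap.flip_apply,
      mul_gen₁_gen₀, ← map_mul, ← map_mul, symbB_gen, symbB_gen, map_sub, map_add,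
      LinearMap.flip_apply,
      LinearMap.flip_apply, LinearMap.flip_apply, symbMul_symb, symbMul_symb, symbMul_symb, add_mul]
  exact LinearMap.congr_fun this m

/-- Functoriality of the algebra of symbols. -/
def symbAlgHom {B : Type u} [Ring B] [Algebra k B] {L : AlgLift p k A} {M : AlgLift p k B}
    {f : A →ₗ[k] B} (φ : L.carrier →ₐ[W₂ p k] M.carrier)
    (hφ : ∀ x, M.proj (φ x) = f (L.proj x)) : L.toLift.Symb →ₐ[k] M.toLift.Symb :=
  AlgHom.ofLinearMap (symbMap (L := L.toLift) (M := M.toLift) (f := f) ⟨φ.toLinearMap, hφ⟩)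
    ((symbMap_symb (L := L.toLift) (M := M.toLift) (f := f) ⟨φ.toLinearMap, hφ⟩
      (1 : L.carrier)).trans (congrArg M.symb (map_one φ)))
    (fun x y => by
      have h : ∀ z : L.carrier, symbMap (L := L.toLift) (M := M.toLift) (f := f)
          ⟨φ.toLinearMap, hφ⟩ (L.symb z) = M.symb (φ z) := fun z => symbMap_symb ..
      induction x using symb_induction with
      | hadd a b ha hb => rw [add_mul, map_add, ha, hb, map_add, add_mul]
      | hsmul c a ha => rw [smul_mul_assoc, map_smul, ha, map_smul, smul_mul_assoc]
      | hsymb x =>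
      induction y using symb_induction with
      | hadd a b ha hb => rw [mul_add, map_add, ha, hb, map_add, mul_add]
      | hsmul c a ha => rw [mul_smul_comm, map_smul, ha, map_smul, mul_smul_comm]
      | hsymb y => rw [← symb_mul, h, h, h, map_mul, symb_mul])

variable [CharP k p] [Finite k]

theorem symb_injective : Function.Injective L.symb := L.toLift.symb_injective

/-- The multiplicative splitting of `A♭` defined by an algebra lifting of `A`. -/
def toMulSpl : MulSpl (flatA k A) where
  carrier := L.toLift.Symb
  a := L.symbA
  b := L.symbB
  isSplitting := L.toLift.isSplitting
  map_one := L.symbA_one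
  map_mul := L.symbA_mul
  left := L.symbB_left
  right := L.symbB_right

end AlgLift

/-! ### The equivalence of algebra liftings with multiplicative splittings -/

namespace AlgLift

open FlatA Lift

variable {p : ℕ} [Fact p.Prime] {k : Type u} [Field k] {A : Type u} [Ring A] [Algebra k A]
  {L M : AlgLift p k A}

theorem symbAlgHom_symb {B : Type u} [Ring B] [Algebra k B] {L : AlgLift p k A} {M : AlgLift p k B}
    {f : A →ₗ[k] B} (φ : L.carrier →ₐ[W₂ p k] M.carrier)
    (hφ : ∀ x, M.proj (φ x) = f (L.proj x)) (x : L.carrier) :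
    symbAlgHom φ hφ (L.symb x) = M.symb (φ x) :=
  symbMap_symb (L := L.toLift) (M := M.toLift) (f := f) ⟨φ.toLinearMap, hφ⟩ x

/-- The isomorphism of the algebras of symbols defined by an isomorphism of algebra liftings. -/
def symbAlgEquiv (g : L ⟶ M) : L.toLift.Symb ≃ₐ[k] M.toLift.Symb :=
  AlgEquiv.ofLinearEquiv (symbEquiv ((AlgLift.forget p k A).map g))
    (map_one (symbAlgHom (f := LinearMap.id) g.e.toAlgHom g.comm))
    (map_mul (symbAlgHom (f := LinearMap.id) g.e.toAlgHom g.comm))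

theorem symbAlgEquiv_symb (g : L ⟶ M) (x : L.carrier) :
    symbAlgEquiv g (L.symb x) = M.symb (g.e x) :=
  symbEquiv_symb ((AlgLift.forget p k A).map g) x

theorem algEquiv_ext {B : Type u} [Ring B] [Algebra k B] {e f : L.toLift.Symb ≃ₐ[k] B}
    (h : ∀ x, e (L.symb x) = f (L.symb x)) : e = f :=
  AlgEquiv.ext fun z => LinearMap.congr_fun
    (symb_hom_ext (φ := e.toLinearMap) (ψ := f.toLinearMap) h) z

variable [CharP k p] [Finite k]

variable (p k A) in
/-- The functor from algebra liftings to multiplicative splittings. -/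
def mulSplFunctor : AlgLift p k A ⥤ MulSpl (flatA k A) where
  obj L := L.toMulSpl
  map g := MulSpl.Hom.mk (symbAlgEquiv g)
    (fun z => symbA_symbEquiv ((AlgLift.forget p k A).map g) z)
    (fun m => symbEquiv_symbB ((AlgLift.forget p k A).map g) m)
  map_id L := MulSpl.Hom.ext (algEquiv_ext fun x => symbAlgEquiv_symb (𝟙 L) x)
  map_comp g h := MulSpl.Hom.ext (algEquiv_ext fun x => (symbAlgEquiv_symb (g ≫ h) x).trans
    ((congrArg (symbAlgEquiv h) (symbAlgEquiv_symb g x)).trans (symbAlgEquiv_symb h _)).symm)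

variable (p k A) in
/-- The two functors from liftings to splittings are compatible. -/
def forgetIso : mulSplFunctor p k A ⋙ forgetFlat k A ≅
    AlgLift.forget p k A ⋙ splFunctor p k A :=
  NatIso.ofComponents (fun L => (Groupoid.isoEquivHom _ _).symm
      (Spl.Hom.mk (LinearEquiv.refl k L.toLift.Symb) (fun _ => rfl) (fun _ => rfl)))
    (fun _ => rfl)

instance : (mulSplFunctor p k A).Faithful where
  map_injective {L M g h} e := by
    refine Hom.ext (AlgEquiv.ext fun x => M.symb_injective ?_)
    rw [← symbAlgEquiv_symb, ← symbAlgEquiv_symb]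
    exact AlgEquiv.congr_fun (congrArg MulSpl.Hom.e e) (L.symb x)

/-- The linear isomorphism g is characterized by [g x] = e [x]. Symbols are multiplicative and
injective, so g inherits multiplicativity and the unit from e. -/
theorem exists_algEquiv (e : L.toLift.Symb ≃ₐ[k] M.toLift.Symb)
    (ha : ∀ z, M.symbA (e z) = L.symbA z) (hb : ∀ m, e (L.symbB m) = M.symbB m) :
    ∃ g : L.carrier ≃ₐ[W₂ p k] M.carrier,
      (∀ x, M.proj (g x) = L.proj x) ∧ ∀ x, M.symb (g x) = e (L.symb x) := by
  obtain ⟨g, hg, hg'⟩ := exists_linearEquiv (L := L.toLift) (M := M.toLift) e.toLinearEquiv ha hb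
  let g₁ : L.carrier ≃ₗ[W₂ p k] M.carrier := g
  have h : ∀ x, M.symb (g₁ x) = e (L.symb x) := hg'
  refine ⟨AlgEquiv.ofLinearEquiv g₁ (M.symb_injective ?_) (fun x y => M.symb_injective ?_), hg, hg'⟩
  · rw [h, symb_one, symb_one, map_one]
  · rw [h, symb_mul, symb_mul, h, h, map_mul]

instance : (mulSplFunctor p k A).Full where
  map_surjective {L M} e := by
    obtain ⟨g, hg, hg'⟩ := exists_algEquiv (L := L) (M := M) e.e e.comm_a e.comm_b
    exact ⟨Hom.mk g hg, MulSpl.Hom.ext (algEquiv_ext fun x =>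
      (symbAlgEquiv_symb (Hom.mk g hg) x).trans (hg' x))⟩

/-- A product on a lifting of `A` is the same as a product on the corresponding splitting. -/
theorem exists_algLift (S : MulSpl (flatA k A)) (L : Lift p k A) (e : L.Symb ≃ₗ[k] S.carrier)
    (ha : ∀ z, S.a (e z) = L.symbA z) (hb : ∀ m : (flatA k A).cx.X 1, e (L.symbB m) = S.b m) :
    ∃ (A' : AlgLift p k A) (e' : A'.toLift.Symb ≃ₗ[k] S.carrier),
      (∀ z, S.a (e' z) = A'.symbA z) ∧ (∀ m, e' (A'.symbB m) = S.b m) ∧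
      e' (A'.symb 1) = 1 ∧ ∀ x y, e' (A'.symb (x * y)) = e' (A'.symb x) * e' (A'.symb y) := by
  -- This embedding identifies the lifting with the elements of the splitting over the generators
  -- [v].
  let ι : L.carrier → S.carrier := fun x => e (L.symb x)
  have ι_inj : ∀ {x y}, ι x = ι y → x = y := fun h => L.symb_injective (e.injective h)
  have ι_a : ∀ x, S.a (ι x) = gen₀ k (L.proj x) := fun x => (ha _).trans (L.symbA_symb x)
  have ι_proj : ∀ {x v}, S.a (ι x) = gen₀ k v → L.proj x = v := fun {x v} h =>
    gen₀_injective (k := k) ((ι_a x).symm.trans h)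
  have ι_surj : ∀ {z v}, S.a z = gen₀ k v → ∃ x, ι x = z := by
    intro z v h
    obtain ⟨x, hx⟩ := L.exists_symb_eq (z := e.symm z) (v := v)
      ((ha _).symm.trans (by rw [e.apply_symm_apply, h]; rfl))
    exact ⟨x, by simp only [ι]; rw [hx, e.apply_symm_apply]⟩
  have ι_b : ∀ x y, S.b (gen₁ k (L.proj x) (L.proj y)) = ι x + ι y - ι (x + y) := by
    intro x y
    rw [← hb]
    refine (congrArg e (L.symbB_gen x y)).trans ?_
    rw [map_sub, map_add]
  have ι_smul : ∀ (c : k) x, ι (teich p c • x) = c • ι x := fun c x => by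
    simp only [ι]
    rw [symb_smul, map_smul]
  have ι_mul_a : ∀ x y, S.a (ι x * ι y) = gen₀ k (L.proj x * L.proj y) := fun x y => by
    rw [S.map_mul, ι_a, ι_a, mul_gen₀_gen₀]
  -- The map a is multiplicative and [v][w] = [v w], so the image of ι is closed under products and
  -- contains 1; m and o are the transported product and unit.
  choose m hm using fun x y => ι_surj (ι_mul_a x y)
  obtain ⟨o, ho⟩ := ι_surj (S.map_one.trans one_eq)
  have m_proj : ∀ x y, L.proj (m x y) = L.proj x * L.proj y := fun x y => ι_proj (by
    rw [hm, ι_mul_a])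
  have o_proj : L.proj o = 1 := ι_proj (by rw [ho, S.map_one, one_eq])
  -- Distributivity on the left is linearity of b over the left action: the defect b of (x y, x z)
  -- equals ι(x) times the defect b of (y, z).
  have m_add : ∀ x y z, m x (y + z) = m x y + m x z := by
    intro x y z
    apply ι_inj
    have h₁ := ι_b (m x y) (m x z)
    have h₂ := S.left (ι x) (gen₁ k (L.proj y) (L.proj z))
    rw [ι_a, mul_gen₀_gen₁, ← m_proj, ← m_proj, h₁, ι_b, mul_sub, mul_add, ← hm, ← hm, ← hm] at h₂
    exact (sub_right_injective h₂).symm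
  have add_m : ∀ x y z, m (x + y) z = m x z + m y z := by
    intro x y z
    apply ι_inj
    have h₁ := ι_b (m x z) (m y z)
    have h₂ := S.right (ι z) (gen₁ k (L.proj x) (L.proj y))
    rw [ι_a, mul_gen₁_gen₀, ← m_proj, ← m_proj, h₁, ι_b, sub_mul, add_mul, ← hm, ← hm, ← hm] at h₂
    exact (sub_right_injective h₂).symm
  -- By additivity only Teichmüller scalars need to be checked, and these act through k on the
  -- splitting.
  have smul_m : ∀ (w : W₂ p k) x y, m (w • x) y = w • m x y := fun w x y =>
    map_smul_of_teich (AddMonoidHom.mk' (fun x => m x y) (fun x x' => add_m x x' y))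
      (fun c x => ι_inj (by
        rw [AddMonoidHom.mk'_apply, hm, ι_smul, ι_smul, hm,
          smul_mul_assoc])) w x
  have m_smul : ∀ (w : W₂ p k) x y, m x (w • y) = w • m x y := fun w x y =>
    map_smul_of_teich (AddMonoidHom.mk' (m x) (m_add x))
      (fun c y => ι_inj (by
        rw [AddMonoidHom.mk'_apply, hm, ι_smul, ι_smul, hm,
          mul_smul_comm])) w y
  let R : Ring L.carrier :=
    { L.addCommGroup with
      mul := m
      one := o
      left_distrib := m_add
      right_distrib := add_m
      zero_mul := fun x => by
        have := smul_m 0 0 x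
        rwa [zero_smul, zero_smul] at this
      mul_zero := fun x => by
        have := m_smul 0 x 0
        rwa [zero_smul, zero_smul] at this
      mul_assoc := fun x y z => ι_inj (show ι (m (m x y) z) = ι (m x (m y z)) by
        rw [hm, hm, hm, hm, mul_assoc])
      one_mul := fun x => ι_inj (show ι (m o x) = ι x by rw [hm, ho, one_mul])
      mul_one := fun x => ι_inj (show ι (m x o) = ι x by rw [hm, ho, mul_one]) }
  let R' : Algebra (W₂ p k) L.carrier :=
    @Algebra.ofModule (W₂ p k) L.carrier _ R.toSemiring L.module smul_m m_smul
  let A' : AlgLift p k A :=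
    { carrier := L.carrier
      ring := R
      algebra := R'
      flat := L.flat
      proj :=
        { toFun := L.proj
          map_add' := map_add L.proj
          map_zero' := map_zero L.proj
          map_one' := o_proj
          map_mul' := m_proj }
      proj_algebraMap := fun w => by
        change L.proj (w • o) = _
        rw [LinearMap.map_smulₛₗ, o_proj, Algebra.algebraMap_eq_smul_one]
      surjective := L.surjective
      ker := L.ker }
  exact ⟨A', e, ha, hb, ho, hm⟩

/-- Forgetting the product, the splitting comes from a lifting of the vector space A; the product is
then transported to that lifting. -/
instance : (mulSplFunctor p k A).EssSurj where
  mem_essImage S := by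
    obtain ⟨L⟩ := nonempty_lift (p := p) (k := k) A
    obtain ⟨f⟩ := Spl.nonempty_hom L.toSpl ((forgetFlat k A).obj S)
    obtain ⟨A', e, ha, hb, h1, hm⟩ := exists_algLift S L f.e f.comm_a f.comm_b
    have hmul : ∀ x y, e (x * y) = e x * e y := by
      intro x y
      induction x using symb_induction with
      | hadd a b ha hb => rw [add_mul, map_add, ha, hb, map_add, add_mul]
      | hsmul c a ha => rw [smul_mul_assoc, map_smul, ha, map_smul, smul_mul_assoc]
      | hsymb x =>
      induction y using symb_induction with
      | hadd a b ha hb => rw [mul_add, map_add, ha, hb, map_add, mul_add]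
      | hsmul c a ha => rw [mul_smul_comm, map_smul, ha, map_smul, mul_smul_comm]
      | hsymb y => rw [← symb_mul, hm]
    exact ⟨A', ⟨(Groupoid.isoEquivHom _ _).symm
      (MulSpl.Hom.mk (AlgEquiv.ofLinearEquiv e h1 hmul) ha hb)⟩⟩

instance : (mulSplFunctor p k A).IsEquivalence where

end AlgLift

/-! ### Replacing the degree 0 term of a DG algebra -/

namespace DGAlg

variable {k : Type u} [Field k]

/-- A replacement of the degree `0` part of a DG algebra `B`: an algebra `K` with an algebra map
`a : K → B₀` through which the differential `B₁ → B₀` factors by a map of `K`-bimodules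
`b : B₁ → K` that vanishes on boundaries. -/
structure Replacement (B : DGAlg k) where
  /-- the algebra `K` -/
  carrier : Type u
  [ring : Ring carrier]
  [algebra : Algebra k carrier]
  /-- the map `K → B₀` -/
  a : carrier →ₗ[k] B.cx.X 0
  /-- the map `B₁ → K` -/
  b : B.cx.X 1 →ₗ[k] carrier
  comp : ∀ m, a (b m) = (B.cx.d 1 0).hom m
  b_d : ∀ x, b ((B.cx.d 2 1).hom x) = 0
  map_one : a 1 = B.one
  map_mul : ∀ x y, a (x * y) = B.mul (zero_add 0) (a x) (a y)
  left : ∀ x m, b (B.mul (zero_add 1) (a x) m) = x * b m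
  right : ∀ x m, b (B.mul (add_zero 1) m (a x)) = b m * x

attribute [instance] Replacement.ring Replacement.algebra

namespace Replacement

variable {B C : DGAlg k} (R : Replacement B) (S : Replacement C)

/-- The terms of the modified DG algebra. -/
def X : ℕ → ModuleCat.{u} k
  | 0 => ModuleCat.of k R.carrier
  | n + 1 => B.cx.X (n + 1)

/-- The projection to the original DG algebra. -/
def toTerm : ∀ n : ℕ, R.X n →ₗ[k] B.cx.X n
  | 0 => R.a
  | n + 1 => (LinearMap.id : B.cx.X (n + 1) →ₗ[k] B.cx.X (n + 1))

/-- The differential. -/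
def δ : ∀ n : ℕ, R.X (n + 1) →ₗ[k] R.X n
  | 0 => R.b
  | n + 1 => (B.cx.d (n + 2) (n + 1)).hom

/-- The product. -/
def product : ∀ i j n : ℕ, i + j = n → (R.X i →ₗ[k] R.X j →ₗ[k] R.X n)
  | 0, 0, 0, _ => LinearMap.mul k R.carrier
  | i, j, _ + 1, h => (B.mul h).compl₁₂ (R.toTerm i) (R.toTerm j)
  | _ + 1, _, 0, _ => 0
  | 0, _ + 1, 0, _ => 0

/-- In positive degrees the projection to B is the identity, so identities there can be checked in
B. Only those with values in degree 0 need the structure of K. -/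
theorem toTerm_injective (n : ℕ) : Function.Injective (R.toTerm (n + 1)) := fun _ _ h => h

theorem toTerm_δ (n : ℕ) (x : R.X (n + 1)) :
    R.toTerm n (R.δ n x) = (B.cx.d (n + 1) n).hom (R.toTerm (n + 1) x) := by
  cases n with
  | zero => exact R.comp x
  | succ n => rfl

theorem toTerm_product {i j n : ℕ} (h : i + j = n) (x : R.X i) (y : R.X j) :
    R.toTerm n (R.product i j n h x y) = B.mul h (R.toTerm i x) (R.toTerm j y) := by
  cases n with
  | zero =>
    obtain ⟨rfl, rfl⟩ : i = 0 ∧ j = 0 := by omega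
    exact R.map_mul x y
  | succ n =>
    rcases i with _ | i
    · rcases j with _ | j <;> rfl
    · rfl

theorem δ_δ (n : ℕ) (x : R.X (n + 2)) : R.δ n (R.δ (n + 1) x) = 0 := by
  cases n with
  | zero => exact R.b_d x
  | succ n => exact d_d_apply B.cx _ _ _ x

/-- The differential, as a morphism. -/
def δHom (n : ℕ) : R.X (n + 1) ⟶ R.X n := ModuleCat.ofHom (R.δ n)

/-- The complex of the modified DG algebra. -/
def cx : ChainComplex (ModuleCat.{u} k) ℕ :=
  ChainComplex.of R.X R.δHom
    (fun n => ModuleCat.hom_ext (LinearMap.ext fun x => R.δ_δ n x))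

theorem cx_d (n : ℕ) : R.cx.d (n + 1) n = R.δHom n :=
  ChainComplex.of_d R.X R.δHom n

theorem cx_d_apply (n : ℕ) (x : R.X (n + 1)) : (R.cx.d (n + 1) n).hom x = R.δ n x := by
  rw [cx_d]
  rfl

theorem product_assoc {i j l ij jl n : ℕ} (h₁ : i + j = ij) (h₂ : j + l = jl) (h₃ : ij + l = n)
    (h₄ : i + jl = n) (x : R.X i) (y : R.X j) (z : R.X l) :
    R.product ij l n h₃ (R.product i j ij h₁ x y) z =
      R.product i jl n h₄ x (R.product j l jl h₂ y z) := by
  cases n with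
  | zero =>
    obtain ⟨rfl, rfl⟩ : ij = 0 ∧ l = 0 := by omega
    obtain ⟨rfl, rfl⟩ : i = 0 ∧ j = 0 := by omega
    obtain rfl : jl = 0 := by omega
    exact _root_.mul_assoc (G := R.carrier) x y z
  | succ n =>
    apply R.toTerm_injective
    simp only [toTerm_product]
    exact B.mul_assoc h₁ h₂ h₃ h₄ _ _ _

theorem δ_product {i j n : ℕ} (h : i + 1 + (j + 1) = n + 1) (h₁ : i + (j + 1) = n)
    (h₂ : i + 1 + j = n) (x : R.X (i + 1)) (y : R.X (j + 1)) :
    R.δ n (R.product (i + 1) (j + 1) (n + 1) h x y) =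
      R.product i (j + 1) n h₁ (R.δ i x) y +
        (-1 : k) ^ (i + 1) • R.product (i + 1) j n h₂ x (R.δ j y) := by
  -- The product of two elements of positive degree has boundary in positive degree, so the identity
  -- follows from that in B.
  obtain ⟨n, rfl⟩ : ∃ m, n = m + 1 := ⟨i + j, by omega⟩
  apply R.toTerm_injective
  simp only [map_add, map_smul, toTerm_product, toTerm_δ]
  exact B.d_mul h h₁ h₂ _ _

/-- The only case not inherited from B is that of an element of degree 1, where the Leibniz rule is
the right linearity of b. -/
theorem δ_product_zero {i n : ℕ} (h : i + 1 + 0 = n + 1) (h' : i + 0 = n) (x : R.X (i + 1))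
    (y : R.X 0) : R.δ n (R.product (i + 1) 0 (n + 1) h x y) = R.product i 0 n h' (R.δ i x) y := by
  cases n with
  | zero =>
    obtain rfl : i = 0 := by omega
    exact R.right y x
  | succ n =>
    apply R.toTerm_injective
    simp only [toTerm_product, toTerm_δ]
    exact B.d_mul_zero h h' _ _

theorem δ_zero_product {j n : ℕ} (h : 0 + (j + 1) = n + 1) (h' : 0 + j = n) (x : R.X 0)
    (y : R.X (j + 1)) : R.δ n (R.product 0 (j + 1) (n + 1) h x y) =
      R.product 0 j n h' x (R.δ j y) := by
  cases n with
  | zero =>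
    obtain rfl : j = 0 := by omega
    exact R.left x y
  | succ n =>
    apply R.toTerm_injective
    simp only [toTerm_product, toTerm_δ]
    exact B.d_zero_mul h h' _ _

theorem one_product {n : ℕ} (h : 0 + n = n) (x : R.X n) :
    R.product 0 n n h (1 : R.carrier) x = x := by
  cases n with
  | zero => exact _root_.one_mul (M := R.carrier) x
  | succ n =>
    apply R.toTerm_injective
    refine (R.toTerm_product h _ x).trans ?_
    exact (congrArg (fun t => B.mul h t _) R.map_one).trans (B.one_mul h _)

theorem product_one {n : ℕ} (h : n + 0 = n) (x : R.X n) :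
    R.product n 0 n h x (1 : R.carrier) = x := by
  cases n with
  | zero => exact _root_.mul_one (M := R.carrier) x
  | succ n =>
    apply R.toTerm_injective
    refine (R.toTerm_product h x _).trans ?_
    exact (congrArg (B.mul h _) R.map_one).trans (B.mul_one h _)

/-- The DG algebra with the replaced degree `0` part. -/
def dgAlg : DGAlg k where
  cx := R.cx
  one := (1 : R.carrier)
  mul {i j n} h := R.product i j n h
  one_mul h x := R.one_product h x
  mul_one h x := R.product_one h x
  mul_assoc h₁ h₂ h₃ h₄ x y z := R.product_assoc h₁ h₂ h₃ h₄ x y z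
  d_mul h h₁ h₂ x y := by
    rw [cx_d, cx_d, cx_d]
    exact R.δ_product h h₁ h₂ x y
  d_mul_zero h h' x y := by
    rw [cx_d, cx_d]
    exact R.δ_product_zero h h' x y
  d_zero_mul h h' x y := by
    rw [cx_d, cx_d]
    exact R.δ_zero_product h h' x y

/-- The projection of the modified DG algebra to the original one. -/
def proj : R.dgAlg ⟶ B :=
  Hom.mk
    { f := fun n => ModuleCat.ofHom (R.toTerm n)
      comm' := fun i j h => by
        obtain rfl : j + 1 = i := h
        refine ModuleCat.hom_ext (LinearMap.ext fun x => ?_)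
        exact (R.toTerm_δ j x).symm.trans (congrArg (R.toTerm j) (R.cx_d_apply j x).symm) }
    R.map_one
    (fun h x y => R.toTerm_product h x y)

variable {R S}

/-- The terms of the map of modified DG algebras. -/
def mapTerm (φ : B ⟶ C) (f : R.carrier →ₐ[k] S.carrier) : ∀ n : ℕ, R.X n →ₗ[k] S.X n
  | 0 => f.toLinearMap
  | n + 1 => (φ.f.f (n + 1)).hom

theorem toTerm_mapTerm (φ : B ⟶ C) (f : R.carrier →ₐ[k] S.carrier)
    (ha : ∀ x, S.a (f x) = (φ.f.f 0).hom (R.a x)) (n : ℕ) (x : R.X n) :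
    S.toTerm n (mapTerm φ f n x) = (φ.f.f n).hom (R.toTerm n x) := by
  cases n with
  | zero => exact ha x
  | succ n => rfl

theorem mapTerm_product (φ : B ⟶ C) (f : R.carrier →ₐ[k] S.carrier)
    (ha : ∀ x, S.a (f x) = (φ.f.f 0).hom (R.a x)) {i j n : ℕ} (h : i + j = n) (x : R.X i)
    (y : R.X j) :
    mapTerm φ f n (R.product i j n h x y) =
      S.product i j n h (mapTerm φ f i x) (mapTerm φ f j y) := by
  cases n with
  | zero =>
    obtain ⟨rfl, rfl⟩ : i = 0 ∧ j = 0 := by omega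
    have hf : ∀ x y : R.carrier, f (x * y) = f x * f y := _root_.map_mul f
    exact hf x y
  | succ n =>
    apply S.toTerm_injective
    rw [toTerm_mapTerm φ f ha, toTerm_product, toTerm_product, toTerm_mapTerm φ f ha,
      toTerm_mapTerm φ f ha]
    exact φ.map_mul h _ _

theorem mapTerm_δ (φ : B ⟶ C) (f : R.carrier →ₐ[k] S.carrier)
    (hb : ∀ m, f (R.b m) = S.b ((φ.f.f 1).hom m)) (n : ℕ) (x : R.X (n + 1)) :
    S.δ n (mapTerm φ f (n + 1) x) = mapTerm φ f n (R.δ n x) := by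
  cases n with
  | zero => exact (hb x).symm
  | succ n => exact congrArg (fun g => g.hom x) (φ.f.comm (n + 2) (n + 1))

/-- Functoriality of the modified DG algebra. -/
def map (φ : B ⟶ C) (f : R.carrier →ₐ[k] S.carrier)
    (ha : ∀ x, S.a (f x) = (φ.f.f 0).hom (R.a x))
    (hb : ∀ m, f (R.b m) = S.b ((φ.f.f 1).hom m)) : R.dgAlg ⟶ S.dgAlg :=
  Hom.mk
    { f := fun n => ModuleCat.ofHom (mapTerm φ f n)
      comm' := fun i j h => by
        obtain rfl : j + 1 = i := h
        refine ModuleCat.hom_ext (LinearMap.ext fun x => ?_)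
        exact (S.cx_d_apply j _).trans ((mapTerm_δ φ f hb j x).trans
          (congrArg (mapTerm φ f j) (R.cx_d_apply j x).symm)) }
    (_root_.map_one f)
    (fun h x y => mapTerm_product φ f ha h x y)

theorem map_proj (φ : B ⟶ C) (f : R.carrier →ₐ[k] S.carrier)
    (ha : ∀ x, S.a (f x) = (φ.f.f 0).hom (R.a x))
    (hb : ∀ m, f (R.b m) = S.b ((φ.f.f 1).hom m)) : map φ f ha hb ≫ S.proj = R.proj ≫ φ :=
  hom_ext (HomologicalComplex.hom_ext _ _ fun n => ModuleCat.hom_ext (LinearMap.ext fun x =>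
    toTerm_mapTerm φ f ha n x))

/-- If `K / Im b ≅ A` and `B₂ → B₁ → K` and `B` in degrees `≥ 2` are exact, then the modified DG
algebra is a DG splitting. -/
theorem isDGSplitting {A : Type u} [Ring A] [Algebra k A] (q : B ⟶ single k A)
    (hsurj : ∀ y : A, ∃ x, (q.f.f 0).hom (R.a x) = y)
    (hker : ∀ x, (q.f.f 0).hom (R.a x) = (0 : A) → ∃ m, R.b m = x)
    (hone : ∀ m, R.b m = 0 → ∃ x, (B.cx.d 2 1).hom x = m)
    (hexact : ∀ n (x : B.cx.X (n + 2)), (B.cx.d (n + 2) (n + 1)).hom x = 0 →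
      ∃ y, (B.cx.d (n + 3) (n + 2)).hom y = x) :
    IsDGSplitting R.proj q := by
  have hsurj' : ∀ n, Function.Surjective ((R.proj ≫ q).f.f n).hom := by
    intro n
    cases n with
    | zero => exact hsurj
    | succ n => exact fun y => ⟨0, Subsingleton.elim (α := singleX k A (n + 1)) _ _⟩
  refine ⟨hsurj', (quasiIso_iff _).2 fun n => ?_⟩
  rcases n with _ | n
  -- In degree 0 the target is A with zero differentials, so the condition is exactness of B₁ → K →
  -- A together with surjectivity onto A.
  · rw [quasiIsoAt_iff' _ 1 0 0 (by simp) (by simp), ShortComplex.quasiIso_iff_of_zeros']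
    · refine ⟨?_, ?_⟩
      · rw [ShortComplex.moduleCat_exact_iff]
        intro x hx
        obtain ⟨m, hm⟩ := hker x hx
        exact ⟨m, (R.cx_d_apply 0 m).trans hm⟩
      · exact (ModuleCat.epi_iff_surjective _).2 (hsurj' 0)
    · exact R.dgAlg.cx.shape 0 0 (by simp)
    · rfl
    · rfl
  -- In positive degrees the target vanishes, and only exactness of the source is needed.
  · rw [quasiIsoAt_iff_exactAt', HomologicalComplex.exactAt_iff' _ (n + 2) (n + 1) n (by simp)
      (by simp), ShortComplex.moduleCat_exact_iff]
    · intro x hx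
      have hx' : R.δ n x = 0 := (R.cx_d_apply n x).symm.trans hx
      have : ∃ y, R.δ (n + 1) y = x := by
        cases n with
        | zero => exact hone x hx'
        | succ n => exact hexact n x hx'
      obtain ⟨y, hy⟩ := this
      exact ⟨y, (R.cx_d_apply (n + 1) y).trans hy⟩
    · rw [HomologicalComplex.exactAt_iff' _ (n + 2) (n + 1) n (by simp) (by simp),
        ShortComplex.moduleCat_exact_iff]
      intro x _
      exact ⟨0, Subsingleton.elim (α := singleX k A (n + 1)) _ _⟩

end Replacement

end DGAlg

/-! ### Comparison of Q̄_{≤1}(A) with A♭ -/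

section Truncation

variable (k : Type u) [Field k] (A : Type u) [Ring A] [Algebra k A]

/-- The projection `Q̄_{≤ 1}(A) → A♭`. -/
def truncToFlat : (QBarAlg k A).trunc 1 ⟶ flatA k A :=
  DGAlg.quotMap (𝟙 (QBarAlg k A)) ((QBarAlg k A).truncIdeal 1) (QBarAlg k A).flatIdeal
    (fun n x hx => by
      rcases n with _ | _ | n
      · exact hx
      · have hx0 : x = 0 := hx
        subst hx0
        exact Submodule.zero_mem _
      · trivial)

variable {k A}

theorem truncToFlat_surjective (n : ℕ) :
    Function.Surjective ((truncToFlat k A).f.f n).hom := by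
  intro y
  obtain ⟨y, rfl⟩ := Submodule.Quotient.mk_surjective (flatSub (QBarCx k A) n) y
  exact ⟨Submodule.Quotient.mk (p := truncSub (QBarCx k A) 1 n) y, rfl⟩

theorem truncToFlat_injective :
    Function.Injective ((truncToFlat k A).f.f 0).hom := by
  rw [injective_iff_map_eq_zero]
  intro x hx
  obtain ⟨x, rfl⟩ := Submodule.Quotient.mk_surjective (truncSub (QBarCx k A) 1 0) x
  exact (Submodule.Quotient.mk_eq_zero _).2
    ((Submodule.Quotient.mk_eq_zero (flatSub (QBarCx k A) 0)).1 hx)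

theorem exists_d_eq_of_truncToFlat {x : ((QBarAlg k A).trunc 1).cx.X 1}
    (hx : ((truncToFlat k A).f.f 1).hom x = 0) :
    ∃ y, (((QBarAlg k A).trunc 1).cx.d 2 1).hom y = x := by
  obtain ⟨x, rfl⟩ := Submodule.Quotient.mk_surjective (truncSub (QBarCx k A) 1 1) x
  obtain ⟨y, rfl⟩ : x ∈ LinearMap.range ((QBarCx k A).d 2 1).hom :=
    (Submodule.Quotient.mk_eq_zero (flatSub (QBarCx k A) 1)).1 hx
  exact ⟨Submodule.Quotient.mk (p := truncSub (QBarCx k A) 1 2) y, rfl⟩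

/-- In degree 2 the kernel of d has been divided out, and the terms above are zero. -/
theorem eq_zero_of_trunc_d {n : ℕ} {x : ((QBarAlg k A).trunc 1).cx.X (n + 2)}
    (hx : (((QBarAlg k A).trunc 1).cx.d (n + 2) (n + 1)).hom x = 0) : x = 0 := by
  obtain ⟨x, rfl⟩ := Submodule.Quotient.mk_surjective (truncSub (QBarCx k A) 1 (n + 2)) x
  refine (Submodule.Quotient.mk_eq_zero (truncSub (QBarCx k A) 1 (n + 2))).2 ?_
  cases n with
  | zero => exact (Submodule.Quotient.mk_eq_zero (truncSub (QBarCx k A) 1 1)).1 hx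
  | succ n => trivial

theorem truncToFlat_naturality {A B : AlgCat.{u} k} (g : A ⟶ B) (n : ℕ)
    (x : ((QBarAlg k A).trunc 1).cx.X n) :
    ((truncToFlat k B).f.f n).hom ((((QBarLE k 1).map g).f.f n).hom x) =
      ((flatVMap g.hom.toLinearMap).f n).hom (((truncToFlat k A).f.f n).hom x) := by
  obtain ⟨x, rfl⟩ := Submodule.Quotient.mk_surjective (truncSub (QBarCx k A) 1 n) x
  rfl

theorem aug_truncToFlat (x : ((QBarAlg k A).trunc 1).cx.X 0) :
    FlatV.aug k A (((truncToFlat k A).f.f 0).hom x) = ((augLE k 1 A).f.f 0).hom x := by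
  obtain ⟨x, rfl⟩ := Submodule.Quotient.mk_surjective (truncSub (QBarCx k A) 1 0) x
  rfl

/-- Modulo boundaries v ↦ [v] is linear, because [v] + [w] − [v + w] is a boundary. Its composition
with the augmentation is the quotient map, so Coker d = V. -/
theorem FlatV.exists_d_eq {V : Type u} [AddCommGroup V] [Module k V] {x : (flatV k V).X 0}
    (hx : FlatV.aug k V x = 0) : ∃ m, ((flatV k V).d 1 0).hom m = x := by
  let R := LinearMap.range ((flatV k V).d 1 0).hom
  let g : V →ₗ[k] (flatV k V).X 0 ⧸ R :=
    { toFun := fun v => R.mkQ (gen₀ k v)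
      map_add' := fun v w => by
        rw [← map_add, ← sub_eq_zero, ← map_sub]
        refine (Submodule.Quotient.mk_eq_zero R).2 ⟨-gen₁ k v w, ?_⟩
        rw [map_neg, d_gen₁]
        abel
      map_smul' := fun c v => by rw [gen₀_smul, map_smul, RingHom.id_apply] }
  have hg : g ∘ₗ FlatV.aug k V = R.mkQ :=
    hom_ext₀ fun v => congrArg g (aug_gen₀ v)
  have h : R.mkQ x = 0 := by rw [← hg, LinearMap.comp_apply, hx, map_zero]
  exact (Submodule.Quotient.mk_eq_zero R).1 h

end Truncation

/-! ### The DG splitting attached to an algebra lifting -/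

namespace AlgLift

variable {p : ℕ} [Fact p.Prime] {k : Type u} [Field k] {A : Type u} [Ring A] [Algebra k A]
  (L : AlgLift p k A)

/-- The map `[x] ↦ [x mod p]` with values in `Q̄_{≤ 1}(A)`. -/
def truncA : L.toLift.Symb →ₗ[k] ((QBarAlg k A).trunc 1).cx.X 0 :=
  (LinearEquiv.ofBijective ((truncToFlat k A).f.f 0).hom
    ⟨truncToFlat_injective, truncToFlat_surjective 0⟩).symm.toLinearMap ∘ₗ L.symbA

theorem truncToFlat_truncA (z : L.toLift.Symb) :
    ((truncToFlat k A).f.f 0).hom (L.truncA z) = L.symbA z :=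
  (LinearEquiv.ofBijective ((truncToFlat k A).f.f 0).hom
    ⟨truncToFlat_injective, truncToFlat_surjective 0⟩).apply_symm_apply _

/-- The map `Q̄₁(A) → A♭₁ → K₀₁`. -/
def truncB : ((QBarAlg k A).trunc 1).cx.X 1 →ₗ[k] L.toLift.Symb :=
  L.symbB ∘ₗ ((truncToFlat k A).f.f 1).hom

theorem symbA_symbB (m : (flatA k A).cx.X 1) :
    L.symbA (L.symbB m) = ((flatA k A).cx.d 1 0).hom m :=
  LinearMap.congr_fun L.toLift.symbA_comp_symbB m

/-- The algebra of symbols as a replacement of the degree `0` part of `Q̄_{≤ 1}(A)`. -/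
def replacement : DGAlg.Replacement ((QBarAlg k A).trunc 1) where
  carrier := L.toLift.Symb
  a := L.truncA
  b := L.truncB
  comp m := truncToFlat_injective <| by
    rw [truncToFlat_truncA, truncB, LinearMap.comp_apply, symbA_symbB]
    exact congrArg (fun g => g.hom m) ((truncToFlat k A).f.comm 1 0)
  b_d x := by
    have h : ((truncToFlat k A).f.f 1).hom ((((QBarAlg k A).trunc 1).cx.d 2 1).hom x) = 0 := by
      obtain ⟨x, rfl⟩ := Submodule.Quotient.mk_surjective (truncSub (QBarCx k A) 1 2) x
      exact (Submodule.Quotient.mk_eq_zero (flatSub (QBarCx k A) 1)).2 ⟨x, rfl⟩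
    rw [truncB, LinearMap.comp_apply, h, map_zero]
  map_one := truncToFlat_injective <| by
    rw [truncToFlat_truncA, symbA_one]
    exact (truncToFlat k A).map_one.symm
  map_mul x y := truncToFlat_injective <| by
    rw [truncToFlat_truncA, symbA_mul, (truncToFlat k A).map_mul, truncToFlat_truncA,
      truncToFlat_truncA]
  left x m := by
    rw [truncB, LinearMap.comp_apply, (truncToFlat k A).map_mul, truncToFlat_truncA, symbB_left]
    rfl
  right x m := by
    rw [truncB, LinearMap.comp_apply, (truncToFlat k A).map_mul, truncToFlat_truncA, symbB_right]
    rfl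

/-- In degree 1, injectivity of b reduces a cycle to the kernel of Q̄₁(A) → A♭₁, which consists of
boundaries. In degree 0, Coker b = Coker d = A. From degree 2 on the differential is injective. -/
theorem isDGSplitting_replacement [CharP k p] [Finite k] :
    DGAlg.IsDGSplitting L.replacement.proj (augLE k 1 A) := by
  have haug : ∀ z, ((augLE k 1 A).f.f 0).hom (L.truncA z) = FlatV.aug k A (L.symbA z) :=
    fun z => (aug_truncToFlat (k := k) (A := A) _).symm.trans
      (congrArg (FlatV.aug k A) (L.truncToFlat_truncA z))
  refine DGAlg.Replacement.isDGSplitting _ (fun y => ?_)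
    (fun (z : L.toLift.Symb) hz => ?_) (fun m hm => ?_)
    (fun n x hx => ⟨0, by rw [map_zero, eq_zero_of_trunc_d hx]⟩)
  · obtain ⟨x, rfl⟩ := L.surjective y
    refine ⟨L.symb x, (haug _).trans ?_⟩
    rw [symbA_symb]
    exact FlatV.aug_gen₀ (k := k) (V := A) _
  · obtain ⟨m, hm⟩ := FlatV.exists_d_eq (k := k) (V := A) ((haug z).symm.trans hz)
    -- An element z with zero augmentation has a(z) = d m. Then z − b(m) lies in Ker a = b(Ker d),
    -- so z lies in the image of b.
    have h : L.toLift.symbA (z - L.toLift.symbB m) = 0 := by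
      rw [map_sub]
      exact sub_eq_zero.2 (hm.symm.trans (L.symbA_symbB m).symm)
    obtain ⟨m', -, hm'⟩ := L.toLift.isSplitting.ker.surjOn h
    obtain ⟨t, ht⟩ := truncToFlat_surjective (k := k) (A := A) 1 (m' + m)
    refine ⟨t, (congrArg L.symbB ht).trans ?_⟩
    refine (map_add L.toLift.symbB m' m).trans ?_
    rw [hm', sub_add_cancel]
  · refine exists_d_eq_of_truncToFlat (L.toLift.symbB_injective ?_)
    exact hm.trans (map_zero _).symm

end AlgLift

/-! ### Functoriality of the DG splitting in pairs (A, A') -/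

namespace AlgWithLift

variable {p : ℕ} [Fact p.Prime] {k : Type u} [Field k]

section

variable {X Y : AlgWithLift p k} (φ : X ⟶ Y)

/-- The map of algebras of symbols defined by a map of algebras with liftings. -/
def symbAlgHom : X.lift.toLift.Symb →ₐ[k] Y.lift.toLift.Symb :=
  AlgLift.symbAlgHom (f := φ.base.hom.toLinearMap) φ.lift φ.comm

theorem symbAlgHom_symb (x : X.lift.carrier) :
    symbAlgHom φ (X.lift.symb x) = Y.lift.symb (φ.lift x) :=
  AlgLift.symbAlgHom_symb φ.lift φ.comm x

theorem truncA_symbAlgHom (z : X.lift.toLift.Symb) : Y.lift.truncA (symbAlgHom φ z) =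
    (((QBarLE k 1).map φ.base).f.f 0).hom (X.lift.truncA z) := by
  apply truncToFlat_injective
  refine (Y.lift.truncToFlat_truncA _).trans ?_
  refine (Lift.symbA_symbMap (L := X.lift.toLift) (M := Y.lift.toLift)
    (f := φ.base.hom.toLinearMap) ⟨φ.lift.toLinearMap, φ.comm⟩ z).trans ?_
  refine Eq.trans ?_ (truncToFlat_naturality φ.base 0 _).symm
  exact congrArg ((flatVMap φ.base.hom.toLinearMap).f 0).hom (X.lift.truncToFlat_truncA z).symm

theorem symbAlgHom_truncB (m : ((QBarAlg k X.base).trunc 1).cx.X 1) :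
    symbAlgHom φ (X.lift.truncB m) =
      Y.lift.truncB ((((QBarLE k 1).map φ.base).f.f 1).hom m) := by
  refine (Lift.symbMap_symbB (L := X.lift.toLift) (M := Y.lift.toLift)
    (f := φ.base.hom.toLinearMap) ⟨φ.lift.toLinearMap, φ.comm⟩ _).trans ?_
  exact congrArg Y.lift.symbB (truncToFlat_naturality φ.base 1 m).symm

end

variable (p k) in
/-- The functorial DG algebra `A_•` associated to an algebra with a flat lifting. -/
def resolution : AlgWithLift p k ⥤ DGAlg k where
  obj X := X.lift.replacement.dgAlg
  map {X Y} φ := DGAlg.Replacement.map (R := X.lift.replacement) (S := Y.lift.replacement)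
    ((QBarLE k 1).map φ.base) (symbAlgHom φ) (truncA_symbAlgHom φ) (symbAlgHom_truncB φ)
  map_id X := by
    refine DGAlg.hom_ext (HomologicalComplex.hom_ext _ _ fun n => ModuleCat.hom_ext ?_)
    cases n with
    | zero => exact AlgLift.symb_hom_ext (L := X.lift) fun x => symbAlgHom_symb (𝟙 X) x
    | succ n =>
      exact congrArg (fun g => (g.f.f (n + 1)).hom) ((QBarLE k 1).map_id X.base)
  map_comp {X Y Z} φ ψ := by
    refine DGAlg.hom_ext (HomologicalComplex.hom_ext _ _ fun n => ModuleCat.hom_ext ?_)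
    cases n with
    | zero =>
      exact AlgLift.symb_hom_ext (L := X.lift) fun x => (symbAlgHom_symb (φ ≫ ψ) x).trans
        ((congrArg (symbAlgHom ψ) (symbAlgHom_symb φ x)).trans (symbAlgHom_symb ψ _)).symm
    | succ n =>
      exact congrArg (fun g => (g.f.f (n + 1)).hom) ((QBarLE k 1).map_comp φ.base ψ.base)

variable (p k) in
/-- The functorial map `A_• → Q̄_{≤ 1}(A)`. -/
def resolutionProj : resolution p k ⟶ toAlg p k ⋙ QBarLE k 1 where
  app X := X.lift.replacement.proj
  naturality X Y φ := DGAlg.Replacement.map_proj (R := X.lift.replacement)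
    (S := Y.lift.replacement) ((QBarLE k 1).map φ.base) (symbAlgHom φ) (truncA_symbAlgHom φ)
    (symbAlgHom_truncB φ)

end AlgWithLift

end CubeConstruction
end

theorem lemma3p11 (p : ℕ) [Fact p.Prime] (k : Type u) [Field k] [Finite k] [CharP k p] :
    (∃ (e : ∀ (V : Type u) [AddCommGroup V] [Module k V],
          CubeConstruction.Lift p k V ≌ CubeConstruction.Spl (CubeConstruction.flatV k V))
      (t : ∀ {V W : Type u} [AddCommGroup V] [Module k V] [AddCommGroup W] [Module k W]
          (f : V →ₗ[k] W) {L : CubeConstruction.Lift p k V} {M : CubeConstruction.Lift p k W},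
          CubeConstruction.Lift.HomOver f L M →
            CubeConstruction.Spl.HomOver (CubeConstruction.flatVMap f)
              ((e V).functor.obj L) ((e W).functor.obj M)),
      -- the equivalences `e V` are functorial in `V`
      (∀ (V : Type u) [AddCommGroup V] [Module k V] {L M : CubeConstruction.Lift p k V}
          (g : L ⟶ M),
          (t LinearMap.id (CubeConstruction.Lift.Hom.toHomOver g)).φ =
            ((e V).functor.map g).e.toLinearMap) ∧
      (∀ {U V W : Type u} [AddCommGroup U] [Module k U] [AddCommGroup V] [Module k V]
          [AddCommGroup W] [Module k W] (f : U →ₗ[k] V) (g : V →ₗ[k] W)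
          {L : CubeConstruction.Lift p k U} {M : CubeConstruction.Lift p k V}
          {N : CubeConstruction.Lift p k W} (φ : CubeConstruction.Lift.HomOver f L M)
          (ψ : CubeConstruction.Lift.HomOver g M N),
          (t (g ∘ₗ f) (ψ.comp φ)).φ = (t g ψ).φ ∘ₗ (t f φ).φ) ∧
      -- for an algebra, they identify algebra liftings with multiplicative splittings
      (∀ (A : Type u) [Ring A] [Algebra k A],
          ∃ e' : CubeConstruction.AlgLift p k A ≌
              CubeConstruction.MulSpl (CubeConstruction.flatA k A),
            Nonempty (e'.functor ⋙ CubeConstruction.forgetFlat k A ≅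
              CubeConstruction.AlgLift.forget p k A ⋙ (e A).functor))) ∧
    -- a functorial DG splitting of `Q̄_{≤ 1}(A) → A` for every algebra with a flat lifting
    (∃ (D : CubeConstruction.AlgWithLift p k ⥤ CubeConstruction.DGAlg k)
      (s : D ⟶ CubeConstruction.AlgWithLift.toAlg p k ⋙ CubeConstruction.QBarLE k 1),
      ∀ X : CubeConstruction.AlgWithLift p k,
        CubeConstruction.DGAlg.IsDGSplitting (s.app X)
          (CubeConstruction.augLE k 1 X.base)) := by
  refine ⟨⟨fun V _ _ => (CubeConstruction.Lift.splFunctor p k V).asEquivalence,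
    fun f _ _ φ => CubeConstruction.Lift.HomOver.toSpl φ, fun V _ _ L M g => rfl,
    fun f g L M N φ ψ => CubeConstruction.Lift.symbMap_comp ψ φ,
    fun A _ _ => ⟨(CubeConstruction.AlgLift.mulSplFunctor p k A).asEquivalence,
      ⟨CubeConstruction.AlgLift.forgetIso p k A⟩⟩⟩,
    CubeConstruction.AlgWithLift.resolution p k, CubeConstruction.AlgWithLift.resolutionProj p k,
    fun X => X.lift.isDGSplitting_replacement⟩
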